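/- **Setting.** Let $\mathfrak H$ be a complex separable Hilbert space and let $Z=\{Z(h):h\in\mathfrak H\}$ be a complex isonormal Gaussian process over $\mathfrak H$, i.e. a centred jointly Gaussian complex family with $E[Z(g)\overline{Z(h)}]=\langle g,h\rangle$ (linear in $g$) and $E[Z(g)Z(h)]=0$. Let $(e_k)$ be an orthonormal basis of $\mathfrak H$. The Hilbert tensor product $\mathfrak H^{\otimes a}\otimes\mathfrak H^{\otimes b}$ has the orthonormal basis $e_{p_1}\otimes\cdots\otimes e_{p_a}\otimes\bar e_{q_1}\otimes\cdots\otimes\bar e_{q_b}$; write $f(p,q)$ for the coordinates of $f$, and let $\mathfrak H^{\odot a}\otimes\mathfrak H^{\odot b}$ be the subspace of those $f$ for which $f(p,q)$ is invariant under permutations of $p$ and under permutations of $q$. The complex Wiener–Itô integral $I_{a,b}$ is the continuous linear map into $L^2(\Omega)$ that sends each of these basis vectors to $\prod_k J_{a_k,b_k}(Z(e_k),1)$, where $a_k,b_k$ are the numbers of occurrences of $k$ in $p$ and in $q$, and $J_{a,b}(z,\rho)=\sum_{r=0}^{a\wedge b}(-1)^r r!\binom ar\binom br z^{a-r}\bar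 z^{\,b-r}\rho^r$ is the complex Hermite polynomial. For $f\in\mathfrak H^{\otimes a}\otimes\mathfrak H^{\otimes b}$, $g\in\mathfrak H^{\otimes c}\otimes\mathfrak H^{\otimes d}$, $0\le i\le a\wedge d$ and $0\le j\le b\wedge c$, the contraction $f\otimes_{i,j}g\in\mathfrak H^{\otimes(a+c-i-j)}\otimes\mathfrak H^{\otimes(b+d-i-j)}$ has the coordinates $$(f\otimes_{i,j}g)\big((p,p'),(q,q')\big)=\sum_{u,v} f\big((p,u),(q,v)\big)\,g\big((p',v),(q',u)\big),$$ where $u$ runs over the $i$-tuples and $v$ over the $j$-tuples of indices. Its symmetrization $f\tilde\otimes_{i,j}g$ is its average over all permutations of its $a+c-i-j$ unconjugated slots and all permutations of its $b+d-i-j$ conjugated slots. **Theorem.** Let $m,n\ge 0$ be fixed with $l=m+n\ge2$, let $F_k=I_{m,n}(f_k)$ with $f_k\in\mathfrak H^{\odot m}\otimes\mathfrak H^{\odot n}$, $k=1,2,\dots$, and let $h_k\in\mathfrak H^{\odot n}\otimes\mathfrak H^{\odot m}$ be the kernel of $\bar F_k$, i.e. $\bar F_k=I_{n,m}(h_k)$.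 Then the following are equivalent. (iii) $\|f_k\otimes_{i,j}f_k\|_{\mathfrak H^{\otimes 2(l-i-j)}}\to0$ for all $i,j\in\{0,\dots,m\wedge n\}$ with $0<i+j\le l-1$, and $\|f_k\otimes_{i,j}h_k\|_{\mathfrak H^{\otimes 2(l-i-j)}}\to0$ for all $0\le i\le m$, $0\le j\le n$ with $0<i+j\le l-1$. (iv) $\|f_k\tilde\otimes_{i,j}f_k\|_{\mathfrak H^{\otimes 2(l-i-j)}}\to0$ and $\|f_k\tilde\otimes_{i,j}h_k\|_{\mathfrak H^{\otimes 2(l-i-j)}}\to0$ for the same ranges of $(i,j)$. -/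

import Mathlib

open MeasureTheory ProbabilityTheory Filter Topology
open scoped ENNReal ComplexConjugate

noncomputable section

namespace ComplexWiener

/-! ### Complex isonormal Gaussian processes -/

/-- A complex isonormal Gaussian process over the complex Hilbert space `H`: a jointly Gaussian
centred complex family `Z h` with `E[Z g * conj (Z h)] = ⟨g, h⟩` (linear in `g`; Mathlib's inner
product is linear in its second argument) and `E[Z g * Z h] = 0`. This is the joint law of the
complexification `(X + i Y) / √2` of two independent real isonormal processes. -/
structure IsComplexIsonormal {H : Type*} [NormedAddCommGroup H] [InnerProductSpace ℂ H]
    {Ω : Type*} [MeasurableSpace Ω] (Z : H → Ω → ℂ) (P : Measure Ω) : Prop where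
  gaussian : IsGaussianProcess Z P
  mean : ∀ h, ∫ ω, Z h ω ∂P = 0
  covariance : ∀ g h, ∫ ω, Z g ω * conj (Z h ω) ∂P = inner ℂ h g
  pseudoCovariance : ∀ g h, ∫ ω, Z g ω * Z h ω ∂P = 0

/-! ### Kernels

Let `(e k)`, `k : ι`, be a Hilbert basis of `H`. The vectors
`e_{p 1} ⊗ ⋯ ⊗ e_{p m} ⊗ conj e_{q 1} ⊗ ⋯ ⊗ conj e_{q n}` form a Hilbert basis of the Hilbert
tensor product `H^{⊗ m} ⊗ H^{⊗ n}` (the last `n` slots being the conjugated ones), so an element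
of this space is its square-summable family of coordinates. -/

/-- The Hilbert tensor product `H^{⊗ α} ⊗ H^{⊗ β}`, in coordinates. The finite types `α` and `β`
index the slots without and with conjugation. The norm is the Hilbert norm. -/
abbrev TensorKernel (ι α β : Type*) : Type _ :=
  lp (fun _ : (α → ι) × (β → ι) => ℂ) 2

/-- Membership in `H^{⊙ α} ⊗ H^{⊙ β}`: the kernel is symmetric in the slots of either kind. -/
def TensorKernel.IsSymm {ι α β : Type*} (f : TensorKernel ι α β) : Prop :=
  ∀ (σ : Equiv.Perm α) (τ : Equiv.Perm β) (p : α → ι) (q : β → ι), f (p ∘ σ, q ∘ τ) = f (p, q)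

theorem memlp_comp {X Y : Type*} {F : Y → ℂ} (hF : Memℓp F 2) {φ : X → Y}
    (hφ : Function.Injective φ) : Memℓp (fun x => F (φ x)) 2 := by
  refine memℓp_gen ?_
  exact (hF.summable (by norm_num)).comp_injective hφ

theorem memlp_two_iff {X : Type*} {F : X → ℂ} : Memℓp F 2 ↔ Summable fun x => ‖F x‖ ^ 2 := by
  rw [memℓp_gen_iff (by norm_num)]
  simp

/-- Composition of two Hilbert–Schmidt kernels is Hilbert–Schmidt. -/
theorem memlp_tsum_mul {X Y W : Type*} {F : X × W → ℂ} {G : Y × W → ℂ}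
    (hF : Memℓp F 2) (hG : Memℓp G 2) :
    Memℓp (fun z : X × Y => ∑' w, F (z.1, w) * G (z.2, w)) 2 := by
  rw [memlp_two_iff] at hF hG ⊢
  have hFs := hF.prod
  have hGs := hG.prod
  have key := hFs.mul_of_nonneg hGs (fun x => tsum_nonneg fun w => by positivity)
    (fun x => tsum_nonneg fun w => by positivity)
  refine Summable.of_nonneg_of_le (fun z => by positivity) (fun z => ?_) key
  have h1 : Summable fun w => ‖F (z.1, w)‖ ^ (2 : ℝ) := by simpa using hF.prod_factor z.1
  have h2 : Summable fun w => ‖G (z.2, w)‖ ^ (2 : ℝ) := by simpa using hG.prod_factor z.2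
  have hpq : Real.HolderConjugate 2 2 := Real.HolderConjugate.two_two
  have hs := Real.summable_mul_of_Lp_Lq_of_nonneg hpq
    (fun w => norm_nonneg (F (z.1, w))) (fun w => norm_nonneg (G (z.2, w))) h1 h2
  have hle := Real.inner_le_Lp_mul_Lq_tsum_of_nonneg hpq
    (fun w => norm_nonneg (F (z.1, w))) (fun w => norm_nonneg (G (z.2, w))) h1 h2
  have hn : ‖∑' w, F (z.1, w) * G (z.2, w)‖ ≤ ∑' w, ‖F (z.1, w)‖ * ‖G (z.2, w)‖ := by
    have hs' : Summable fun w => ‖F (z.1, w) * G (z.2, w)‖ := by simpa using hs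
    simpa using norm_tsum_le_tsum_norm hs'
  have hA : 0 ≤ ∑' w, ‖F (z.1, w)‖ ^ 2 := tsum_nonneg fun w => by positivity
  have hB : 0 ≤ ∑' w, ‖G (z.2, w)‖ ^ 2 := tsum_nonneg fun w => by positivity
  have hle' := hn.trans hle
  simp only [Real.rpow_two, ← Real.sqrt_eq_rpow] at hle'
  calc _ ≤ (√(∑' w, ‖F (z.1, w)‖ ^ 2) * √(∑' w, ‖G (z.2, w)‖ ^ 2)) ^ 2 := by gcongr
    _ = _ := by rw [mul_pow, Real.sq_sqrt hA, Real.sq_sqrt hB]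

/-! ### Contractions -/

/-- The tuple `(p 1, …, p (a - i), u 1, …, u i)` of length `a`. -/
def glue {ι : Type*} {a i : ℕ} (hi : i ≤ a) (p : Fin (a - i) → ι) (u : Fin i → ι) : Fin a → ι :=
  fun t => Fin.append p u (Fin.cast (Nat.sub_add_cancel hi).symm t)

theorem glue_injective {ι : Type*} {a i : ℕ} (hi : i ≤ a) {p p' : Fin (a - i) → ι}
    {u u' : Fin i → ι} (h : glue hi p u = glue hi p' u') : p = p' ∧ u = u' := by
  have h' : Fin.append p u = Fin.append p' u' := by
    funext s
    have := congrFun h (Fin.cast (Nat.sub_add_cancel hi) s)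
    simpa [glue] using this
  constructor
  · funext s
    simpa using congrFun h' (Fin.castAdd i s)
  · funext s
    simpa using congrFun h' (Fin.natAdd (a - i) s)

/-- The coordinates of the `(i, j)`-th contraction of `f` and `g`: the last `i` unconjugated slots
of `f` are paired with the last `i` conjugated slots of `g`, and the last `j` conjugated slots of
`f` with the last `j` unconjugated slots of `g`. -/
def contractFun {ι : Type*} {a b c d : ℕ} (i j : ℕ) (hia : i ≤ a) (hjb : j ≤ b) (hjc : j ≤ c)
    (hid : i ≤ d) (f : TensorKernel ι (Fin a) (Fin b)) (g : TensorKernel ι (Fin c) (Fin d)) :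
    (Fin (a - i) ⊕ Fin (c - j) → ι) × (Fin (b - j) ⊕ Fin (d - i) → ι) → ℂ :=
  fun z => ∑' w : (Fin i → ι) × (Fin j → ι),
    f (glue hia (z.1 ∘ Sum.inl) w.1, glue hjb (z.2 ∘ Sum.inl) w.2) *
      g (glue hjc (z.1 ∘ Sum.inr) w.2, glue hid (z.2 ∘ Sum.inr) w.1)

theorem memlp_contractFun {ι : Type*} {a b c d : ℕ} (i j : ℕ) (hia : i ≤ a) (hjb : j ≤ b)
    (hjc : j ≤ c) (hid : i ≤ d) (f : TensorKernel ι (Fin a) (Fin b)) (g : TensorKernel ι (Fin c) (Fin d)) :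
    Memℓp (contractFun i j hia hjb hjc hid f g) 2 := by
  let φ : ((Fin (a - i) → ι) × (Fin (b - j) → ι)) × ((Fin i → ι) × (Fin j → ι)) →
      (Fin a → ι) × (Fin b → ι) := fun x => (glue hia x.1.1 x.2.1, glue hjb x.1.2 x.2.2)
  let ψ : ((Fin (c - j) → ι) × (Fin (d - i) → ι)) × ((Fin i → ι) × (Fin j → ι)) →
      (Fin c → ι) × (Fin d → ι) := fun x => (glue hjc x.1.1 x.2.2, glue hid x.1.2 x.2.1)
  have hφ : Function.Injective φ := by
    rintro ⟨⟨x1, x2⟩, ⟨x3, x4⟩⟩ ⟨⟨y1, y2⟩, ⟨y3, y4⟩⟩ h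
    obtain ⟨h1, h2⟩ := Prod.mk.inj h
    obtain ⟨rfl, rfl⟩ := glue_injective hia h1
    obtain ⟨rfl, rfl⟩ := glue_injective hjb h2
    rfl
  have hψ : Function.Injective ψ := by
    rintro ⟨⟨x1, x2⟩, ⟨x3, x4⟩⟩ ⟨⟨y1, y2⟩, ⟨y3, y4⟩⟩ h
    obtain ⟨h1, h2⟩ := Prod.mk.inj h
    obtain ⟨rfl, rfl⟩ := glue_injective hjc h1
    obtain ⟨rfl, rfl⟩ := glue_injective hid h2
    rfl
  have key := memlp_tsum_mul (memlp_comp (lp.memℓp f) hφ) (memlp_comp (lp.memℓp g) hψ)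
  let χ : (Fin (a - i) ⊕ Fin (c - j) → ι) × (Fin (b - j) ⊕ Fin (d - i) → ι) →
      ((Fin (a - i) → ι) × (Fin (b - j) → ι)) × ((Fin (c - j) → ι) × (Fin (d - i) → ι)) :=
    fun z => ((z.1 ∘ Sum.inl, z.2 ∘ Sum.inl), (z.1 ∘ Sum.inr, z.2 ∘ Sum.inr))
  have hχ : Function.Injective χ := by
    rintro ⟨x1, x2⟩ ⟨y1, y2⟩ h
    simp only [χ, Prod.mk.injEq] at h
    obtain ⟨⟨h1, h2⟩, h3, h4⟩ := h
    refine Prod.ext (funext ?_) (funext ?_)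
    · rintro (s | s)
      · exact congrFun h1 s
      · exact congrFun h3 s
    · rintro (s | s)
      · exact congrFun h2 s
      · exact congrFun h4 s
  have key' := memlp_comp key hχ
  unfold contractFun
  simpa only [φ, ψ, χ] using key'

/-- The contraction `f ⊗_{i,j} g`, an element of `H^{⊗ (a + c - i - j)} ⊗ H^{⊗ (b + d - i - j)}`. -/
def contract {ι : Type*} {a b c d : ℕ} (i j : ℕ) (hia : i ≤ a) (hjb : j ≤ b) (hjc : j ≤ c)
    (hid : i ≤ d) (f : TensorKernel ι (Fin a) (Fin b)) (g : TensorKernel ι (Fin c) (Fin d)) :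
    TensorKernel ι (Fin (a - i) ⊕ Fin (c - j)) (Fin (b - j) ⊕ Fin (d - i)) :=
  ⟨contractFun i j hia hjb hjc hid f g, memlp_contractFun i j hia hjb hjc hid f g⟩

/-! ### Symmetrization -/

/-- The coordinates of the symmetrization of a kernel: the average over all permutations of the
unconjugated slots and all permutations of the conjugated slots. -/
def symFun {ι α β : Type*} [Fintype α] [DecidableEq α] [Fintype β] [DecidableEq β]
    (f : TensorKernel ι α β) : (α → ι) × (β → ι) → ℂ :=
  fun z => (((Fintype.card α).factorial : ℂ) * ((Fintype.card β).factorial : ℂ))⁻¹ *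
    ∑ s : Equiv.Perm α × Equiv.Perm β, f (z.1 ∘ s.1, z.2 ∘ s.2)

theorem memlp_symFun {ι α β : Type*} [Fintype α] [DecidableEq α] [Fintype β] [DecidableEq β]
    (f : TensorKernel ι α β) : Memℓp (symFun f) 2 := by
  refine Memℓp.const_mul (𝕜 := ℂ) (Memℓp.finsetSum (E := fun _ => ℂ) Finset.univ
    (f := fun (s : Equiv.Perm α × Equiv.Perm β) (z : (α → ι) × (β → ι)) =>
      f (z.1 ∘ s.1, z.2 ∘ s.2)) fun s _ => ?_) _
  refine memlp_comp (lp.memℓp f) (φ := fun z : (α → ι) × (β → ι) => (z.1 ∘ s.1, z.2 ∘ s.2)) ?_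
  rintro ⟨x1, x2⟩ ⟨y1, y2⟩ h
  obtain ⟨h1, h2⟩ := Prod.mk.inj h
  exact Prod.ext (s.1.surjective.injective_comp_right h1) (s.2.surjective.injective_comp_right h2)

/-- The orthogonal projection of a kernel onto `H^{⊙ α} ⊗ H^{⊙ β}`. -/
def symmetrize {ι α β : Type*} [Fintype α] [DecidableEq α] [Fintype β] [DecidableEq β]
    (f : TensorKernel ι α β) : TensorKernel ι α β :=
  ⟨symFun f, memlp_symFun f⟩

/-! ### Complex Hermite polynomials and complex Wiener–Itô integrals -/

/-- The complex Hermite polynomial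
`J_{m,n}(z, ρ) = ∑ r, (-1)^r r! (m choose r) (n choose r) z^(m-r) (conj z)^(n-r) ρ^r`. -/
def hermiteJ (m n : ℕ) (z : ℂ) (ρ : ℝ) : ℂ :=
  ∑ r ∈ Finset.range (min m n + 1), (-1) ^ r * (r.factorial : ℂ) * (m.choose r : ℂ) *
    (n.choose r : ℂ) * z ^ (m - r) * (conj z) ^ (n - r) * (ρ : ℂ) ^ r

variable {H : Type*} [NormedAddCommGroup H] [InnerProductSpace ℂ H] {ι : Type*}
  {Ω : Type*} [MeasurableSpace Ω]

open Classical in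
/-- The integral of the basis vector `e_{p 1} ⊗ ⋯ ⊗ e_{p m} ⊗ conj e_{q 1} ⊗ ⋯ ⊗ conj e_{q n}`:
the product over `k` of `J_{m_k, n_k}(Z(e_k), 1)`, where `m_k` and `n_k` count the occurrences of
`k` in `p` and `q`. (Indices `k` that do not occur would contribute the factor `J_{0,0} = 1`.) -/
def hermiteProd (e : HilbertBasis ι ℂ H) (Z : H → Ω → ℂ) {m n : ℕ} (p : Fin m → ι)
    (q : Fin n → ι) (ω : Ω) : ℂ :=
  ∏ k ∈ Finset.univ.image p ∪ Finset.univ.image q,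
    hermiteJ (Finset.univ.filter fun s => p s = k).card
      (Finset.univ.filter fun s => q s = k).card (Z (e k) ω) 1

/-- Membership in all `L^p`, `p < ∞`. -/
def AllLp (X : Ω → ℂ) (P : Measure Ω) : Prop := ∀ p : ℝ≥0∞, p ≠ ∞ → MemLp X p P

theorem AllLp.mul {X Y : Ω → ℂ} {P : Measure Ω} (hX : AllLp X P) (hY : AllLp Y P) :
    AllLp (fun ω => X ω * Y ω) P := by
  intro p hp
  have : ENNReal.HolderTriple (2 * p) (2 * p) p := ⟨by
    rw [ENNReal.mul_inv (by simp) (by simp), ← add_mul, ENNReal.inv_two_add_inv_two, one_mul]⟩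
  have h2 : 2 * p ≠ ∞ := ENNReal.mul_ne_top (by simp) hp
  exact MemLp.mul' (hY _ h2) (hX _ h2)

theorem AllLp.prod {κ : Type*} {X : κ → Ω → ℂ} {P : Measure Ω} [IsFiniteMeasure P] (s : Finset κ)
    (hX : ∀ k ∈ s, AllLp (X k) P) : AllLp (fun ω => ∏ k ∈ s, X k ω) P := by
  classical
  induction s using Finset.induction_on with
  | empty => intro p _; simpa using memLp_const (1 : ℂ)
  | insert a s ha ih =>
    simp only [Finset.prod_insert ha]
    exact (hX a (by simp)).mul (ih fun k hk => hX k (by simp [hk]))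

theorem AllLp.pow {X : Ω → ℂ} {P : Measure Ω} [IsFiniteMeasure P] (hX : AllLp X P) (k : ℕ) :
    AllLp (fun ω => X ω ^ k) P := by
  simpa using AllLp.prod (X := fun _ : ℕ => X) (Finset.range k) fun _ _ => hX

theorem AllLp.const {P : Measure Ω} [IsFiniteMeasure P] (c : ℂ) : AllLp (fun _ => c) P :=
  fun _ _ => memLp_const c

theorem AllLp.conj {X : Ω → ℂ} {P : Measure Ω} (hX : AllLp X P) :
    AllLp (fun ω => conj (X ω)) P :=
  fun p hp => (hX p hp).star

theorem AllLp.hermiteJ {X : Ω → ℂ} {P : Measure Ω} [IsFiniteMeasure P] (hX : AllLp X P)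
    (m n : ℕ) (ρ : ℝ) : AllLp (fun ω => hermiteJ m n (X ω) ρ) P := by
  intro p hp
  refine memLp_finsetSum _ fun r _ => ?_
  exact (((AllLp.const _).mul (hX.pow _)).mul (hX.conj.pow _)).mul (AllLp.const _) p hp

theorem IsComplexIsonormal.isProbabilityMeasure {Z : H → Ω → ℂ} {P : Measure Ω}
    (hZ : IsComplexIsonormal Z P) : IsProbabilityMeasure P :=
  hZ.gaussian.isProbabilityMeasure

theorem IsComplexIsonormal.allLp {Z : H → Ω → ℂ} {P : Measure Ω}
    (hZ : IsComplexIsonormal Z P) (h : H) : AllLp (Z h) P :=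
  fun _ hp => (hZ.gaussian.hasGaussianLaw_eval h).memLp hp

theorem memLp_hermiteProd {Z : H → Ω → ℂ} {P : Measure Ω} (hZ : IsComplexIsonormal Z P)
    (e : HilbertBasis ι ℂ H) {m n : ℕ} (p : Fin m → ι) (q : Fin n → ι) :
    MemLp (hermiteProd e Z p q) 2 P := by
  have := hZ.isProbabilityMeasure
  exact AllLp.prod _ (fun k _ => (hZ.allLp (e k)).hermiteJ _ _ _) 2 (by simp)

/-- The complex Wiener–Itô multiple integral `I_{m,n}(f)`: the linear continuous extension of the
integral of the basis vectors, as an unconditionally convergent series in `L²`. (Finitely many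
basis vectors share the same counts, hence the same integral, and integrals of basis vectors with
different counts are orthogonal.) It satisfies
`I_{m,n}(h^{⊗ m} ⊗ (conj h)^{⊗ n}) = J_{m,n}(Z h, ‖h‖²)`. -/
def wienerIto {Z : H → Ω → ℂ} {P : Measure Ω} (hZ : IsComplexIsonormal Z P)
    (e : HilbertBasis ι ℂ H) (m n : ℕ) (f : TensorKernel ι (Fin m) (Fin n)) : Lp ℂ 2 P :=
  ∑' z : (Fin m → ι) × (Fin n → ι), f z • (memLp_hermiteProd hZ e z.1 z.2).toLp

end ComplexWiener

end

open ComplexWiener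

/-! Symmetrization is an average of isometries, so it cannot increase norms; this gives one
implication. For the other, put `f, f, h, h` at the vertices `0, 1, 2, 3`, where `h` is the adjoint
kernel `h (q, p) = conj (f (p, q))`. A complete contraction of the four kernels without
self-pairings is encoded by a table `e`, with `e a b` the number of unconjugated slots of `a` joined
to conjugated slots of `b`. Let `S e` (`tableValue`) be its value, normalized by factorials.

Two facts tie `S` to the norms. First, summing over all matchings between `f ⊗_{i,j} f` and `h
⊗_{k,l} h` gives a positive multiple of the sum of `S` over the tables with prescribed entries
inside `{0,1}` and `{2,3}` (`pairing_contract`). A sum over all matchings sees only the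
symmetrizations, so by Cauchy–Schwarz it is `O(ε²)` when these have norm at most `ε`
(`norm_pairing_le`). The other two splittings of the vertices into pairs give `f ⊗ h` against `h ⊗
f`. Second, a table without edges between the two copies of `f` is a four-cycle, and its `S` is a
positive multiple of some `‖f ⊗_{i,j} h‖²`; without edges between `0` and `2` it is a positive
multiple of some `‖f ⊗_{i,j} f‖²`.

Let `x, y, z` count the edges from vertex `0` to `1, 2, 3`; then `x + y + z = L = m + n`. Grouping
by `x`, the sums of `S` and of `x S` over `0 < x < L` are `O(ε²)`, and likewise for `y` and `z`.
Adding the sums weighted by `x, y, z` bounds the sum of `S` over all tables with `x, y, z < L`;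
removing those with `x > 0` bounds the sum over `x = 0`. All its terms are nonnegative, so each one
is `O(ε²)` (`re_le_of_weighted_sums`). Exchanging `x` and `y` treats `f ⊗ f`.

The table calculus is carried out over a finite index set, where symmetric kernels are combinations
of pure powers and every contraction becomes a product of scalar products. The constant depends only
on `m` and `n`, so truncating to finite index sets gives the general case. Probability enters only
in identifying `h`: orthogonality of the Hermite products makes the integral injective on symmetric
kernels, and conjugation carries the integral of `f` to that of its adjoint kernel. -/

noncomputable section

namespace ComplexWiener

/-! ### Permanents of block-constant matrices -/

/-- The divided power `x ^ k / k!`. -/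
def divPow (x : ℂ) (k : ℕ) : ℂ := x ^ k / (k.factorial : ℂ)

theorem succ_mul_divPow (x : ℂ) (k : ℕ) : ((k + 1 : ℕ) : ℂ) * divPow x (k + 1) = x * divPow x k := by
  unfold divPow
  rw [Nat.factorial_succ, pow_succ]
  have h1 : ((k.factorial : ℕ) : ℂ) ≠ 0 := by exact_mod_cast k.factorial_ne_zero
  have h2 : ((k + 1 : ℕ) : ℂ) ≠ 0 := by exact_mod_cast k.succ_ne_zero
  push_cast at h2 ⊢
  field_simp

/-- The sum of `∏ B ^ e / e!` over the `2 × 2` contingency tables `e` with row sums `a`, `b` and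
column sums `c`, `d`. -/
def tableSum (B : Bool → Bool → ℂ) (a b c d : ℕ) : ℂ :=
  ∑ x ∈ Finset.HasAntidiagonal.antidiagonal a, ∑ y ∈ Finset.HasAntidiagonal.antidiagonal b,
    if x.1 + y.1 = c ∧ x.2 + y.2 = d then
      divPow (B true true) x.1 * divPow (B true false) x.2 *
        divPow (B false true) y.1 * divPow (B false false) y.2 else 0

theorem tableSum_swap (B : Bool → Bool → ℂ) (a b c d : ℕ) :
    tableSum B a b c d = tableSum (fun r => B (!r)) b a c d := by
  unfold tableSum
  rw [Finset.sum_comm]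
  refine Finset.sum_congr rfl fun y _ => Finset.sum_congr rfl fun x _ => ?_
  simp only [add_comm, Bool.not_true, Bool.not_false]
  split_ifs
  · ring
  · rfl

/-- The first row has total `a + 1 = x.1 + x.2`. Distributing this factor over the two entries
lowers one divided power at a time, which removes one unit from the first row and from one column.
-/
theorem tableSum_succ_left (B : Bool → Bool → ℂ) (a b c d : ℕ) :
    ((a + 1 : ℕ) : ℂ) * tableSum B (a + 1) b c d =
      (if c = 0 then 0 else B true true * tableSum B a b (c - 1) d) +
        (if d = 0 then 0 else B true false * tableSum B a b c (d - 1)) := by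
  let G : ℕ → ℕ → ℂ := fun x1 x2 => ∑ y ∈ Finset.HasAntidiagonal.antidiagonal b,
    if x1 + y.1 = c ∧ x2 + y.2 = d then
      divPow (B true true) x1 * divPow (B true false) x2 *
        divPow (B false true) y.1 * divPow (B false false) y.2 else 0
  have h1 : ∑ x ∈ Finset.HasAntidiagonal.antidiagonal (a + 1), (x.1 : ℂ) * G x.1 x.2 =
      if c = 0 then 0 else B true true * tableSum B a b (c - 1) d := by
    rw [Finset.Nat.antidiagonal_succ, Finset.sum_cons, Finset.sum_map]
    simp only [Nat.cast_zero, zero_mul, zero_add, Function.Embedding.prodMap,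
      Function.Embedding.coeFn_mk, Prod.map, Function.Embedding.refl_apply]
    split_ifs with hc
    · refine Finset.sum_eq_zero fun x _ => ?_
      simp only [G, mul_eq_zero]
      refine Or.inr (Finset.sum_eq_zero fun y _ => if_neg ?_)
      omega
    · rw [tableSum, Finset.mul_sum]
      refine Finset.sum_congr rfl fun x _ => ?_
      simp only [G, Finset.mul_sum]
      refine Finset.sum_congr rfl fun y _ => ?_
      have : (x.1.succ + y.1 = c ∧ x.2 + y.2 = d) ↔ (x.1 + y.1 = c - 1 ∧ x.2 + y.2 = d) := by omega
      simp only [this]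
      split_ifs
      · have := succ_mul_divPow (B true true) x.1
        simp only [Nat.succ_eq_add_one] at *
        linear_combination (divPow (B true false) x.2 *
        divPow (B false true) y.1 * divPow (B false false) y.2) * this
      · simp
  have h2 : ∑ x ∈ Finset.HasAntidiagonal.antidiagonal (a + 1), (x.2 : ℂ) * G x.1 x.2 =
      if d = 0 then 0 else B true false * tableSum B a b c (d - 1) := by
    rw [Finset.Nat.antidiagonal_succ', Finset.sum_cons, Finset.sum_map]
    simp only [Nat.cast_zero, zero_mul, zero_add, Function.Embedding.prodMap,
      Function.Embedding.coeFn_mk, Prod.map, Function.Embedding.refl_apply]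
    split_ifs with hc
    · refine Finset.sum_eq_zero fun x _ => ?_
      simp only [G, mul_eq_zero]
      refine Or.inr (Finset.sum_eq_zero fun y _ => if_neg ?_)
      omega
    · rw [tableSum, Finset.mul_sum]
      refine Finset.sum_congr rfl fun x _ => ?_
      simp only [G, Finset.mul_sum]
      refine Finset.sum_congr rfl fun y _ => ?_
      have : (x.1 + y.1 = c ∧ x.2.succ + y.2 = d) ↔ (x.1 + y.1 = c ∧ x.2 + y.2 = d - 1) := by omega
      simp only [this]
      split_ifs
      · have := succ_mul_divPow (B true false) x.2
        simp only [Nat.succ_eq_add_one] at *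
        linear_combination (divPow (B true true) x.1 *
        divPow (B false true) y.1 * divPow (B false false) y.2) * this
      · simp
  rw [← h1, ← h2, ← Finset.sum_add_distrib, tableSum, Finset.mul_sum]
  refine Finset.sum_congr rfl fun x hx => ?_
  rw [← Finset.HasAntidiagonal.mem_antidiagonal.1 hx]
  push_cast
  ring

/-- The number of points with a given label. -/
def labelCount {α : Type*} [Fintype α] (r : α → Bool) (t : Bool) : ℕ :=
  ∑ s, if r s = t then 1 else 0

theorem labelCount_equiv {α β : Type*} [Fintype α] [Fintype β] (e : α ≃ β) (r : β → Bool)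
    (t : Bool) : labelCount (r ∘ e) t = labelCount r t :=
  e.sum_comp fun s => if r s = t then 1 else 0

open Classical in
-- Expansion of a permanent along the row `none`: the bijections are sorted by the image of `none`.
theorem sum_equiv_option {α β M : Type*} [AddCommMonoid M] [Fintype β] [Fintype (Option α ≃ β)]
    [∀ b : β, Fintype (α ≃ {y : β // y ≠ b})] (F : (Option α ≃ β) → M) :
    ∑ σ : Option α ≃ β, F σ =
      ∑ b : β, ∑ σ : α ≃ {y : β // y ≠ b}, F ((Equiv.optionSubtype b).symm σ) := by
  rw [← Finset.sum_fiberwise_of_maps_to (s := Finset.univ) (t := Finset.univ)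
    (g := fun σ : Option α ≃ β => σ none) fun _ _ => Finset.mem_univ _]
  refine Finset.sum_congr rfl fun b _ => ?_
  rw [← Finset.sum_subtype_eq_sum_filter, Finset.subtype_univ]
  exact ((Equiv.optionSubtype b).symm.sum_comp
    (fun σ : {e : Option α ≃ β // e none = b} => F σ)).symm

theorem sum_comp_label {β : Type*} [Fintype β] (c : β → Bool) (g : Bool → ℂ) :
    ∑ b, g (c b) = labelCount c true * g true + labelCount c false * g false := by
  simp only [labelCount, Nat.cast_sum, Finset.sum_mul, ← Finset.sum_add_distrib]
  refine Finset.sum_congr rfl fun b _ => ?_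
  cases c b <;> simp

theorem tableSum_succ (B : Bool → Bool → ℂ) (r : Bool) (a b c d : ℕ) :
    (((if r = true then a + 1 else b + 1 : ℕ)) : ℂ) *
      tableSum B (a + if r = true then 1 else 0) (b + if r = false then 1 else 0) c d =
      (if c = 0 then 0 else B r true * tableSum B a b (c - 1) d) +
        (if d = 0 then 0 else B r false * tableSum B a b c (d - 1)) := by
  cases r
  · have := tableSum_succ_left (fun r => B (!r)) b a c d
    simpa [tableSum_swap B] using this
  · simpa using tableSum_succ_left B a b c d

open Classical in
-- The product depends on `σ` only through the number of pairs of each label type, that is, through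
-- a contingency table, and the factorials count the bijections with a given table. The induction
-- replaces this count: row expansion on the left matches the recursion `tableSum_succ` on the
-- right.
theorem sum_equiv_prod_block (B : Bool → Bool → ℂ) (α : Type) [Fintype α] :
    ∀ (β : Type) [Fintype β] [Fintype (α ≃ β)] (r : α → Bool) (c : β → Bool),
    ∑ σ : α ≃ β, ∏ s, B (r s) (c (σ s)) =
      (labelCount r true).factorial * (labelCount r false).factorial *
      ((labelCount c true).factorial * (labelCount c false).factorial) *
      tableSum B (labelCount r true) (labelCount r false)
        (labelCount c true) (labelCount c false) := by
  revert α
  apply Fintype.induction_empty_option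
  · intro α α' _ e ih β _ _ r c
    let _ := Fintype.ofEquiv α' e.symm
    have := ih β (r ∘ e) c
    rw [labelCount_equiv, labelCount_equiv] at this
    rw [← this]
    refine Fintype.sum_equiv (Equiv.equivCongr e.symm (Equiv.refl β)) _ _ fun σ => ?_
    exact Fintype.prod_equiv e.symm _ _ fun s => by simp
  · intro β _ _ r c
    have hr : ∀ t, labelCount r t = 0 := fun t => by simp [labelCount]
    rw [hr, hr]
    -- For nonempty `β` there are no bijections, and the column sums do not both vanish, so no table
    -- is admissible either.
    by_cases hβ : IsEmpty β
    · have hc : ∀ t, labelCount c t = 0 := fun t => by simp [labelCount]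
      have h1 : Fintype.card (PEmpty.{1} ≃ β) = 1 := by
        exact Fintype.card_eq_one_iff.2 ⟨Equiv.equivOfIsEmpty _ _, fun e => Equiv.ext fun x => x.elim⟩
      simp [hc, tableSum, divPow, h1]
    · have hc : labelCount c true + labelCount c false ≠ 0 := by
        obtain ⟨b⟩ := not_isEmpty_iff.1 hβ
        rw [labelCount, labelCount, ← Finset.sum_add_distrib]
        refine (Finset.sum_pos' (fun _ _ => by simp) ⟨b, Finset.mem_univ _, ?_⟩).ne'
        cases c b <;> simp
      have h1 : IsEmpty (PEmpty.{1} ≃ β) := ⟨fun e => hβ ⟨fun b => (e.symm b).elim⟩⟩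
      have h2 : ¬ (0 = labelCount c true ∧ 0 = labelCount c false) := by omega
      simp [tableSum, h2]
  · intro α _ ih β _ _ r c
    rw [sum_equiv_option]
    have hcount : ∀ t, labelCount r t =
        labelCount (fun s => r (some s)) t + if r none = t then 1 else 0 := fun t => by
      rw [labelCount, Fintype.sum_option, add_comm, labelCount]
    have hsub : ∀ b t, labelCount (fun y : {y : β // y ≠ b} => c y) t =
        labelCount c t - if c b = t then 1 else 0 := fun b t => by
      rw [labelCount, labelCount, Fintype.sum_eq_add_sum_subtype_ne _ b]
      simp
    set a := labelCount (fun s => r (some s)) true with ha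
    set b := labelCount (fun s => r (some s)) false with hb
    -- The contribution of a column depends only on its label. The truncated subtraction is
    -- harmless: if no column has label `t`, then `g t` is multiplied by zero.
    let g : Bool → ℂ := fun t => B (r none) t * (a.factorial * b.factorial *
      (((labelCount c true - if t = true then 1 else 0).factorial : ℕ) *
        ((labelCount c false - if t = false then 1 else 0).factorial : ℕ)) *
      tableSum B a b (labelCount c true - if t = true then 1 else 0)
        (labelCount c false - if t = false then 1 else 0))
    have step : ∀ x : β, ∑ σ : α ≃ {y : β // y ≠ x},
        ∏ s, B (r s) (c (((Equiv.optionSubtype x).symm σ : Option α ≃ β) s)) = g (c x) := by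
      intro x
      have := ih {y : β // y ≠ x} (fun s => r (some s)) (fun y => c y)
      rw [hsub, hsub] at this
      simp only [Fintype.prod_option, Equiv.optionSubtype_symm_apply_apply_none,
        Equiv.optionSubtype_symm_apply_apply_some, ← Finset.mul_sum]
      rw [this]
    simp only [step]
    rw [sum_comp_label, hcount, hcount]
    have key := tableSum_succ B (r none) a b (labelCount c true) (labelCount c false)
    have hfac : ∀ k : ℕ, k ≠ 0 → (k : ℂ) * ((k - 1).factorial : ℂ) = (k.factorial : ℂ) :=
      fun k hk => by exact_mod_cast Nat.mul_factorial_pred hk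
    have hab : (((a + if r none = true then 1 else 0).factorial : ℕ) : ℂ) *
        ((b + if r none = false then 1 else 0).factorial : ℕ) =
        a.factorial * b.factorial * ((if r none = true then a + 1 else b + 1 : ℕ) : ℂ) := by
      cases r none <;> simp [Nat.factorial_succ] <;> ring
    rw [hab]
    have hT : (labelCount c true : ℂ) * g true = a.factorial * b.factorial *
        ((labelCount c true).factorial * (labelCount c false).factorial) *
        (if labelCount c true = 0 then 0 else
          B (r none) true * tableSum B a b (labelCount c true - 1) (labelCount c false)) := by
      split_ifs with h0
      · simp [h0]
      · rw [← hfac _ h0]; simp only [g, if_true, Bool.true_eq_false, if_false, Nat.sub_zero]; ring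
    have hF : (labelCount c false : ℂ) * g false = a.factorial * b.factorial *
        ((labelCount c true).factorial * (labelCount c false).factorial) *
        (if labelCount c false = 0 then 0 else
          B (r none) false * tableSum B a b (labelCount c true) (labelCount c false - 1)) := by
      split_ifs with h0
      · simp [h0]
      · rw [← hfac _ h0]; simp only [g, if_true, Bool.false_eq_true, if_false, Nat.sub_zero]; ring
    rw [hT, hF]
    linear_combination (-(a.factorial * b.factorial *
        ((labelCount c true).factorial * (labelCount c false).factorial) : ℂ)) * key

/-! ### Contingency tables on four vertices -/

theorem forall_fin_four {p : Fin 4 → Prop} : (∀ a, p a) ↔ p 0 ∧ p 1 ∧ p 2 ∧ p 3 := by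
  rw [Fin.forall_fin_succ, Fin.forall_fin_succ, Fin.forall_fin_two]
  rfl

/-- The `4 × 4` contingency tables with zero diagonal, row sums `M` and column sums `N`. -/
def tables (M N : Fin 4 → ℕ) : Finset (Fin 4 → Fin 4 → ℕ) :=
  (Fintype.piFinset fun a => Fintype.piFinset fun _ => Finset.range (M a + 1)).filter fun e =>
    (∀ a, ∑ b, e a b = M a) ∧ (∀ b, ∑ a, e a b = N b) ∧ ∀ a, e a a = 0

/-- The range bound serves only to make the set finite, since row sums already bound the entries. -/
theorem mem_tables {M N : Fin 4 → ℕ} {e : Fin 4 → Fin 4 → ℕ} :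
    e ∈ tables M N ↔ (∀ a, ∑ b, e a b = M a) ∧ (∀ b, ∑ a, e a b = N b) ∧ ∀ a, e a a = 0 := by
  rw [tables, Finset.mem_filter, and_iff_right_iff_imp]
  rintro ⟨h, -, -⟩
  simp only [Fintype.mem_piFinset, Finset.mem_range, Nat.lt_succ_iff]
  intro a b
  rw [← h a]
  exact Finset.single_le_sum (f := e a) (fun _ _ => Nat.zero_le _) (Finset.mem_univ b)

/-- The product of the divided powers `A ^ e / e!`. -/
def tableWeight (A : Fin 4 → Fin 4 → ℂ) (e : Fin 4 → Fin 4 → ℕ) : ℂ :=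
  ∏ a, ∏ b, divPow (A a b) (e a b)

theorem tableSum_eq_sum_filter (B : Bool → Bool → ℂ) (a b c d : ℕ) :
    tableSum B a b c d = ∑ p ∈ (Finset.HasAntidiagonal.antidiagonal a ×ˢ
        Finset.HasAntidiagonal.antidiagonal b).filter
        (fun p => p.1.1 + p.2.1 = c ∧ p.1.2 + p.2.2 = d),
      divPow (B true true) p.1.1 * divPow (B true false) p.1.2 *
        divPow (B false true) p.2.1 * divPow (B false false) p.2.2 := by
  rw [Finset.sum_filter, Finset.sum_product, tableSum]

/-- With zero diagonal and the entries inside `{0,1}` and `{2,3}` fixed, the free entries form two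
`2 × 2` blocks, from `{0,1}` to `{2,3}` and back. No row or column constraint links the blocks, so
the sum factorizes. -/
theorem sum_tables_fiber (A : Fin 4 → Fin 4 → ℂ) (M N : Fin 4 → ℕ) (i j k l : ℕ)
    (h0 : i ≤ M 0) (h1 : j ≤ M 1) (h2 : k ≤ M 2) (h3 : l ≤ M 3)
    (g0 : j ≤ N 0) (g1 : i ≤ N 1) (g2 : l ≤ N 2) (g3 : k ≤ N 3) :
    ∑ e ∈ (tables M N).filter (fun e => e 0 1 = i ∧ e 1 0 = j ∧ e 2 3 = k ∧ e 3 2 = l),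
      tableWeight A e =
    divPow (A 0 1) i * divPow (A 1 0) j * divPow (A 2 3) k * divPow (A 3 2) l *
      tableSum (fun s t => A (if s then 0 else 1) (if t then 2 else 3))
        (M 0 - i) (M 1 - j) (N 2 - l) (N 3 - k) *
      tableSum (fun s t => A (if s then 2 else 3) (if t then 0 else 1))
        (M 2 - k) (M 3 - l) (N 0 - j) (N 1 - i) := by
  rw [mul_assoc, tableSum_eq_sum_filter, tableSum_eq_sum_filter, Finset.sum_mul_sum,
    ← Finset.sum_product', Finset.mul_sum]
  refine Finset.sum_bij'
    (fun e _ => (((e 0 2, e 0 3), (e 1 2, e 1 3)), ((e 2 0, e 2 1), (e 3 0, e 3 1))))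
    (fun p _ => ![![0, i, p.1.1.1, p.1.1.2], ![j, 0, p.1.2.1, p.1.2.2],
      ![p.2.1.1, p.2.1.2, 0, k], ![p.2.2.1, p.2.2.2, l, 0]]) ?_ ?_ ?_ ?_ ?_
  · intro e he
    simp only [Finset.mem_filter, mem_tables, forall_fin_four, Fin.sum_univ_four] at he
    simp only [Finset.mem_product, Finset.mem_filter, Finset.HasAntidiagonal.mem_antidiagonal]
    omega
  · intro p hp
    simp only [Finset.mem_product, Finset.mem_filter,
      Finset.HasAntidiagonal.mem_antidiagonal] at hp
    simp only [Finset.mem_filter, mem_tables, forall_fin_four, Fin.sum_univ_four]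
    simp
    omega
  · intro e he
    simp only [Finset.mem_filter, mem_tables, forall_fin_four, Fin.sum_univ_four] at he
    funext a b
    fin_cases a <;> fin_cases b <;> simp <;> omega
  · intro p hp
    simp
  · intro e he
    simp only [Finset.mem_filter, mem_tables] at he
    obtain ⟨⟨-, -, hd⟩, rfl, rfl, rfl, rfl⟩ := he
    simp [tableWeight, Fin.prod_univ_four, hd]
    simp [divPow]
    ring

theorem sum_tables_fiber_perm (ρ : Equiv.Perm (Fin 4)) (A : Fin 4 → Fin 4 → ℂ) (M N : Fin 4 → ℕ)
    (i j k l : ℕ)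
    (h0 : i ≤ M (ρ 0)) (h1 : j ≤ M (ρ 1)) (h2 : k ≤ M (ρ 2)) (h3 : l ≤ M (ρ 3))
    (g0 : j ≤ N (ρ 0)) (g1 : i ≤ N (ρ 1)) (g2 : l ≤ N (ρ 2)) (g3 : k ≤ N (ρ 3)) :
    ∑ e ∈ (tables M N).filter (fun e => e (ρ 0) (ρ 1) = i ∧ e (ρ 1) (ρ 0) = j ∧
        e (ρ 2) (ρ 3) = k ∧ e (ρ 3) (ρ 2) = l), tableWeight A e =
    divPow (A (ρ 0) (ρ 1)) i * divPow (A (ρ 1) (ρ 0)) j * divPow (A (ρ 2) (ρ 3)) k *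
      divPow (A (ρ 3) (ρ 2)) l *
      tableSum (fun s t => A (ρ (if s then 0 else 1)) (ρ (if t then 2 else 3)))
        (M (ρ 0) - i) (M (ρ 1) - j) (N (ρ 2) - l) (N (ρ 3) - k) *
      tableSum (fun s t => A (ρ (if s then 2 else 3)) (ρ (if t then 0 else 1)))
        (M (ρ 2) - k) (M (ρ 3) - l) (N (ρ 0) - j) (N (ρ 1) - i) := by
  refine Eq.trans ?_ (sum_tables_fiber (fun a b => A (ρ a) (ρ b)) (M ∘ ρ) (N ∘ ρ) i j k l
    h0 h1 h2 h3 g0 g1 g2 g3)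
  refine Finset.sum_bij' (fun e _ => fun a b => e (ρ a) (ρ b))
    (fun e _ => fun a b => e (ρ.symm a) (ρ.symm b)) ?_ ?_ ?_ ?_ ?_
  · intro e he
    simp only [Finset.mem_filter, mem_tables] at he ⊢
    obtain ⟨⟨hr, hc, hd⟩, h⟩ := he
    refine ⟨⟨fun a => ?_, fun b => ?_, fun a => hd _⟩, h⟩
    · rw [Equiv.sum_comp ρ fun b => e (ρ a) b]; exact hr _
    · rw [Equiv.sum_comp ρ fun a => e a (ρ b)]; exact hc _
  · intro e he
    simp only [Finset.mem_filter, mem_tables] at he ⊢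
    obtain ⟨⟨hr, hc, hd⟩, h⟩ := he
    refine ⟨⟨fun a => ?_, fun b => ?_, fun a => hd _⟩, by simpa using h⟩
    · rw [Equiv.sum_comp ρ.symm fun b => e (ρ.symm a) b, hr]; simp
    · rw [Equiv.sum_comp ρ.symm fun a => e a (ρ.symm b), hc]; simp
  · intro e _; simp
  · intro e _; simp
  · intro e _
    rw [tableWeight, tableWeight, ← Equiv.prod_comp ρ]
    exact Finset.prod_congr rfl fun a _ => (Equiv.prod_comp ρ fun b => divPow (A (ρ a) b) (e (ρ a) b)).symm

section

/-! ### Pairings of kernels over a finite index set -/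

section Pairing

variable {ι α β α' β' : Type*} [Fintype ι] [Fintype β] [Fintype β'] [DecidableEq β] [DecidableEq β']

/-- The full contraction of `X` with `Y`, matching the unconjugated slots of either kernel with the
conjugated slots of the other one. -/
def pairAt (σ : α ≃ β') (τ : α' ≃ β) (X : (α → ι) × (β → ι) → ℂ) (Y : (α' → ι) × (β' → ι) → ℂ) : ℂ :=
  ∑ z : (β' → ι) × (β → ι), X (z.1 ∘ σ, z.2) * Y (z.2 ∘ τ, z.1)

theorem pairAt_sum_mul {κ κ' : Type*} [Fintype κ] [Fintype κ'] (σ : α ≃ β') (τ : α' ≃ β)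
    (c : κ → ℂ) (c' : κ' → ℂ) (X : κ → (α → ι) × (β → ι) → ℂ) (Y : κ' → (α' → ι) × (β' → ι) → ℂ) :
    pairAt σ τ (fun z => ∑ k, c k * X k z) (fun z => ∑ k, c' k * Y k z) =
      ∑ k, ∑ k', c k * c' k' * pairAt σ τ (X k) (Y k') := by
  simp only [pairAt, Finset.sum_mul_sum]
  simp only [Finset.mul_sum]
  rw [Finset.sum_comm]
  refine Finset.sum_congr rfl fun k _ => ?_
  rw [Finset.sum_comm]
  refine Finset.sum_congr rfl fun k' _ => Finset.sum_congr rfl fun z _ => ?_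
  ring

variable [Fintype α] [Fintype α'] [DecidableEq α] [DecidableEq α']

/-- The sum of the full contractions of `X` with `Y` over all matchings of the slots. -/
def pairing (X : (α → ι) × (β → ι) → ℂ) (Y : (α' → ι) × (β' → ι) → ℂ) : ℂ :=
  ∑ σ : α ≃ β', ∑ τ : α' ≃ β, pairAt σ τ X Y

/-- The elementary tensor with the given factors. -/
def elemTensor (x : α → ι → ℂ) (y : β → ι → ℂ) (z : (α → ι) × (β → ι)) : ℂ :=
  (∏ s, x s (z.1 s)) * ∏ t, y t (z.2 t)

theorem sum_prod_comp_mul_prod (σ : α ≃ β) (x : α → ι → ℂ) (y : β → ι → ℂ) :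
    ∑ z : β → ι, (∏ s, x s (z (σ s))) * ∏ t, y t (z t) = ∏ s, dotProduct (x s) (y (σ s)) := by
  simp only [dotProduct]
  rw [Finset.prod_univ_sum, Fintype.piFinset_univ]
  refine Fintype.sum_equiv (σ.symm.arrowCongr (Equiv.refl ι)) _ _ fun z => ?_
  rw [← σ.prod_comp fun t => y t (z t), ← Finset.prod_mul_distrib]
  simp

theorem pairAt_elemTensor (σ : α ≃ β') (τ : α' ≃ β) (x : α → ι → ℂ) (y : β → ι → ℂ)
    (x' : α' → ι → ℂ) (y' : β' → ι → ℂ) :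
    pairAt σ τ (elemTensor x y) (elemTensor x' y') =
      (∏ s, dotProduct (x s) (y' (σ s))) * ∏ s, dotProduct (x' s) (y (τ s)) := by
  rw [← sum_prod_comp_mul_prod, ← sum_prod_comp_mul_prod, Fintype.sum_mul_sum,
    ← Fintype.sum_prod_type', pairAt]
  refine Finset.sum_congr rfl fun z _ => ?_
  simp only [elemTensor, Function.comp_apply]
  ring

end Pairing

/-! ### Contractions of sums of pure powers -/

section Contract

variable {ι : Type*} {a b c d : ℕ}

theorem prod_glue {i : ℕ} (hi : i ≤ a) (u : ι → ℂ) (p : Fin (a - i) → ι) (w : Fin i → ι) :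
    ∏ s, u (glue hi p w s) = (∏ s, u (p s)) * ∏ s, u (w s) := by
  unfold glue
  rw [Fintype.prod_equiv (finCongr (Nat.sub_add_cancel hi).symm)
    (fun t => u (Fin.append p w (Fin.cast (Nat.sub_add_cancel hi).symm t)))
    (fun t => u (Fin.append p w t)) fun _ => rfl, Fin.prod_univ_add]
  simp

variable [Fintype ι]

theorem sum_prod_mul_prod_eq_pow (i : ℕ) (u v : ι → ℂ) :
    ∑ w : Fin i → ι, (∏ s, u (w s)) * ∏ s, v (w s) = dotProduct u v ^ i := by
  have := sum_prod_comp_mul_prod (Equiv.refl (Fin i)) (fun _ => u) (fun _ => v)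
  simpa using this

/-- The contraction of sums of pure powers is a sum of elementary tensors. -/
theorem contract_apply_of_sum_pow {κ κ' : Type*} [Fintype κ] [Fintype κ'] (i j : ℕ) (hia : i ≤ a)
    (hjb : j ≤ b) (hjc : j ≤ c) (hid : i ≤ d) (f : TensorKernel ι (Fin a) (Fin b))
    (g : TensorKernel ι (Fin c) (Fin d)) (x : κ → ℂ) (u v : κ → ι → ℂ) (x' : κ' → ℂ)
    (u' v' : κ' → ι → ℂ)
    (hf : ∀ z, f z = ∑ k, x k * elemTensor (fun _ => u k) (fun _ => v k) z)
    (hg : ∀ z, g z = ∑ k, x' k * elemTensor (fun _ => u' k) (fun _ => v' k) z)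
    (z : (Fin (a - i) ⊕ Fin (c - j) → ι) × (Fin (b - j) ⊕ Fin (d - i) → ι)) :
    contract i j hia hjb hjc hid f g z = ∑ k : κ × κ', (x k.1 * x' k.2 *
      (dotProduct (u k.1) (v' k.2) ^ i * dotProduct (u' k.2) (v k.1) ^ j)) *
        elemTensor (fun s => if s.isLeft then u k.1 else u' k.2)
          (fun s => if s.isLeft then v k.1 else v' k.2) z := by
  change contractFun i j hia hjb hjc hid f g z = _
  rw [contractFun, tsum_fintype]
  simp only [hf, hg, Finset.sum_mul_sum, elemTensor, prod_glue]
  rw [Fintype.sum_prod_type (α₁ := κ), Finset.sum_comm]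
  refine Finset.sum_congr rfl fun k _ => ?_
  rw [Finset.sum_comm]
  refine Finset.sum_congr rfl fun k' _ => ?_
  rw [← sum_prod_mul_prod_eq_pow, ← sum_prod_mul_prod_eq_pow, Fintype.sum_mul_sum,
    ← Fintype.sum_prod_type', Finset.mul_sum, Finset.sum_mul]
  refine Finset.sum_congr rfl fun w _ => ?_
  simp only [Fintype.prod_sum_type, Function.comp_apply, Sum.isLeft_inl, Sum.isLeft_inr, ↓reduceIte,
    Bool.false_eq_true]
  ring

end Contract

/-! ### Complete contractions of four kernels -/

theorem sum_fin_four {κ : Type*} [Fintype κ] (ρ : Equiv.Perm (Fin 4)) (G : κ → κ → κ → κ → ℂ) :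
    ∑ x : Fin 4 → κ, G (x (ρ 0)) (x (ρ 1)) (x (ρ 2)) (x (ρ 3)) =
      ∑ k : κ × κ, ∑ l : κ × κ, G k.1 k.2 l.1 l.2 := by
  rw [← Fintype.sum_prod_type']
  let E : (Fin 4 → κ) ≃ (κ × κ) × (κ × κ) :=
    { toFun := fun x => ((x 0, x 1), (x 2, x 3))
      invFun := fun p => ![p.1.1, p.1.2, p.2.1, p.2.2]
      left_inv := fun x => by funext a; fin_cases a <;> rfl
      right_inv := fun p => rfl }
  exact Fintype.sum_equiv ((ρ.symm.arrowCongr (Equiv.refl κ)).trans E) _ _ fun x => rfl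

theorem labelCount_isLeft (a b : ℕ) :
    labelCount (Sum.isLeft : Fin a ⊕ Fin b → Bool) true = a ∧
      labelCount (Sum.isLeft : Fin a ⊕ Fin b → Bool) false = b := by
  constructor <;> rw [labelCount, Fintype.sum_sum_type] <;> simp

/-- The Gram matrix of the factors `U` and `V` of four elementary tensors. -/
def gram {ι κ : Type*} [Fintype ι] (U V : Fin 4 → κ → ι → ℂ) (x : Fin 4 → κ) (a b : Fin 4) : ℂ :=
  dotProduct (U a (x a)) (V b (x b))

/-- The total contribution of a contingency table to the contractions of four kernels. -/
def tableValue {ι κ : Type*} [Fintype ι] [Fintype κ] (c : Fin 4 → κ → ℂ) (U V : Fin 4 → κ → ι → ℂ)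
    (e : Fin 4 → Fin 4 → ℕ) : ℂ :=
  ∑ x : Fin 4 → κ, (∏ a, c a (x a)) * tableWeight (gram U V x) e

theorem pow_eq_factorial_mul_divPow (x : ℂ) (k : ℕ) : x ^ k = k.factorial * divPow x k := by
  rw [divPow, mul_div_cancel₀]
  exact_mod_cast k.factorial_ne_zero

section Main

variable {ι κ : Type*} [Fintype ι] [Fintype κ] {M N : Fin 4 → ℕ} {c : Fin 4 → κ → ℂ}
  {U V : Fin 4 → κ → ι → ℂ} {f : ∀ a, TensorKernel ι (Fin (M a)) (Fin (N a))}

/-- For pure powers, every joined pair of slots contributes one Gram entry. Pairs inside the two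
contractions give the four powers, and pairs made by `σ` and `τ` give the two products, in which
only the vertex carrying a slot (`isLeft`) matters. -/
theorem pairAt_contract
    (hf : ∀ a z, f a z = ∑ k, c a k * elemTensor (fun _ => U a k) (fun _ => V a k) z)
    (ρ : Equiv.Perm (Fin 4)) (i j k l : ℕ)
    (h0 : i ≤ M (ρ 0)) (h1 : j ≤ M (ρ 1)) (h2 : k ≤ M (ρ 2)) (h3 : l ≤ M (ρ 3))
    (g0 : j ≤ N (ρ 0)) (g1 : i ≤ N (ρ 1)) (g2 : l ≤ N (ρ 2)) (g3 : k ≤ N (ρ 3)) (σ τ) :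
    pairAt σ τ (contract i j h0 g0 h1 g1 (f (ρ 0)) (f (ρ 1)))
      (contract k l h2 g2 h3 g3 (f (ρ 2)) (f (ρ 3))) =
    ∑ x : Fin 4 → κ, (∏ a, c a (x a)) *
      (gram U V x (ρ 0) (ρ 1) ^ i * gram U V x (ρ 1) (ρ 0) ^ j *
        gram U V x (ρ 2) (ρ 3) ^ k * gram U V x (ρ 3) (ρ 2) ^ l *
        (∏ s, gram U V x (ρ (if s.isLeft then 0 else 1)) (ρ (if (σ s).isLeft then 2 else 3))) *
        ∏ s, gram U V x (ρ (if s.isLeft then 2 else 3)) (ρ (if (τ s).isLeft then 0 else 1))) := by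
  have e1 := funext (contract_apply_of_sum_pow i j h0 g0 h1 g1 (f (ρ 0)) (f (ρ 1)) _ _ _ _ _ _
    (hf (ρ 0)) (hf (ρ 1)))
  have e2 := funext (contract_apply_of_sum_pow k l h2 g2 h3 g3 (f (ρ 2)) (f (ρ 3)) _ _ _ _ _ _
    (hf (ρ 2)) (hf (ρ 3)))
  rw [e1, e2, pairAt_sum_mul]
  simp only [pairAt_elemTensor]
  rw [← sum_fin_four ρ (fun k0 k1 k2 k3 => (c (ρ 0) k0 * c (ρ 1) k1 *
    (dotProduct (U (ρ 0) k0) (V (ρ 1) k1) ^ i * dotProduct (U (ρ 1) k1) (V (ρ 0) k0) ^ j)) *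
    (c (ρ 2) k2 * c (ρ 3) k3 *
    (dotProduct (U (ρ 2) k2) (V (ρ 3) k3) ^ k * dotProduct (U (ρ 3) k3) (V (ρ 2) k2) ^ l)) *
    ((∏ s : Fin (M (ρ 0) - i) ⊕ Fin (M (ρ 1) - j), dotProduct
      (if s.isLeft then U (ρ 0) k0 else U (ρ 1) k1)
      (if (σ s).isLeft then V (ρ 2) k2 else V (ρ 3) k3)) *
    ∏ s : Fin (M (ρ 2) - k) ⊕ Fin (M (ρ 3) - l), dotProduct
      (if s.isLeft then U (ρ 2) k2 else U (ρ 3) k3)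
      (if (τ s).isLeft then V (ρ 0) k0 else V (ρ 1) k1)))]
  refine Finset.sum_congr rfl fun x _ => ?_
  have hc : ∏ a, c a (x a) = c (ρ 0) (x (ρ 0)) * c (ρ 1) (x (ρ 1)) * c (ρ 2) (x (ρ 2)) *
      c (ρ 3) (x (ρ 3)) := by
    rw [← Equiv.prod_comp ρ, Fin.prod_univ_four]
  have hp1 : ∀ s t : Bool, gram U V x (ρ (if s then 0 else 1)) (ρ (if t then 2 else 3)) =
      dotProduct (if s then U (ρ 0) (x (ρ 0)) else U (ρ 1) (x (ρ 1)))
        (if t then V (ρ 2) (x (ρ 2)) else V (ρ 3) (x (ρ 3))) := by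
    intro s t; cases s <;> cases t <;> rfl
  have hp2 : ∀ s t : Bool, gram U V x (ρ (if s then 2 else 3)) (ρ (if t then 0 else 1)) =
      dotProduct (if s then U (ρ 2) (x (ρ 2)) else U (ρ 3) (x (ρ 3)))
        (if t then V (ρ 0) (x (ρ 0)) else V (ρ 1) (x (ρ 1))) := by
    intro s t; cases s <;> cases t <;> rfl
  simp only [hp1, hp2, hc]
  simp only [gram]
  ring

/-- Summing over `σ` and `τ` turns the two products of `pairAt_contract` into permanents of
block-constant matrices, hence into two table sums; by `sum_tables_fiber_perm` these sum up exactly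
the tables with the four prescribed entries. What matters about the constant is that it is a
positive integer. -/
theorem pairing_contract
    (hf : ∀ a z, f a z = ∑ k, c a k * elemTensor (fun _ => U a k) (fun _ => V a k) z)
    (ρ : Equiv.Perm (Fin 4)) (i j k l : ℕ)
    (h0 : i ≤ M (ρ 0)) (h1 : j ≤ M (ρ 1)) (h2 : k ≤ M (ρ 2)) (h3 : l ≤ M (ρ 3))
    (g0 : j ≤ N (ρ 0)) (g1 : i ≤ N (ρ 1)) (g2 : l ≤ N (ρ 2)) (g3 : k ≤ N (ρ 3)) :
    ∃ C : ℕ, 0 < C ∧ pairing (contract i j h0 g0 h1 g1 (f (ρ 0)) (f (ρ 1)))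
      (contract k l h2 g2 h3 g3 (f (ρ 2)) (f (ρ 3))) =
      C * ∑ e ∈ (tables M N).filter (fun e => e (ρ 0) (ρ 1) = i ∧ e (ρ 1) (ρ 0) = j ∧
        e (ρ 2) (ρ 3) = k ∧ e (ρ 3) (ρ 2) = l), tableValue c U V e := by
  -- The first four factorials turn powers into divided powers; the others are the block sizes of
  -- the two permanents.
  refine ⟨i.factorial * j.factorial * k.factorial * l.factorial *
    ((M (ρ 0) - i).factorial * (M (ρ 1) - j).factorial *
      ((N (ρ 2) - l).factorial * (N (ρ 3) - k).factorial)) *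
    ((M (ρ 2) - k).factorial * (M (ρ 3) - l).factorial *
      ((N (ρ 0) - j).factorial * (N (ρ 1) - i).factorial)), by positivity, ?_⟩
  simp only [tableValue]
  rw [Finset.sum_comm]
  simp only [← Finset.mul_sum,
    sum_tables_fiber_perm ρ _ M N i j k l h0 h1 h2 h3 g0 g1 g2 g3]
  rw [pairing]
  simp only [pairAt_contract hf ρ i j k l h0 h1 h2 h3 g0 g1 g2 g3]
  simp only [Finset.sum_comm (t := (Finset.univ : Finset (Fin 4 → κ)))]
  rw [Finset.mul_sum]
  refine Finset.sum_congr rfl fun x _ => ?_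
  simp only [mul_assoc, ← Finset.mul_sum, ← Finset.sum_mul]
  have s1 := sum_equiv_prod_block
    (fun s t => gram U V x (ρ (if s then 0 else 1)) (ρ (if t then 2 else 3)))
    (Fin (M (ρ 0) - i) ⊕ Fin (M (ρ 1) - j)) (Fin (N (ρ 2) - l) ⊕ Fin (N (ρ 3) - k))
    Sum.isLeft Sum.isLeft
  have s2 := sum_equiv_prod_block
    (fun s t => gram U V x (ρ (if s then 2 else 3)) (ρ (if t then 0 else 1)))
    (Fin (M (ρ 2) - k) ⊕ Fin (M (ρ 3) - l)) (Fin (N (ρ 0) - j) ⊕ Fin (N (ρ 1) - i))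
    Sum.isLeft Sum.isLeft
  simp only [labelCount_isLeft] at s1 s2
  rw [s1, s2]
  simp only [pow_eq_factorial_mul_divPow]
  push_cast
  ring

end Main

end

/-! ### Polarization -/

/-- If `φ` misses `s₀`, flipping the sign `ε s₀` negates the summand, so the sum vanishes; if `φ` is
bijective the two products are equal and every summand is `1`. -/
theorem sum_sign_prod_comp {m : ℕ} (φ : Fin m → Fin m) :
    ∑ ε : Fin m → ℤˣ, (((∏ s, ε s) * ∏ t, ε (φ t) : ℤˣ) : ℤ) =
      if Function.Bijective φ then 2 ^ m else 0 := by
  split_ifs with hφ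
  · have : ∀ ε : Fin m → ℤˣ, (∏ s, ε s) * ∏ t, ε (φ t) = 1 := fun ε => by
      rw [Fintype.prod_bijective φ hφ _ ε fun _ => rfl]
      exact Int.units_mul_self _
    simp [this, Fintype.card_units_int]
  · have hs : ¬ Function.Surjective φ := fun h => hφ (Finite.surjective_iff_bijective.1 h)
    obtain ⟨s₀, hs₀⟩ := not_forall.1 hs
    have hs₀' : ∀ t, φ t ≠ s₀ := fun t ht => hs₀ ⟨t, ht⟩
    have key : ∀ ε : Fin m → ℤˣ,
        (∏ s, (ε * Pi.mulSingle s₀ (-1) : Fin m → ℤˣ) s) *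
          ∏ t, (ε * Pi.mulSingle s₀ (-1) : Fin m → ℤˣ) (φ t) =
        -((∏ s, ε s) * ∏ t, ε (φ t)) := fun ε => by
      simp [Finset.prod_mul_distrib, Pi.mulSingle_eq_of_ne (hs₀' _)]
    have := Equiv.sum_comp (Equiv.mulRight (Pi.mulSingle s₀ (-1) : Fin m → ℤˣ))
      fun ε : Fin m → ℤˣ => (((∏ s, ε s) * ∏ t, ε (φ t) : ℤˣ) : ℤ)
    simp only [Equiv.coe_mulRight, key, Units.val_neg, Finset.sum_neg_distrib] at this
    omega

/-- Glynn's formula for the permanent. -/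
theorem sum_sign_mul_prod_sum {m : ℕ} (a : Fin m → Fin m → ℂ) :
    ∑ ε : Fin m → ℤˣ, (((∏ s, ε s : ℤˣ) : ℤ) : ℂ) * ∏ t, ∑ s, (((ε s : ℤˣ) : ℤ) : ℂ) * a s t =
      2 ^ m * ∑ σ : Equiv.Perm (Fin m), ∏ t, a (σ t) t := by
  classical
  simp only [Finset.prod_univ_sum, Fintype.piFinset_univ, Finset.mul_sum]
  rw [Finset.sum_comm]
  have h1 : ∀ φ : Fin m → Fin m, ∑ ε : Fin m → ℤˣ, (((∏ s, ε s : ℤˣ) : ℤ) : ℂ) *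
      ∏ t, (((ε (φ t) : ℤˣ) : ℤ) : ℂ) * a (φ t) t =
      (∏ t, a (φ t) t) * if Function.Bijective φ then 2 ^ m else 0 := fun φ => by
    have := congrArg (fun k : ℤ => (k : ℂ)) (sum_sign_prod_comp φ)
    push_cast at this
    rw [← this, Finset.mul_sum]
    refine Finset.sum_congr rfl fun ε _ => ?_
    rw [Finset.prod_mul_distrib]
    push_cast
    ring
  simp only [h1, mul_ite, mul_zero, ← Finset.sum_filter]
  symm
  refine Finset.sum_bij (fun σ _ => (σ : Fin m → Fin m)) ?_ ?_ ?_ ?_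
  · intro σ _; exact Finset.mem_filter.2 ⟨Finset.mem_univ _, σ.bijective⟩
  · intro σ _ τ _ h; exact Equiv.coe_fn_injective h
  · intro φ hφ
    exact ⟨Equiv.ofBijective φ (Finset.mem_filter.1 hφ).2, Finset.mem_univ _, rfl⟩
  · intro σ _; ring

/-- Each `σ` selects the single tuple `x ∘ σ⁻¹`, where `g` has the value `g x` by symmetry. -/
theorem sum_mul_perm_delta {ι : Type*} [Fintype ι] [DecidableEq ι] {m : ℕ}
    (g : (Fin m → ι) → ℂ) (hg : ∀ (σ : Equiv.Perm (Fin m)) p, g (p ∘ σ) = g p) (x : Fin m → ι) :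
    ∑ p, g p * ∑ σ : Equiv.Perm (Fin m), ∏ t, (if p (σ t) = x t then (1 : ℂ) else 0) =
      m.factorial * g x := by
  simp only [Finset.mul_sum]
  rw [Finset.sum_comm]
  have : ∀ σ : Equiv.Perm (Fin m), ∑ p, g p * ∏ t, (if p (σ t) = x t then (1 : ℂ) else 0) = g x := by
    intro σ
    rw [Finset.sum_eq_single (x ∘ σ.symm)]
    · rw [hg]; simp
    · intro p _ hp
      obtain ⟨t, ht⟩ := Function.ne_iff.1 hp
      rw [Finset.prod_eq_zero (Finset.mem_univ (σ.symm t)), mul_zero]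
      simpa using ht
    · simp
  simp [this, Fintype.card_perm]

/-- A symmetric kernel over a finite index set is a combination of pure powers. -/
theorem exists_eq_sum_pow {ι : Type*} [Fintype ι] {m n : ℕ} (f : (Fin m → ι) × (Fin n → ι) → ℂ)
    (hf : ∀ (σ : Equiv.Perm (Fin m)) (τ : Equiv.Perm (Fin n)) p q, f (p ∘ σ, q ∘ τ) = f (p, q)) :
    ∃ (c : ((Fin m → ι) × (Fin m → ℤˣ)) × ((Fin n → ι) × (Fin n → ℤˣ)) → ℂ) (u v : _ → ι → ℂ),
      ∀ z, f z = ∑ k, c k * elemTensor (fun _ => u k) (fun _ => v k) z := by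
  classical
  -- Polarization of each basis vector: a summand carries a multi-index and a sign vector, and its
  -- factors are the signed sums of the corresponding basis vectors. Glynn's formula produces `2 ^
  -- m`, and the permutations of a symmetric kernel produce `m!`.
  refine ⟨fun k => f (k.1.1, k.2.1) * (((∏ s, k.1.2 s : ℤˣ) : ℤ) : ℂ) *
      (((∏ s, k.2.2 s : ℤˣ) : ℤ) : ℂ) / (2 ^ m * m.factorial * (2 ^ n * n.factorial)),
    fun k x => ∑ s, (((k.1.2 s : ℤˣ) : ℤ) : ℂ) * (if k.1.1 s = x then 1 else 0),
    fun k x => ∑ s, (((k.2.2 s : ℤˣ) : ℤ) : ℂ) * (if k.2.1 s = x then 1 else 0), ?_⟩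
  rintro ⟨x, y⟩
  have hm : (2 ^ m * m.factorial : ℂ) ≠ 0 :=
    mul_ne_zero (by simp) (by exact_mod_cast m.factorial_ne_zero)
  have hn : (2 ^ n * n.factorial : ℂ) ≠ 0 :=
    mul_ne_zero (by simp) (by exact_mod_cast n.factorial_ne_zero)
  have h1 : ∀ p, ∑ q, f (p, q) * ∑ η : Fin n → ℤˣ, (((∏ s, η s : ℤˣ) : ℤ) : ℂ) *
      ∏ t, ∑ s, (((η s : ℤˣ) : ℤ) : ℂ) * (if q s = y t then (1 : ℂ) else 0) =
      2 ^ n * n.factorial * f (p, y) := fun p => by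
    have hp := sum_mul_perm_delta (fun q => f (p, q)) (fun τ q => by simpa using hf 1 τ p q) y
    rw [mul_assoc, ← hp, Finset.mul_sum]
    refine Finset.sum_congr rfl fun q _ => ?_
    rw [sum_sign_mul_prod_sum (fun s t => if q s = y t then (1 : ℂ) else 0)]
    ring
  have h2 : ∑ p, f (p, y) * ∑ ε : Fin m → ℤˣ, (((∏ s, ε s : ℤˣ) : ℤ) : ℂ) *
      ∏ t, ∑ s, (((ε s : ℤˣ) : ℤ) : ℂ) * (if p s = x t then (1 : ℂ) else 0) =
      2 ^ m * m.factorial * f (x, y) := by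
    have hp := sum_mul_perm_delta (fun p => f (p, y)) (fun σ p => by simpa using hf σ 1 p y) x
    rw [mul_assoc, ← hp, Finset.mul_sum]
    refine Finset.sum_congr rfl fun p _ => ?_
    rw [sum_sign_mul_prod_sum (fun s t => if p s = x t then (1 : ℂ) else 0)]
    ring
  have h3 : f (x, y) * (2 ^ m * m.factorial * (2 ^ n * n.factorial)) =
      ∑ p, (∑ q, f (p, q) * ∑ η : Fin n → ℤˣ, (((∏ s, η s : ℤˣ) : ℤ) : ℂ) *
      ∏ t, ∑ s, (((η s : ℤˣ) : ℤ) : ℂ) * (if q s = y t then (1 : ℂ) else 0)) *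
      ∑ ε : Fin m → ℤˣ, (((∏ s, ε s : ℤˣ) : ℤ) : ℂ) *
      ∏ t, ∑ s, (((ε s : ℤˣ) : ℤ) : ℂ) * (if p s = x t then (1 : ℂ) else 0) := by
    simp only [h1, mul_assoc, ← Finset.mul_sum]
    rw [h2]
    ring
  rw [← mul_div_cancel_right₀ (f (x, y)) (mul_ne_zero hm hn), h3, Finset.sum_div,
    Fintype.sum_prod_type, Fintype.sum_prod_type]
  refine Finset.sum_congr rfl fun p _ => ?_
  rw [Finset.mul_sum, Finset.sum_div]
  refine Finset.sum_congr rfl fun ε _ => ?_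
  rw [Finset.sum_mul, Finset.sum_div, Fintype.sum_prod_type]
  refine Finset.sum_congr rfl fun q _ => ?_
  rw [Finset.mul_sum, Finset.sum_mul, Finset.sum_div]
  refine Finset.sum_congr rfl fun η _ => ?_
  simp only [elemTensor]
  ring

section

/-! ### Norms, adjoints and symmetrizations -/

theorem norm_sq_eq_tsum {X : Type*} (f : lp (fun _ : X => ℂ) 2) : ‖f‖ ^ 2 = ∑' x, ‖f x‖ ^ 2 := by
  have := lp.norm_rpow_eq_tsum (p := 2) (by norm_num) f
  simpa using this

/-- `Y` is the kernel of the complex conjugate of the integral of `X`. -/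
def IsAdj {ι α β : Type*} (X : TensorKernel ι α β) (Y : TensorKernel ι β α) : Prop :=
  ∀ p q, Y (q, p) = conj (X (p, q))

section Adjoint

variable {ι α β : Type*}

theorem IsAdj.symm {X : TensorKernel ι α β} {Y : TensorKernel ι β α} (h : IsAdj X Y) :
    IsAdj Y X := fun p q => by rw [h, Complex.conj_conj]

theorem IsAdj.norm_eq {X : TensorKernel ι α β} {Y : TensorKernel ι β α} (h : IsAdj X Y) :
    ‖Y‖ = ‖X‖ := by
  rw [← sq_eq_sq₀ (norm_nonneg _) (norm_nonneg _), norm_sq_eq_tsum, norm_sq_eq_tsum,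
    ← (Equiv.prodComm (α → ι) (β → ι)).tsum_eq]
  refine tsum_congr fun z => ?_
  rw [Equiv.prodComm_apply, Prod.swap, h]
  simp

theorem IsAdj.symmetrize [Fintype α] [DecidableEq α] [Fintype β] [DecidableEq β]
    {X : TensorKernel ι α β} {Y : TensorKernel ι β α} (h : IsAdj X Y) :
    IsAdj (symmetrize X) (symmetrize Y) := by
  intro p q
  change symFun Y (q, p) = conj (symFun X (p, q))
  rw [symFun, symFun, map_mul, map_sum, ← (Equiv.prodComm _ _).sum_comp]
  congr 1
  · simp [mul_comm]
  · refine Finset.sum_congr rfl fun s _ => ?_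
    exact h _ _

/-- Conjugation exchanges the two kinds of slots, so `i` and `j` trade places. -/
theorem IsAdj.contract {a b c d : ℕ} {i j : ℕ} {hia : i ≤ a} {hjb : j ≤ b} {hjc : j ≤ c}
    {hid : i ≤ d} {f : TensorKernel ι (Fin a) (Fin b)} {g : TensorKernel ι (Fin c) (Fin d)}
    {f' : TensorKernel ι (Fin b) (Fin a)} {g' : TensorKernel ι (Fin d) (Fin c)}
    (hf : IsAdj f f') (hg : IsAdj g g') :
    IsAdj (contract i j hia hjb hjc hid f g) (contract j i hjb hia hid hjc f' g') := by
  intro p q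
  change contractFun j i hjb hia hid hjc f' g' (q, p) =
    conj (contractFun i j hia hjb hjc hid f g (p, q))
  rw [contractFun, contractFun, Complex.conj_tsum, ← (Equiv.prodComm _ _).tsum_eq]
  refine tsum_congr fun w => ?_
  rw [map_mul, ← hf, ← hg]
  rfl

end Adjoint

section Bounds

variable {ι α β α' β' : Type*} [Fintype ι] [Fintype β] [Fintype β']
  [DecidableEq β] [DecidableEq β']

/-- This is how norms without symmetrization enter the table calculus: as one particular matching of
a kernel with its adjoint. -/
theorem pairAt_refl_of_isAdj [Fintype α] [DecidableEq α] {X : TensorKernel ι α β}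
    {Y : TensorKernel ι β α} (h : IsAdj X Y) :
    pairAt (Equiv.refl α) (Equiv.refl β) X Y = ((‖X‖ ^ 2 : ℝ) : ℂ) := by
  rw [norm_sq_eq_tsum, tsum_fintype, pairAt, Complex.ofReal_sum]
  refine Finset.sum_congr rfl fun z => ?_
  simp only [Equiv.coe_refl, Function.comp_id]
  rw [h, Complex.mul_conj, Complex.normSq_eq_norm_sq]
  simp

theorem norm_pairAt_le [Fintype α] [Fintype α'] [DecidableEq α] [DecidableEq α']
    (σ : α ≃ β') (τ : α' ≃ β) (X : TensorKernel ι α β)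
    (Y : TensorKernel ι α' β') : ‖pairAt σ τ X Y‖ ≤ ‖X‖ * ‖Y‖ := by
  have hX : ∑ z : (β' → ι) × (β → ι), ‖X (z.1 ∘ σ, z.2)‖ ^ 2 = ‖X‖ ^ 2 := by
    rw [norm_sq_eq_tsum, tsum_fintype]
    exact Fintype.sum_equiv ((σ.symm.arrowCongr (Equiv.refl ι)).prodCongr (Equiv.refl _)) _ _
      fun z => rfl
  have hY : ∑ z : (β' → ι) × (β → ι), ‖Y (z.2 ∘ τ, z.1)‖ ^ 2 = ‖Y‖ ^ 2 := by
    rw [norm_sq_eq_tsum, tsum_fintype]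
    exact Fintype.sum_equiv ((Equiv.prodComm _ _).trans
      ((τ.symm.arrowCongr (Equiv.refl ι)).prodCongr (Equiv.refl _))) _ _ fun z => rfl
  have hcs := Finset.sum_mul_sq_le_sq_mul_sq (Finset.univ : Finset ((β' → ι) × (β → ι)))
    (fun z => ‖X (z.1 ∘ σ, z.2)‖) (fun z => ‖Y (z.2 ∘ τ, z.1)‖)
  rw [hX, hY, ← mul_pow] at hcs
  refine le_trans ?_ (le_of_abs_le (abs_le_of_sq_le_sq hcs (by positivity)))
  refine (norm_sum_le _ _).trans (le_of_eq ?_)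
  simp

/-- Permutations of the slots can be absorbed into the matchings. -/
theorem pairAt_comp (σ : α ≃ β') (τ : α' ≃ β) (π : Equiv.Perm α) (ν : Equiv.Perm β)
    (π' : Equiv.Perm α') (ν' : Equiv.Perm β') (X : (α → ι) × (β → ι) → ℂ)
    (Y : (α' → ι) × (β' → ι) → ℂ) :
    pairAt σ τ (fun z => X (z.1 ∘ π, z.2 ∘ ν)) (fun z => Y (z.1 ∘ π', z.2 ∘ ν')) =
      pairAt (π.trans (σ.trans ν'.symm)) (π'.trans (τ.trans ν.symm)) X Y := by
  refine Fintype.sum_equiv ((ν'.symm.arrowCongr (Equiv.refl ι)).prodCongr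
    (ν.symm.arrowCongr (Equiv.refl ι))) _ _ fun z => ?_
  have h1 : ((z.1 ∘ ν') ∘ (ν'.symm ∘ σ ∘ π)) = z.1 ∘ σ ∘ π := by ext; simp
  have h2 : ((z.2 ∘ ν) ∘ (ν.symm ∘ τ ∘ π')) = z.2 ∘ τ ∘ π' := by ext; simp
  change X ((z.1 ∘ σ) ∘ π, z.2 ∘ ν) * Y ((z.2 ∘ τ) ∘ π', z.1 ∘ ν') =
    X ((z.1 ∘ ν') ∘ (ν'.symm ∘ σ ∘ π), z.2 ∘ ν) * Y ((z.2 ∘ ν) ∘ (ν.symm ∘ τ ∘ π'), z.1 ∘ ν')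
  rw [h1, h2]
  rfl

variable [Fintype α] [Fintype α'] [DecidableEq α] [DecidableEq α']

/-- Averaging over slot permutations carries one fixed matching uniformly over all matchings, so the
right-hand contraction is the mean over matchings. The factorials count them. -/
theorem pairing_eq_mul_pairAt_symmetrize (σ₀ : α ≃ β') (τ₀ : α' ≃ β) (X : TensorKernel ι α β)
    (Y : TensorKernel ι α' β') :
    pairing X Y = (Fintype.card α).factorial * (Fintype.card α').factorial *
      pairAt σ₀ τ₀ (symmetrize X) (symmetrize Y) := by
  have hX : (symmetrize X : (α → ι) × (β → ι) → ℂ) = fun z => ∑ s : Equiv.Perm α × Equiv.Perm β,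
      (((Fintype.card α).factorial : ℂ) * ((Fintype.card β).factorial : ℂ))⁻¹ *
        X (z.1 ∘ s.1, z.2 ∘ s.2) := by
    funext z
    rw [← Finset.mul_sum]
    rfl
  have hY : (symmetrize Y : (α' → ι) × (β' → ι) → ℂ) =
      fun z => ∑ s : Equiv.Perm α' × Equiv.Perm β',
      (((Fintype.card α').factorial : ℂ) * ((Fintype.card β').factorial : ℂ))⁻¹ *
        Y (z.1 ∘ s.1, z.2 ∘ s.2) := by
    funext z
    rw [← Finset.mul_sum]
    rfl
  rw [hX, hY, pairAt_sum_mul _ _ _ _ (fun (s : Equiv.Perm α × Equiv.Perm β) z =>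
    X (z.1 ∘ s.1, z.2 ∘ s.2)) (fun (s : Equiv.Perm α' × Equiv.Perm β') z =>
    Y (z.1 ∘ s.1, z.2 ∘ s.2))]
  simp only [pairAt_comp, ← Finset.mul_sum]
  have h1 : ∀ ν : Equiv.Perm β, ∀ ν' : Equiv.Perm β', ∑ π : Equiv.Perm α, ∑ π' : Equiv.Perm α',
      pairAt (π.trans (σ₀.trans ν'.symm)) (π'.trans (τ₀.trans ν.symm)) X Y = pairing X Y := by
    intro ν ν'
    refine Fintype.sum_equiv ((Equiv.refl α).equivCongr (σ₀.trans ν'.symm)) _ _ fun π => ?_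
    exact Fintype.sum_equiv ((Equiv.refl α').equivCongr (τ₀.trans ν.symm)) _ _ fun π' => rfl
  have h2 : ∑ s : Equiv.Perm α × Equiv.Perm β, ∑ s' : Equiv.Perm α' × Equiv.Perm β',
      pairAt (s.1.trans (σ₀.trans s'.2.symm)) (s'.1.trans (τ₀.trans s.2.symm)) X Y =
      (Fintype.card β).factorial * (Fintype.card β').factorial * pairing X Y := by
    simp only [Fintype.sum_prod_type]
    rw [Finset.sum_comm]
    have h3 : ∀ ν : Equiv.Perm β, ∑ π : Equiv.Perm α, ∑ π' : Equiv.Perm α', ∑ ν' : Equiv.Perm β',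
        pairAt (π.trans (σ₀.trans ν'.symm)) (π'.trans (τ₀.trans ν.symm)) X Y =
        (Fintype.card β').factorial * pairing X Y := by
      intro ν
      simp only [Finset.sum_comm (t := (Finset.univ : Finset (Equiv.Perm β')))]
      simp [h1, Fintype.card_perm]
    simp [h3, Fintype.card_perm, mul_assoc]
  rw [h2]
  have hc : ∀ k : ℕ, (k.factorial : ℂ) ≠ 0 := fun k => by exact_mod_cast k.factorial_ne_zero
  have := hc (Fintype.card α)
  have := hc (Fintype.card β)
  have := hc (Fintype.card α')
  have := hc (Fintype.card β')
  field_simp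

theorem norm_pairing_le (X : TensorKernel ι α β) (Y : TensorKernel ι α' β') :
    ‖pairing X Y‖ ≤ (Fintype.card α).factorial * (Fintype.card α').factorial *
      (‖symmetrize X‖ * ‖symmetrize Y‖) := by
  by_cases h : Nonempty (α ≃ β') ∧ Nonempty (α' ≃ β)
  · obtain ⟨⟨σ⟩, ⟨τ⟩⟩ := h
    rw [pairing_eq_mul_pairAt_symmetrize σ τ, norm_mul, norm_mul]
    simp only [Complex.norm_natCast]
    gcongr
    exact norm_pairAt_le _ _ _ _
  -- If the numbers of slots disagree there is no matching and the sum is empty.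
  · have : pairing X Y = 0 := by
      rw [not_and_or, not_nonempty_iff, not_nonempty_iff] at h
      rcases h with h | h <;> simp [pairing]
    rw [this, norm_zero]
    positivity

end Bounds

/-- The symmetrization is a mean of the kernels `T s`, each a reindexing of `X` with the same norm.
-/
theorem norm_symmetrize_le {ι α β : Type*} [Fintype α] [DecidableEq α] [Fintype β] [DecidableEq β]
    (X : TensorKernel ι α β) : ‖symmetrize X‖ ≤ ‖X‖ := by
  let T : Equiv.Perm α × Equiv.Perm β → TensorKernel ι α β := fun s =>
    ⟨fun z => X (z.1 ∘ s.1, z.2 ∘ s.2), memlp_comp (lp.memℓp X)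
      (φ := fun z : (α → ι) × (β → ι) => (z.1 ∘ s.1, z.2 ∘ s.2)) (by
        rintro ⟨x1, x2⟩ ⟨y1, y2⟩ h
        obtain ⟨h1, h2⟩ := Prod.mk.inj h
        exact Prod.ext (s.1.surjective.injective_comp_right h1)
          (s.2.surjective.injective_comp_right h2))⟩
  have hT : ∀ s, ‖T s‖ = ‖X‖ := fun s => by
    rw [← sq_eq_sq₀ (norm_nonneg _) (norm_nonneg _), norm_sq_eq_tsum, norm_sq_eq_tsum]
    exact ((s.1.symm.arrowCongr (Equiv.refl ι)).prodCongr
      (s.2.symm.arrowCongr (Equiv.refl ι))).tsum_eq (fun z => ‖X z‖ ^ 2)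
  have hs : symmetrize X = (((Fintype.card α).factorial : ℂ) * ((Fintype.card β).factorial : ℂ))⁻¹ •
      ∑ s, T s := by
    ext z
    rw [lp.coeFn_smul, lp.coeFn_sum]
    change symFun X z = _
    simp [symFun, T]
  rw [hs, norm_smul]
  calc _ ≤ ‖(((Fintype.card α).factorial : ℂ) * ((Fintype.card β).factorial : ℂ))⁻¹‖ *
        ∑ s, ‖T s‖ := by gcongr; exact norm_sum_le _ _
    _ = ‖X‖ := by
      simp only [hT, Finset.sum_const, Finset.card_univ, Fintype.card_prod, Fintype.card_perm,
        nsmul_eq_mul, norm_inv, norm_mul, Complex.norm_natCast]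
      have h1 : ((Fintype.card α).factorial : ℝ) ≠ 0 := by exact_mod_cast Nat.factorial_ne_zero _
      have h2 : ((Fintype.card β).factorial : ℝ) ≠ 0 := by exact_mod_cast Nat.factorial_ne_zero _
      push_cast
      field_simp

end

section

/-! ### Bounding contractions by symmetrized contractions -/

section Tables

variable {ι κ : Type*} [Fintype ι] [Fintype κ] {M N : Fin 4 → ℕ} {c : Fin 4 → κ → ℂ}
  {U V : Fin 4 → κ → ι → ℂ} {f : ∀ a, TensorKernel ι (Fin (M a)) (Fin (N a))}

theorem sum_row_perm {e : Fin 4 → Fin 4 → ℕ} (he : e ∈ tables M N) (ρ : Equiv.Perm (Fin 4))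
    (a : Fin 4) : e a (ρ 0) + e a (ρ 1) + e a (ρ 2) + e a (ρ 3) = M a := by
  rw [← (mem_tables.1 he).1 a, ← Equiv.sum_comp ρ, Fin.sum_univ_four]

theorem sum_col_perm {e : Fin 4 → Fin 4 → ℕ} (he : e ∈ tables M N) (ρ : Equiv.Perm (Fin 4))
    (b : Fin 4) : e (ρ 0) b + e (ρ 1) b + e (ρ 2) b + e (ρ 3) b = N b := by
  rw [← (mem_tables.1 he).2.1 b, ← Equiv.sum_comp ρ (fun a => e a b), Fin.sum_univ_four]

/-- A table without edges between the vertices `ρ 0, ρ 3` and between `ρ 1, ρ 2` is determined by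
four of its entries, and its contribution is a full contraction. -/
theorem pairAt_contract_eq_tableValue
    (hf : ∀ a z, f a z = ∑ k, c a k * elemTensor (fun _ => U a k) (fun _ => V a k) z)
    (ρ : Equiv.Perm (Fin 4)) {e : Fin 4 → Fin 4 → ℕ} (he : e ∈ tables M N)
    (e03 : e (ρ 0) (ρ 3) = 0) (e30 : e (ρ 3) (ρ 0) = 0) (e12 : e (ρ 1) (ρ 2) = 0)
    (e21 : e (ρ 2) (ρ 1) = 0) (i j k l : ℕ) (hi : e (ρ 0) (ρ 1) = i) (hj : e (ρ 1) (ρ 0) = j)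
    (hk : e (ρ 2) (ρ 3) = k) (hl : e (ρ 3) (ρ 2) = l)
    (h0 : i ≤ M (ρ 0)) (h1 : j ≤ M (ρ 1)) (h2 : k ≤ M (ρ 2)) (h3 : l ≤ M (ρ 3))
    (g0 : j ≤ N (ρ 0)) (g1 : i ≤ N (ρ 1)) (g2 : l ≤ N (ρ 2)) (g3 : k ≤ N (ρ 3))
    (σ : Fin (M (ρ 0) - i) ⊕ Fin (M (ρ 1) - j) ≃ Fin (N (ρ 2) - l) ⊕ Fin (N (ρ 3) - k))
    (τ : Fin (M (ρ 2) - k) ⊕ Fin (M (ρ 3) - l) ≃ Fin (N (ρ 0) - j) ⊕ Fin (N (ρ 1) - i))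
    (hσ : ∀ s, (σ s).isLeft = s.isLeft) (hτ : ∀ s, (τ s).isLeft = s.isLeft) :
    ∃ C : ℕ, 0 < C ∧ C ≤ ∏ a, (M a).factorial ^ 4 ∧
      pairAt σ τ (contract i j h0 g0 h1 g1 (f (ρ 0)) (f (ρ 1)))
        (contract k l h2 g2 h3 g3 (f (ρ 2)) (f (ρ 3))) = C * tableValue c U V e := by
  have hd := (mem_tables.1 he).2.2
  have r0 := sum_row_perm he ρ (ρ 0)
  have r1 := sum_row_perm he ρ (ρ 1)
  have r2 := sum_row_perm he ρ (ρ 2)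
  have r3 := sum_row_perm he ρ (ρ 3)
  rw [hd, hi, e03] at r0
  rw [hd, hj, e12] at r1
  rw [hd, hk, e21] at r2
  rw [hd, hl, e30] at r3
  -- These factorials undo the divided powers. Each row has four entries, all at most the row sum,
  -- whence the exponent `4`.
  refine ⟨∏ a, ∏ b, (e (ρ a) (ρ b)).factorial, by positivity, ?_, ?_⟩
  · rw [← Equiv.prod_comp ρ fun a => (M a).factorial ^ 4]
    refine Finset.prod_le_prod' fun a _ => ?_
    refine (Finset.prod_le_pow_card _ _ _ fun b _ => Nat.factorial_le ?_).trans_eq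
      (by rw [Finset.card_univ, Fintype.card_fin])
    rw [← (mem_tables.1 he).1 (ρ a)]
    exact Finset.single_le_sum (f := e (ρ a)) (fun _ _ => Nat.zero_le _) (Finset.mem_univ _)
  rw [pairAt_contract hf, tableValue, Finset.mul_sum]
  refine Finset.sum_congr rfl fun x _ => ?_
  have hw : tableWeight (gram U V x) e =
      ∏ a, ∏ b, divPow (gram U V x (ρ a) (ρ b)) (e (ρ a) (ρ b)) := by
    rw [tableWeight, ← Equiv.prod_comp ρ]
    exact Finset.prod_congr rfl fun a _ =>
      (Equiv.prod_comp ρ fun b => divPow (gram U V x (ρ a) b) (e (ρ a) b)).symm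
  rw [hw]
  simp only [hσ, hτ, Fintype.prod_sum_type, Sum.isLeft_inl, Sum.isLeft_inr, ↓reduceIte,
    Bool.false_eq_true, Finset.prod_const, Finset.card_univ, Fintype.card_fin]
  rw [show M (ρ 0) - i = e (ρ 0) (ρ 2) by omega, show M (ρ 1) - j = e (ρ 1) (ρ 3) by omega,
    show M (ρ 2) - k = e (ρ 2) (ρ 0) by omega, show M (ρ 3) - l = e (ρ 3) (ρ 1) by omega]
  subst hi hj hk hl
  simp only [Fin.prod_univ_four, hd, e03, e30, e12, e21, pow_eq_factorial_mul_divPow]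
  have hz : ∀ z : ℂ, divPow z 0 = 1 := fun z => by simp [divPow]
  simp only [hz, Nat.factorial_zero]
  push_cast
  ring

/-- If some table has the prescribed entries, its row and column sums supply the inequalities needed
to form the contractions; otherwise the sum is empty. The integer constant of `pairing_contract` is
at least `1` and can be dropped. -/
theorem norm_sum_fiber_le
    (hf : ∀ a z, f a z = ∑ k, c a k * elemTensor (fun _ => U a k) (fun _ => V a k) z)
    (ρ : Equiv.Perm (Fin 4)) (i j k l : ℕ) {δ : ℝ} (hδ : 0 ≤ δ)
    (h : ∀ (h0 : i ≤ M (ρ 0)) (h1 : j ≤ M (ρ 1)) (h2 : k ≤ M (ρ 2)) (h3 : l ≤ M (ρ 3))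
      (g0 : j ≤ N (ρ 0)) (g1 : i ≤ N (ρ 1)) (g2 : l ≤ N (ρ 2)) (g3 : k ≤ N (ρ 3)),
      ‖pairing (contract i j h0 g0 h1 g1 (f (ρ 0)) (f (ρ 1)))
        (contract k l h2 g2 h3 g3 (f (ρ 2)) (f (ρ 3)))‖ ≤ δ) :
    ‖∑ e ∈ (tables M N).filter (fun e => e (ρ 0) (ρ 1) = i ∧ e (ρ 1) (ρ 0) = j ∧
        e (ρ 2) (ρ 3) = k ∧ e (ρ 3) (ρ 2) = l), tableValue c U V e‖ ≤ δ := by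
  rcases Finset.eq_empty_or_nonempty ((tables M N).filter (fun e => e (ρ 0) (ρ 1) = i ∧
    e (ρ 1) (ρ 0) = j ∧ e (ρ 2) (ρ 3) = k ∧ e (ρ 3) (ρ 2) = l)) with h' | ⟨e, he⟩
  · rw [h']; simpa using hδ
  obtain ⟨he, hi, hj, hk, hl⟩ := Finset.mem_filter.1 he
  have r0 := sum_row_perm he ρ (ρ 0)
  have r1 := sum_row_perm he ρ (ρ 1)
  have r2 := sum_row_perm he ρ (ρ 2)
  have r3 := sum_row_perm he ρ (ρ 3)
  have s0 := sum_col_perm he ρ (ρ 0)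
  have s1 := sum_col_perm he ρ (ρ 1)
  have s2 := sum_col_perm he ρ (ρ 2)
  have s3 := sum_col_perm he ρ (ρ 3)
  obtain ⟨C, hC, hp⟩ := pairing_contract hf ρ i j k l (by omega) (by omega) (by omega) (by omega)
    (by omega) (by omega) (by omega) (by omega)
  have := h (by omega) (by omega) (by omega) (by omega)
    (by omega) (by omega) (by omega) (by omega)
  rw [hp, norm_mul, Complex.norm_natCast] at this
  refine le_trans (le_mul_of_one_le_left (norm_nonneg _) ?_) this
  exact_mod_cast hC

/-- Weighted sums over the tables with an intermediate number of edges between `ρ 0` and `ρ 1`. -/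
theorem norm_sum_weight_le (S : (Fin 4 → Fin 4 → ℕ) → ℂ) (ρ : Equiv.Perm (Fin 4)) (L : ℕ) {δ : ℝ}
    (hδ : 0 ≤ δ) (hx : ∀ e ∈ tables M N, e (ρ 0) (ρ 1) + e (ρ 1) (ρ 0) =
      e (ρ 2) (ρ 3) + e (ρ 3) (ρ 2))
    (h : ∀ i j k l, 0 < i + j → i + j < L → i + j = k + l →
      ‖∑ e ∈ (tables M N).filter (fun e => e (ρ 0) (ρ 1) = i ∧ e (ρ 1) (ρ 0) = j ∧
        e (ρ 2) (ρ 3) = k ∧ e (ρ 3) (ρ 2) = l), S e‖ ≤ δ) (w : ℕ → ℕ) (hw : ∀ x ≤ L, w x ≤ L) :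
    ‖∑ e ∈ (tables M N).filter (fun e => 0 < e (ρ 0) (ρ 1) + e (ρ 1) (ρ 0) ∧
      e (ρ 0) (ρ 1) + e (ρ 1) (ρ 0) < L), (w (e (ρ 0) (ρ 1) + e (ρ 1) (ρ 0)) : ℂ) * S e‖ ≤
      (L : ℝ) ^ 5 * δ := by
  let φ : (Fin 4 → Fin 4 → ℕ) → (ℕ × ℕ) × (ℕ × ℕ) := fun e =>
    ((e (ρ 0) (ρ 1), e (ρ 1) (ρ 0)), (e (ρ 2) (ρ 3), e (ρ 3) (ρ 2)))
  -- All four entries are below `L`, as the pair `{ρ 2, ρ 3}` carries as many edges as `{ρ 0, ρ 1}`.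
  -- There are thus at most `L ^ 4` fibers; the weight is constant on each and contributes the fifth
  -- factor.
  let T : Finset ((ℕ × ℕ) × (ℕ × ℕ)) :=
    (Finset.range L ×ˢ Finset.range L) ×ˢ (Finset.range L ×ˢ Finset.range L)
  rw [← Finset.sum_fiberwise_of_maps_to (t := T) (g := φ)]
  · refine (norm_sum_le _ _).trans ?_
    have hcard : (T.card : ℝ) = (L : ℝ) ^ 4 := by simp [T]; ring
    calc _ ≤ ∑ t ∈ T, (L : ℝ) * δ := ?_
      _ = (L : ℝ) ^ 5 * δ := by rw [Finset.sum_const, nsmul_eq_mul, hcard]; ring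
    refine Finset.sum_le_sum fun t _ => ?_
    obtain ⟨⟨i, j⟩, ⟨k, l⟩⟩ := t
    by_cases hc : 0 < i + j ∧ i + j < L ∧ i + j = k + l
    · have : ((tables M N).filter (fun e => 0 < e (ρ 0) (ρ 1) + e (ρ 1) (ρ 0) ∧
          e (ρ 0) (ρ 1) + e (ρ 1) (ρ 0) < L)).filter (fun e => φ e = ((i, j), (k, l))) =
          (tables M N).filter (fun e => e (ρ 0) (ρ 1) = i ∧ e (ρ 1) (ρ 0) = j ∧
            e (ρ 2) (ρ 3) = k ∧ e (ρ 3) (ρ 2) = l) := by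
        ext e
        simp only [Finset.mem_filter, φ, Prod.mk.injEq]
        constructor
        · rintro ⟨⟨h1, -⟩, ⟨h2, h3⟩, h4, h5⟩; exact ⟨h1, h2, h3, h4, h5⟩
        · rintro ⟨h1, h2, h3, h4, h5⟩; exact ⟨⟨h1, by omega⟩, ⟨h2, h3⟩, h4, h5⟩
      rw [this]
      have h2 : ∀ e ∈ (tables M N).filter (fun e => e (ρ 0) (ρ 1) = i ∧ e (ρ 1) (ρ 0) = j ∧
            e (ρ 2) (ρ 3) = k ∧ e (ρ 3) (ρ 2) = l),
          (w (e (ρ 0) (ρ 1) + e (ρ 1) (ρ 0)) : ℂ) * S e = (w (i + j) : ℂ) * S e := by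
        intro e he
        obtain ⟨-, rfl, rfl, -⟩ := Finset.mem_filter.1 he
        rfl
      rw [Finset.sum_congr rfl h2, ← Finset.mul_sum, norm_mul, Complex.norm_natCast]
      have := h i j k l hc.1 hc.2.1 hc.2.2
      have hw' : (w (i + j) : ℝ) ≤ L := by exact_mod_cast hw _ hc.2.1.le
      gcongr
    · rw [Finset.filter_false_of_mem, Finset.sum_empty, norm_zero]
      · positivity
      · intro e he hφ
        obtain ⟨he, h1, h2⟩ := Finset.mem_filter.1 he
        simp only [φ, Prod.mk.injEq] at hφ
        have := hx e he
        omega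
  · intro e he
    obtain ⟨he, h1, h2⟩ := Finset.mem_filter.1 he
    have := hx e he
    simp only [T, φ, Finset.mem_product, Finset.mem_range]
    omega

/-- Individual terms have no sign in general, but those with `x = 0` do. The weights `x, y, z` add
up to the constant `L`, so the three weighted bounds control the whole sum over `E'`; the unweighted
bound then removes the part with `x > 0` and leaves a sum of nonnegative terms. -/
theorem re_le_of_weighted_sums {T : Type*} (E : Finset T) (S : T → ℂ) (x y z : T → ℕ) {L : ℕ}
    (hL : 0 < L) {B : ℝ} (hsum : ∀ e ∈ E, x e + y e + z e = L)
    (hx1 : ‖∑ e ∈ E.filter (fun e => 0 < x e ∧ x e < L), S e‖ ≤ B)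
    (hx : ‖∑ e ∈ E.filter (fun e => 0 < x e ∧ x e < L), (x e : ℂ) * S e‖ ≤ B)
    (hy : ‖∑ e ∈ E.filter (fun e => 0 < y e ∧ y e < L), (y e : ℂ) * S e‖ ≤ B)
    (hz : ‖∑ e ∈ E.filter (fun e => 0 < z e ∧ z e < L), (z e : ℂ) * S e‖ ≤ B)
    (hpos : ∀ e ∈ E, x e = 0 → y e < L → z e < L → 0 ≤ (S e).re) {e : T} (he : e ∈ E)
    (hxe : x e = 0) (hye : y e < L) (hze : z e < L) : (S e).re ≤ 4 * B := by
  classical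
  set E' := E.filter (fun e => x e < L ∧ y e < L ∧ z e < L) with hE'
  -- A positive value of one variable forces the others below `L`, and terms of weight zero do not
  -- matter, so all three weighted sums may be taken over the same set `E'`.
  have hsub : ∀ u : T → ℕ, (u = x ∨ u = y ∨ u = z) →
      ∑ e ∈ E.filter (fun e => 0 < u e ∧ u e < L), (u e : ℂ) * S e = ∑ e ∈ E', (u e : ℂ) * S e := by
    intro u hu
    refine Finset.sum_subset ?_ ?_
    · intro e he
      simp only [hE', Finset.mem_filter] at he ⊢
      have := hsum e he.1
      refine ⟨he.1, ?_⟩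
      rcases hu with rfl | rfl | rfl <;> omega
    · intro e he hne
      simp only [hE', Finset.mem_filter] at he hne
      have : u e = 0 := by
        by_contra h0
        refine hne ⟨he.1, Nat.pos_of_ne_zero h0, ?_⟩
        rcases hu with rfl | rfl | rfl
        · exact he.2.1
        · exact he.2.2.1
        · exact he.2.2.2
      simp [this]
  rw [hsub x (by simp)] at hx
  rw [hsub y (by simp)] at hy
  rw [hsub z (by simp)] at hz
  have htot : (L : ℂ) * ∑ e ∈ E', S e = ∑ e ∈ E', (x e : ℂ) * S e + ∑ e ∈ E', (y e : ℂ) * S e +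
      ∑ e ∈ E', (z e : ℂ) * S e := by
    rw [Finset.mul_sum, ← Finset.sum_add_distrib, ← Finset.sum_add_distrib]
    refine Finset.sum_congr rfl fun e he => ?_
    rw [← hsum e (Finset.mem_filter.1 he).1]
    push_cast
    ring
  have hE : ‖∑ e ∈ E', S e‖ ≤ 3 * B := by
    have h1 : ‖(L : ℂ) * ∑ e ∈ E', S e‖ ≤ 3 * B := by
      rw [htot]
      exact (norm_add₃_le).trans (by linarith)
    rw [norm_mul, Complex.norm_natCast] at h1
    refine le_trans (le_mul_of_one_le_left (norm_nonneg _) ?_) h1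
    exact_mod_cast hL
  have hsplit : ∑ e ∈ E'.filter (fun e => x e = 0), S e =
      ∑ e ∈ E', S e - ∑ e ∈ E.filter (fun e => 0 < x e ∧ x e < L), S e := by
    rw [eq_sub_iff_add_eq, ← Finset.sum_filter_add_sum_filter_not E' (fun e => x e = 0)]
    congr 1
    refine Finset.sum_congr ?_ fun _ _ => rfl
    ext e
    simp only [hE', Finset.mem_filter]
    constructor
    · rintro ⟨h1, h2, h3⟩
      have := hsum e h1
      exact ⟨⟨h1, by omega⟩, by omega⟩
    · rintro ⟨⟨h1, h2⟩, h3⟩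
      exact ⟨h1, by omega⟩
  have hfin : (∑ e ∈ E'.filter (fun e => x e = 0), S e).re ≤ 4 * B := by
    refine (Complex.re_le_norm _).trans ?_
    rw [hsplit]
    exact (norm_sub_le _ _).trans (by linarith)
  refine le_trans ?_ hfin
  rw [Complex.re_sum]
  refine Finset.single_le_sum (f := fun e => (S e).re) (fun e he => ?_) ?_
  · simp only [hE', Finset.mem_filter] at he
    exact hpos e he.1.1 he.2 he.1.2.2.1 he.1.2.2.2
  · simp only [hE', Finset.mem_filter]
    exact ⟨⟨he, by omega⟩, hxe⟩

end Tables

end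

/-! ### The quantitative estimate over a finite index set -/

section

/-- The four kernels of the fourth absolute moment. -/
def quadKernel {ι : Type*} {m n : ℕ} (f : TensorKernel ι (Fin m) (Fin n))
    (h : TensorKernel ι (Fin n) (Fin m)) :
    ∀ a : Fin 4, TensorKernel ι (Fin (![m, m, n, n] a)) (Fin (![n, n, m, m] a))
  | 0 => f
  | 1 => f
  | 2 => h
  | 3 => h

/-- The permutation `0, 2, 3, 1` of the four vertices. -/
def perm0231 : Equiv.Perm (Fin 4) where
  toFun := ![0, 2, 3, 1]
  invFun := ![0, 3, 1, 2]
  left_inv := by decide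
  right_inv := by decide

/-- The permutation `0, 3, 2, 1` of the four vertices. -/
def perm0321 : Equiv.Perm (Fin 4) where
  toFun := ![0, 3, 2, 1]
  invFun := ![0, 3, 2, 1]
  left_inv := by decide
  right_inv := by decide

/-- The permutation `0, 1, 3, 2` of the four vertices. -/
def perm0132 : Equiv.Perm (Fin 4) where
  toFun := ![0, 1, 3, 2]
  invFun := ![0, 1, 3, 2]
  left_inv := by decide
  right_inv := by decide

/-- Conjugating the polarization of `f` and exchanging its factors expands `h` over the same index
type, as the four-vertex calculus requires. -/
theorem IsAdj.exists_eq_sum_pow {ι : Type*} [Fintype ι] {m n : ℕ}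
    {f : TensorKernel ι (Fin m) (Fin n)} {h : TensorKernel ι (Fin n) (Fin m)} (hf : f.IsSymm)
    (hfh : IsAdj f h) :
    ∃ (c : Fin 4 → ((Fin m → ι) × (Fin m → ℤˣ)) × ((Fin n → ι) × (Fin n → ℤˣ)) → ℂ)
      (U V : Fin 4 → ((Fin m → ι) × (Fin m → ℤˣ)) × ((Fin n → ι) × (Fin n → ℤˣ)) → ι → ℂ),
      ∀ a z, quadKernel f h a z =
        ∑ k, c a k * elemTensor (fun _ => U a k) (fun _ => V a k) z := by
  obtain ⟨c, u, v, hc⟩ := ComplexWiener.exists_eq_sum_pow f hf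
  have hh : ∀ z, h z = ∑ k, conj (c k) * elemTensor (fun _ x => conj (v k x))
      (fun _ x => conj (u k x)) z := by
    rintro ⟨q, p⟩
    rw [hfh p q, hc, map_sum]
    refine Finset.sum_congr rfl fun k _ => ?_
    simp only [elemTensor, map_mul, map_prod]
    ring
  refine ⟨![c, c, fun k => conj (c k), fun k => conj (c k)],
    ![u, u, fun k x => conj (v k x), fun k x => conj (v k x)],
    ![v, v, fun k x => conj (u k x), fun k x => conj (u k x)], fun a => ?_⟩
  match a with
  | 0 => exact hc
  | 1 => exact hc
  | 2 => exact hh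
  | 3 => exact hh

theorem norm_pairing_le_of_le {ι : Type*} [Fintype ι] {a b c d a' b' c' d' L : ℕ}
    (X : TensorKernel ι (Fin a ⊕ Fin b) (Fin c ⊕ Fin d))
    (Y : TensorKernel ι (Fin a' ⊕ Fin b') (Fin c' ⊕ Fin d')) (h : a + b ≤ L) (h' : a' + b' ≤ L)
    {ε : ℝ} (hX : ‖symmetrize X‖ ≤ ε) (hY : ‖symmetrize Y‖ ≤ ε) :
    ‖pairing X Y‖ ≤ (L.factorial : ℝ) ^ 2 * ε ^ 2 := by
  refine (norm_pairing_le X Y).trans ?_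
  have hε := (norm_nonneg _).trans hX
  rw [sq, sq]
  have h1 : ((Fintype.card (Fin a ⊕ Fin b)).factorial : ℝ) ≤ L.factorial := by
    exact_mod_cast Nat.factorial_le (by simpa using h)
  have h2 : ((Fintype.card (Fin a' ⊕ Fin b')).factorial : ℝ) ≤ L.factorial := by
    exact_mod_cast Nat.factorial_le (by simpa using h')
  gcongr

/-- Every vertex has degree `m + n`, row sum plus column sum. In a loopless four-vertex graph with
equal degrees, complementary pairs of vertices carry equally many edges. -/
theorem tables_degrees {m n : ℕ} {e : Fin 4 → Fin 4 → ℕ}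
    (he : e ∈ tables ![m, m, n, n] ![n, n, m, m]) :
    (e 0 1 + e 1 0) + (e 0 2 + e 2 0) + (e 0 3 + e 3 0) = m + n ∧
      e 0 1 + e 1 0 = e 2 3 + e 3 2 ∧ e 0 2 + e 2 0 = e 3 1 + e 1 3 ∧
      e 0 3 + e 3 0 = e 2 1 + e 1 2 := by
  obtain ⟨hr, hc, hd⟩ := mem_tables.1 he
  simp only [Fin.sum_univ_four, forall_fin_four] at hr hc hd
  simp at hr hc
  omega

section

variable {ι κ : Type*} [Fintype ι] [Fintype κ] {m n : ℕ} {c : Fin 4 → κ → ℂ}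
  {U V : Fin 4 → κ → ι → ℂ} {f : TensorKernel ι (Fin m) (Fin n)} {h : TensorKernel ι (Fin n) (Fin m)}

/-- No edges join `0` to `1`, hence none join `2` to `3`. Cutting the remaining four-cycle into the
pairs `{0,2}` and `{3,1}` leaves `f ⊗ h` fully paired with its adjoint `h ⊗ f`. -/
theorem norm_contract_adj_sq_eq_tableValue (hfh : IsAdj f h)
    (hc : ∀ a z, quadKernel f h a z =
      ∑ k, c a k * elemTensor (fun _ => U a k) (fun _ => V a k) z)
    {e : Fin 4 → Fin 4 → ℕ} (he : e ∈ tables ![m, m, n, n] ![n, n, m, m]) (h0 : e 0 1 + e 1 0 = 0)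
    (i j : ℕ) (him : i ≤ m) (hjn : j ≤ n) (hi : e 0 2 = i) (hj : e 2 0 = j) :
    ∃ C : ℕ, 0 < C ∧ C ≤ ∏ a, ((![m, m, n, n] : Fin 4 → ℕ) a).factorial ^ 4 ∧
      ((‖contract i j him hjn hjn him f h‖ ^ 2 : ℝ) : ℂ) = C * tableValue c U V e := by
  obtain ⟨hr, hcol, hd⟩ := mem_tables.1 he
  simp only [Fin.sum_univ_four, forall_fin_four] at hr hcol hd
  simp at hr hcol
  have := tables_degrees he
  obtain ⟨C, hC, hCQ, hp⟩ := pairAt_contract_eq_tableValue (f := quadKernel f h) hc perm0231 he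
    (show e 0 1 = 0 by omega) (show e 1 0 = 0 by omega) (show e 2 3 = 0 by omega)
    (show e 3 2 = 0 by omega) i j j i hi hj (show e 3 1 = j by omega) (show e 1 3 = i by omega)
    him hjn hjn him hjn him him hjn (Equiv.refl (Fin (m - i) ⊕ Fin (n - j)))
    (Equiv.refl (Fin (n - j) ⊕ Fin (m - i))) (fun _ => rfl) (fun _ => rfl)
  refine ⟨C, hC, hCQ, ?_⟩
  rw [← hp]
  exact (pairAt_refl_of_isAdj (X := contract i j him hjn hjn him f h)
    (Y := contract j i hjn him him hjn h f) (hfh.contract hfh.symm)).symm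

/-- The same argument without edges between `0` and `2`, or between `1` and `3`: the pairs `{0,1}`
and `{3,2}` leave `f ⊗ f` paired with its adjoint `h ⊗ h`. -/
theorem norm_contract_self_sq_eq_tableValue (hfh : IsAdj f h)
    (hc : ∀ a z, quadKernel f h a z =
      ∑ k, c a k * elemTensor (fun _ => U a k) (fun _ => V a k) z)
    {e : Fin 4 → Fin 4 → ℕ} (he : e ∈ tables ![m, m, n, n] ![n, n, m, m]) (h0 : e 0 2 + e 2 0 = 0)
    (i j : ℕ) (him : i ≤ m) (hin : i ≤ n) (hjm : j ≤ m) (hjn : j ≤ n) (hi : e 0 1 = i)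
    (hj : e 1 0 = j) :
    ∃ C : ℕ, 0 < C ∧ C ≤ ∏ a, ((![m, m, n, n] : Fin 4 → ℕ) a).factorial ^ 4 ∧
      ((‖contract i j him hjn hjm hin f f‖ ^ 2 : ℝ) : ℂ) = C * tableValue c U V e := by
  obtain ⟨hr, hcol, hd⟩ := mem_tables.1 he
  simp only [Fin.sum_univ_four, forall_fin_four] at hr hcol hd
  simp at hr hcol
  have := tables_degrees he
  obtain ⟨C, hC, hCQ, hp⟩ := pairAt_contract_eq_tableValue (f := quadKernel f h) hc perm0132 he
    (show e 0 2 = 0 by omega) (show e 2 0 = 0 by omega) (show e 1 3 = 0 by omega)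
    (show e 3 1 = 0 by omega) i j j i hi hj (show e 3 2 = j by omega) (show e 2 3 = i by omega)
    him hjm hjn hin hjn hin him hjm (Equiv.refl (Fin (m - i) ⊕ Fin (m - j)))
    (Equiv.refl (Fin (n - j) ⊕ Fin (n - i))) (fun _ => rfl) (fun _ => rfl)
  refine ⟨C, hC, hCQ, ?_⟩
  rw [← hp]
  exact (pairAt_refl_of_isAdj (X := contract i j him hjn hjm hin f f)
    (Y := contract j i hjn him hin hjm h h) (hfh.contract hfh)).symm

/-- One bound for each splitting of the four vertices into two pairs. The splitting `{0,1}`, `{2,3}`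
uses the contractions of `f` with itself, the other two those of `f` with `h`; the second factor is
estimated by passing to its adjoint. -/
theorem norm_sum_weight_quad_le (hfh : IsAdj f h)
    (hc : ∀ a z, quadKernel f h a z =
      ∑ k, c a k * elemTensor (fun _ => U a k) (fun _ => V a k) z) {ε : ℝ}
    (hX : ∀ (i j : ℕ) (_ : 0 < i + j) (_ : i + j ≤ m + n - 1)
      (him : i ≤ m) (hin : i ≤ n) (hjm : j ≤ m) (hjn : j ≤ n),
      ‖symmetrize (contract i j him hjn hjm hin f f)‖ ≤ ε)
    (hY : ∀ (i j : ℕ) (_ : 0 < i + j) (_ : i + j ≤ m + n - 1) (him : i ≤ m) (hjn : j ≤ n),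
      ‖symmetrize (contract i j him hjn hjn him f h)‖ ≤ ε)
    (w : ℕ → ℕ) (hw : ∀ x ≤ m + n, w x ≤ m + n) :
    ‖∑ e ∈ (tables ![m, m, n, n] ![n, n, m, m]).filter (fun e => 0 < e 0 1 + e 1 0 ∧
      e 0 1 + e 1 0 < m + n), (w (e 0 1 + e 1 0) : ℂ) * tableValue c U V e‖ ≤
      ((m + n : ℕ) : ℝ) ^ 5 * (((2 * (m + n)).factorial : ℝ) ^ 2 * ε ^ 2) ∧
    ‖∑ e ∈ (tables ![m, m, n, n] ![n, n, m, m]).filter (fun e => 0 < e 0 2 + e 2 0 ∧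
      e 0 2 + e 2 0 < m + n), (w (e 0 2 + e 2 0) : ℂ) * tableValue c U V e‖ ≤
      ((m + n : ℕ) : ℝ) ^ 5 * (((2 * (m + n)).factorial : ℝ) ^ 2 * ε ^ 2) ∧
    ‖∑ e ∈ (tables ![m, m, n, n] ![n, n, m, m]).filter (fun e => 0 < e 0 3 + e 3 0 ∧
      e 0 3 + e 3 0 < m + n), (w (e 0 3 + e 3 0) : ℂ) * tableValue c U V e‖ ≤
      ((m + n : ℕ) : ℝ) ^ 5 * (((2 * (m + n)).factorial : ℝ) ^ 2 * ε ^ 2) := by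
  have hXh : ∀ (i j : ℕ) (_ : 0 < i + j) (_ : i + j ≤ m + n - 1)
      (him : i ≤ m) (hin : i ≤ n) (hjm : j ≤ m) (hjn : j ≤ n),
      ‖symmetrize (contract j i hjn him hin hjm h h)‖ ≤ ε := by
    intro i j h1 h2 him hin hjm hjn
    rw [(hfh.contract hfh (hia := him) (hjb := hjn) (hjc := hjm) (hid := hin)).symmetrize.norm_eq]
    exact hX i j h1 h2 him hin hjm hjn
  have hYh : ∀ (i j : ℕ) (_ : 0 < i + j) (_ : i + j ≤ m + n - 1) (him : i ≤ m) (hjn : j ≤ n),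
      ‖symmetrize (contract j i hjn him him hjn h f)‖ ≤ ε := by
    intro i j h1 h2 him hjn
    rw [(hfh.contract hfh.symm (hia := him) (hjb := hjn) (hjc := hjn)
      (hid := him)).symmetrize.norm_eq]
    exact hY i j h1 h2 him hjn
  let ρ₀ : Equiv.Perm (Fin 4) := 1
  have f1 : ∀ i j k l, 0 < i + j → i + j < m + n → i + j = k + l →
      ‖∑ e ∈ (tables ![m, m, n, n] ![n, n, m, m]).filter (fun e => e (ρ₀ 0) (ρ₀ 1) = i ∧
        e (ρ₀ 1) (ρ₀ 0) = j ∧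
        e (ρ₀ 2) (ρ₀ 3) = k ∧
        e (ρ₀ 3) (ρ₀ 2) = l), tableValue c U V e‖ ≤ ((2 * (m + n)).factorial : ℝ) ^ 2 * ε ^ 2 := by
    intro i j k l h1 h2 h3
    refine norm_sum_fiber_le (f := quadKernel f h) hc ρ₀ i j k l (by positivity) ?_
    intro (h0 : i ≤ m) (h1 : j ≤ m) (h2 : k ≤ n) (h3 : l ≤ n) (g0 : j ≤ n) (g1 : i ≤ n)
      (g2 : l ≤ m) (g3 : k ≤ m)
    exact norm_pairing_le_of_le (contract i j h0 g0 h1 g1 f f) (contract k l h2 g2 h3 g3 h h)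
      (by omega) (by omega) (hX i j (by omega) (by omega) _ _ _ _)
      (hXh l k (by omega) (by omega) _ _ _ _)
  have f2 : ∀ i j k l, 0 < i + j → i + j < m + n → i + j = k + l →
      ‖∑ e ∈ (tables ![m, m, n, n] ![n, n, m, m]).filter (fun e => e (perm0231 0) (perm0231 1) = i ∧
        e (perm0231 1) (perm0231 0) = j ∧ e (perm0231 2) (perm0231 3) = k ∧
        e (perm0231 3) (perm0231 2) = l), tableValue c U V e‖ ≤ ((2 * (m + n)).factorial : ℝ) ^ 2 * ε ^ 2 := by
    intro i j k l h1 h2 h3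
    refine norm_sum_fiber_le (f := quadKernel f h) hc perm0231 i j k l (by positivity) ?_
    intro (h0 : i ≤ m) (h1 : j ≤ n) (h2 : k ≤ n) (h3 : l ≤ m) (g0 : j ≤ n) (g1 : i ≤ m)
      (g2 : l ≤ m) (g3 : k ≤ n)
    exact norm_pairing_le_of_le (contract i j h0 g0 h1 g1 f h) (contract k l h2 g2 h3 g3 h f)
      (by omega) (by omega) (hY i j (by omega) (by omega) _ _)
      (hYh l k (by omega) (by omega) _ _)
  have f3 : ∀ i j k l, 0 < i + j → i + j < m + n → i + j = k + l →
      ‖∑ e ∈ (tables ![m, m, n, n] ![n, n, m, m]).filter (fun e => e (perm0321 0) (perm0321 1) = i ∧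
        e (perm0321 1) (perm0321 0) = j ∧ e (perm0321 2) (perm0321 3) = k ∧
        e (perm0321 3) (perm0321 2) = l), tableValue c U V e‖ ≤ ((2 * (m + n)).factorial : ℝ) ^ 2 * ε ^ 2 := by
    intro i j k l h1 h2 h3
    refine norm_sum_fiber_le (f := quadKernel f h) hc perm0321 i j k l (by positivity) ?_
    intro (h0 : i ≤ m) (h1 : j ≤ n) (h2 : k ≤ n) (h3 : l ≤ m) (g0 : j ≤ n) (g1 : i ≤ m)
      (g2 : l ≤ m) (g3 : k ≤ n)
    exact norm_pairing_le_of_le (contract i j h0 g0 h1 g1 f h) (contract k l h2 g2 h3 g3 h f)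
      (by omega) (by omega) (hY i j (by omega) (by omega) _ _)
      (hYh l k (by omega) (by omega) _ _)
  exact ⟨norm_sum_weight_le _ ρ₀ _ (by positivity) (fun e he => (tables_degrees he).2.1) f1 w hw,
    norm_sum_weight_le _ perm0231 _ (by positivity) (fun e he => (tables_degrees he).2.2.1) f2 w hw,
    norm_sum_weight_le _ perm0321 _ (by positivity) (fun e he => (tables_degrees he).2.2.2) f3 w hw⟩

end

/-- It is essential that `K` does not depend on the finite index type, which later exhausts an
arbitrary one. -/
theorem exists_norm_contract_le (m n : ℕ) (hmn : 2 ≤ m + n) : ∃ K : ℝ, 0 ≤ K ∧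
    ∀ (ι : Type*) [Fintype ι] (f : TensorKernel ι (Fin m) (Fin n))
      (h : TensorKernel ι (Fin n) (Fin m)) (_ : f.IsSymm) (_ : IsAdj f h) (ε : ℝ) (_ : 0 ≤ ε)
      (_ : ∀ (i j : ℕ) (_ : 0 < i + j) (_ : i + j ≤ m + n - 1)
        (him : i ≤ m) (hin : i ≤ n) (hjm : j ≤ m) (hjn : j ≤ n),
        ‖symmetrize (contract i j him hjn hjm hin f f)‖ ≤ ε)
      (_ : ∀ (i j : ℕ) (_ : 0 < i + j) (_ : i + j ≤ m + n - 1) (him : i ≤ m) (hjn : j ≤ n),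
        ‖symmetrize (contract i j him hjn hjn him f h)‖ ≤ ε),
      (∀ (i j : ℕ) (_ : 0 < i + j) (_ : i + j ≤ m + n - 1)
        (him : i ≤ m) (hin : i ≤ n) (hjm : j ≤ m) (hjn : j ≤ n),
        ‖contract i j him hjn hjm hin f f‖ ^ 2 ≤ K * ε ^ 2) ∧
      (∀ (i j : ℕ) (_ : 0 < i + j) (_ : i + j ≤ m + n - 1) (him : i ≤ m) (hjn : j ≤ n),
        ‖contract i j him hjn hjn him f h‖ ^ 2 ≤ K * ε ^ 2) := by
  refine ⟨(∏ a, ((![m, m, n, n] : Fin 4 → ℕ) a).factorial ^ 4 : ℕ) *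
    (4 * (((m + n : ℕ) : ℝ) ^ 5 * ((2 * (m + n)).factorial : ℝ) ^ 2)), by positivity, ?_⟩
  intro ι _ f h hf hfh ε hε hX hY
  obtain ⟨c, U, V, hc⟩ := hfh.exists_eq_sum_pow hf
  have w1 : ∀ x ≤ m + n, (fun _ : ℕ => 1) x ≤ m + n := fun _ _ => by simp only; omega
  -- Identity weights give the three weighted sums; the constant weight `1` below gives the
  -- unweighted ones.
  obtain ⟨b1, b2, b3⟩ := norm_sum_weight_quad_le hfh hc hX hY _ fun _ h => h
  obtain ⟨c1, c2, -⟩ := norm_sum_weight_quad_le hfh hc hX hY _ w1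
  simp only [Nat.cast_one, one_mul] at c1 c2
  generalize hB : ((m + n : ℕ) : ℝ) ^ 5 * (((2 * (m + n)).factorial : ℝ) ^ 2 * ε ^ 2) = B at *
  generalize hQ : ∏ a, ((![m, m, n, n] : Fin 4 → ℕ) a).factorial ^ 4 = Q at *
  have hre : ∀ {r : ℝ} {C : ℕ} {s : ℂ}, (r : ℂ) = C * s → r = C * s.re := by
    intro r C s hrs
    have := congrArg Complex.re hrs
    simpa using this
  have hnonneg : ∀ {r : ℝ} {C : ℕ} {s : ℂ}, 0 ≤ r → 0 < C → (r : ℂ) = C * s → 0 ≤ s.re := by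
    intro r C s hr hC hrs
    rw [hre hrs] at hr
    exact nonneg_of_mul_nonneg_right hr (by exact_mod_cast hC)
  have hfinal : ∀ {r : ℝ} {C : ℕ} {s : ℂ}, 0 ≤ r → 0 < C → C ≤ Q → (r : ℂ) = C * s →
      s.re ≤ 4 * B → r ≤ Q * (4 * (((m + n : ℕ) : ℝ) ^ 5 * ((2 * (m + n)).factorial : ℝ) ^ 2)) * ε ^ 2 := by
    intro r C s hr hC hCQ hrs hs
    have h0 := hnonneg hr hC hrs
    have hCQ' : (C : ℝ) ≤ Q := by exact_mod_cast hCQ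
    calc r = C * s.re := hre hrs
      _ ≤ Q * (4 * B) := by gcongr
      _ = _ := by rw [← hB]; ring
  constructor
  · intro i j h1 h2 him hin hjm hjn
    -- The four-cycle table whose value is a multiple of the norm to be bounded; `x` now counts the
    -- edges between `0` and `2`. The condition `0 < i + j < m + n` keeps it among the tables with
    -- `y, z < m + n`.
    let e : Fin 4 → Fin 4 → ℕ :=
      ![![0, i, 0, m - i], ![j, 0, m - j, 0], ![0, n - i, 0, i], ![n - j, 0, j, 0]]
    have he : e ∈ tables ![m, m, n, n] ![n, n, m, m] := by
      simp only [mem_tables, forall_fin_four, Fin.sum_univ_four]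
      simp [e]
      omega
    obtain ⟨C, hC, hCQ, hp⟩ := norm_contract_self_sq_eq_tableValue hfh hc he rfl i j him hin hjm hjn rfl rfl
    rw [hQ] at hCQ
    refine hfinal (by positivity) hC hCQ hp ?_
    refine re_le_of_weighted_sums (tables ![m, m, n, n] ![n, n, m, m]) (tableValue c U V) (fun e => e 0 2 + e 2 0)
      (fun e => e 0 1 + e 1 0) (fun e => e 0 3 + e 3 0) (L := m + n) (by omega)
      (fun e he => by have := tables_degrees he; omega) c2 b2 b1 b3 ?_ he rfl
      (show i + j < m + n by omega) (show m - i + (n - j) < m + n by omega)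
    · intro e he hx hy hz
      obtain ⟨hr, hcol, hd⟩ := mem_tables.1 he
      simp only [Fin.sum_univ_four, forall_fin_four] at hr hcol hd
      simp at hr hcol
      obtain ⟨C, hC, -, hp⟩ := norm_contract_self_sq_eq_tableValue hfh hc he hx (e 0 1) (e 1 0) (by omega) (by omega) (by omega)
        (by omega) rfl rfl
      exact hnonneg (by positivity) hC hp
  · intro i j h1 h2 him hjn
    -- The four-cycle table without edges between the two copies of `f`.
    let e : Fin 4 → Fin 4 → ℕ :=
      ![![0, 0, i, m - i], ![0, 0, m - i, i], ![j, n - j, 0, 0], ![n - j, j, 0, 0]]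
    have he : e ∈ tables ![m, m, n, n] ![n, n, m, m] := by
      simp only [mem_tables, forall_fin_four, Fin.sum_univ_four]
      simp [e]
      omega
    obtain ⟨C, hC, hCQ, hp⟩ := norm_contract_adj_sq_eq_tableValue hfh hc he rfl i j him hjn rfl rfl
    rw [hQ] at hCQ
    refine hfinal (by positivity) hC hCQ hp ?_
    refine re_le_of_weighted_sums (tables ![m, m, n, n] ![n, n, m, m]) (tableValue c U V) (fun e => e 0 1 + e 1 0)
      (fun e => e 0 2 + e 2 0) (fun e => e 0 3 + e 3 0) (L := m + n) (by omega)
      (fun e he => (tables_degrees he).1) c1 b1 b2 b3 ?_ he rfl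
      (show i + j < m + n by omega) (show m - i + (n - j) < m + n by omega)
    · intro e he hx hy hz
      obtain ⟨hr, hcol, hd⟩ := mem_tables.1 he
      simp only [Fin.sum_univ_four, forall_fin_four] at hr hcol hd
      simp at hr hcol
      obtain ⟨C, hC, -, hp⟩ := norm_contract_adj_sq_eq_tableValue hfh hc he hx (e 0 2) (e 2 0) (by omega) (by omega) rfl rfl
      exact hnonneg (by positivity) hC hp

end

section

/-! ### Restriction of kernels to finitely many indices -/

theorem summable_mul_of_memlp {X : Type*} {F G : X → ℂ} (hF : Memℓp F 2) (hG : Memℓp G 2) :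
    Summable fun x => F x * G x := by
  rw [memlp_two_iff] at hF hG
  refine Summable.of_norm_bounded (hF.add hG) fun x => ?_
  rw [norm_mul]
  nlinarith [sq_nonneg (‖F x‖ - ‖G x‖), sq_nonneg (‖F x‖), sq_nonneg (‖G x‖)]

theorem norm_tsum_mul_sq_le {X : Type*} {F G : X → ℂ} (hF : Memℓp F 2) (hG : Memℓp G 2) :
    ‖∑' x, F x * G x‖ ^ 2 ≤ (∑' x, ‖F x‖ ^ 2) * ∑' x, ‖G x‖ ^ 2 := by
  have hG' : Memℓp (fun x => conj (G x)) 2 := by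
    rw [memlp_two_iff] at hG ⊢
    simpa using hG
  let f : lp (fun _ : X => ℂ) 2 := ⟨F, hF⟩
  let g : lp (fun _ : X => ℂ) 2 := ⟨fun x => conj (G x), hG'⟩
  have h1 : inner ℂ g f = ∑' x, F x * G x := by
    rw [lp.inner_eq_tsum]
    refine tsum_congr fun x => ?_
    simp [f, g]
  have h2 : ‖f‖ ^ 2 = ∑' x, ‖F x‖ ^ 2 := norm_sq_eq_tsum f
  have h3 : ‖g‖ ^ 2 = ∑' x, ‖G x‖ ^ 2 := by
    rw [norm_sq_eq_tsum]; simp [g]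
  rw [← h1, ← h2, ← h3, ← mul_pow, mul_comm]
  gcongr
  exact norm_inner_le_norm g f

/-- The Hilbert–Schmidt norm of a composition. -/
theorem tsum_norm_tsum_mul_sq_le {X Y W : Type*} {F : X × W → ℂ} {G : Y × W → ℂ}
    (hF : Memℓp F 2) (hG : Memℓp G 2) :
    ∑' z : X × Y, ‖∑' w, F (z.1, w) * G (z.2, w)‖ ^ 2 ≤
      (∑' x, ‖F x‖ ^ 2) * ∑' y, ‖G y‖ ^ 2 := by
  have hsum : Summable fun z : X × Y => ‖∑' w, F (z.1, w) * G (z.2, w)‖ ^ 2 :=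
    memlp_two_iff.1 (memlp_tsum_mul hF hG)
  have hFs := memlp_two_iff.1 hF
  have hGs := memlp_two_iff.1 hG
  have hFx : ∀ x, Memℓp (fun w => F (x, w)) 2 := fun x =>
    memlp_comp hF (Prod.mk_right_injective x)
  have hGy : ∀ y, Memℓp (fun w => G (y, w)) 2 := fun y =>
    memlp_comp hG (Prod.mk_right_injective y)
  have hle : ∀ z : X × Y, ‖∑' w, F (z.1, w) * G (z.2, w)‖ ^ 2 ≤
      (∑' w, ‖F (z.1, w)‖ ^ 2) * ∑' w, ‖G (z.2, w)‖ ^ 2 := fun z =>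
    norm_tsum_mul_sq_le (hFx z.1) (hGy z.2)
  have key : Summable fun z : X × Y => (∑' w, ‖F (z.1, w)‖ ^ 2) * ∑' w, ‖G (z.2, w)‖ ^ 2 :=
    hFs.prod.mul_of_nonneg hGs.prod (fun x => tsum_nonneg fun w => by positivity)
      (fun x => tsum_nonneg fun w => by positivity)
  refine (hsum.tsum_le_tsum hle key).trans_eq ?_
  rw [hFs.tsum_prod, hGs.tsum_prod, hFs.prod.tsum_mul_tsum hGs.prod key]

/-- A contraction composes two Hilbert–Schmidt kernels, once free and summed indices are separated
by `glue`. -/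
theorem norm_contract_le {ι : Type*} {a b c d : ℕ} (i j : ℕ) (hia : i ≤ a)
    (hjb : j ≤ b) (hjc : j ≤ c) (hid : i ≤ d) (f : TensorKernel ι (Fin a) (Fin b))
    (g : TensorKernel ι (Fin c) (Fin d)) :
    ‖contract i j hia hjb hjc hid f g‖ ≤ ‖f‖ * ‖g‖ := by
  let φ : ((Fin (a - i) → ι) × (Fin (b - j) → ι)) × ((Fin i → ι) × (Fin j → ι)) →
      (Fin a → ι) × (Fin b → ι) := fun x => (glue hia x.1.1 x.2.1, glue hjb x.1.2 x.2.2)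
  let ψ : ((Fin (c - j) → ι) × (Fin (d - i) → ι)) × ((Fin i → ι) × (Fin j → ι)) →
      (Fin c → ι) × (Fin d → ι) := fun x => (glue hjc x.1.1 x.2.2, glue hid x.1.2 x.2.1)
  have hφ : Function.Injective φ := by
    rintro ⟨⟨x1, x2⟩, ⟨x3, x4⟩⟩ ⟨⟨y1, y2⟩, ⟨y3, y4⟩⟩ h
    obtain ⟨h1, h2⟩ := Prod.mk.inj h
    obtain ⟨rfl, rfl⟩ := glue_injective hia h1
    obtain ⟨rfl, rfl⟩ := glue_injective hjb h2
    rfl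
  have hψ : Function.Injective ψ := by
    rintro ⟨⟨x1, x2⟩, ⟨x3, x4⟩⟩ ⟨⟨y1, y2⟩, ⟨y3, y4⟩⟩ h
    obtain ⟨h1, h2⟩ := Prod.mk.inj h
    obtain ⟨rfl, rfl⟩ := glue_injective hjc h1
    obtain ⟨rfl, rfl⟩ := glue_injective hid h2
    rfl
  have key := tsum_norm_tsum_mul_sq_le (memlp_comp (lp.memℓp f) hφ) (memlp_comp (lp.memℓp g) hψ)
  let χ : (Fin (a - i) ⊕ Fin (c - j) → ι) × (Fin (b - j) ⊕ Fin (d - i) → ι) ≃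
      ((Fin (a - i) → ι) × (Fin (b - j) → ι)) × ((Fin (c - j) → ι) × (Fin (d - i) → ι)) :=
    ((Equiv.sumArrowEquivProdArrow _ _ _).prodCongr (Equiv.sumArrowEquivProdArrow _ _ _)).trans
      (Equiv.prodProdProdComm _ _ _ _)
  rw [← sq_le_sq₀ (norm_nonneg _) (by positivity), mul_pow, norm_sq_eq_tsum]
  have h1 : ∑' z, ‖contract i j hia hjb hjc hid f g z‖ ^ 2 =
      ∑' z : ((Fin (a - i) → ι) × (Fin (b - j) → ι)) × ((Fin (c - j) → ι) × (Fin (d - i) → ι)),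
        ‖∑' w, f (φ (z.1, w)) * g (ψ (z.2, w))‖ ^ 2 := by
    rw [← χ.tsum_eq]
    rfl
  rw [h1]
  refine key.trans ?_
  rw [norm_sq_eq_tsum, norm_sq_eq_tsum]
  have hf := memlp_two_iff.1 (lp.memℓp f)
  have hg := memlp_two_iff.1 (lp.memℓp g)
  refine mul_le_mul (tsum_comp_le_tsum_of_inj hf (fun _ => by positivity) hφ)
    (tsum_comp_le_tsum_of_inj hg (fun _ => by positivity) hψ)
    (tsum_nonneg fun _ => by positivity) (tsum_nonneg fun _ => by positivity)

section Restrict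

variable {ι α β : Type*}

/-- The inclusion of multi-indices over a finite set of indices. -/
def incl (s : Finset ι) (z : (α → s) × (β → s)) : (α → ι) × (β → ι) :=
  (fun t => z.1 t, fun t => z.2 t)

theorem incl_injective (s : Finset ι) : Function.Injective (incl s (α := α) (β := β)) := by
  rintro ⟨x1, x2⟩ ⟨y1, y2⟩ h
  obtain ⟨h1, h2⟩ := Prod.mk.inj h
  exact Prod.ext (funext fun t => Subtype.ext (congrFun h1 t))
    (funext fun t => Subtype.ext (congrFun h2 t))

theorem mem_range_incl {s : Finset ι} {z : (α → ι) × (β → ι)} :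
    z ∈ Set.range (incl s) ↔ (∀ t, z.1 t ∈ s) ∧ ∀ t, z.2 t ∈ s := by
  constructor
  · rintro ⟨x, rfl⟩
    exact ⟨fun t => (x.1 t).2, fun t => (x.2 t).2⟩
  · rintro ⟨h1, h2⟩
    exact ⟨(fun t => ⟨z.1 t, h1 t⟩, fun t => ⟨z.2 t, h2 t⟩), rfl⟩

/-- The restriction of a kernel to a finite set of indices. -/
def TensorKernel.restrict (f : TensorKernel ι α β) (s : Finset ι) : TensorKernel s α β :=
  ⟨fun z => f (incl s z), memlp_comp (lp.memℓp f) (incl_injective s)⟩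

/-- The part of a kernel where some index lies outside of a finite set. -/
def TensorKernel.tail (f : TensorKernel ι α β) (s : Finset ι) : TensorKernel ι α β :=
  ⟨(Set.range (incl s))ᶜ.indicator f, by
    refine memlp_two_iff.2 ((memlp_two_iff.1 (lp.memℓp f)).of_nonneg_of_le
      (fun _ => by positivity) fun z => ?_)
    gcongr
    exact norm_indicator_le_norm_self _ _⟩

theorem TensorKernel.norm_restrict_sq_add (f : TensorKernel ι α β) (s : Finset ι) :
    ‖f.restrict s‖ ^ 2 + ‖f.tail s‖ ^ 2 = ‖f‖ ^ 2 := by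
  have hf := memlp_two_iff.1 (lp.memℓp f)
  rw [norm_sq_eq_tsum f, ← hf.tsum_subtype_add_tsum_subtype_compl (Set.range (incl s)),
    norm_sq_eq_tsum, norm_sq_eq_tsum, tsum_range (fun z => ‖f z‖ ^ 2) (incl_injective s),
    tsum_subtype (Set.range (incl s))ᶜ (fun z => ‖f z‖ ^ 2)]
  congr 1
  refine tsum_congr fun z => ?_
  change ‖(Set.range (incl s))ᶜ.indicator f z‖ ^ 2 = _
  by_cases h : z ∈ (Set.range (incl s))ᶜ <;> simp [h]

theorem TensorKernel.norm_restrict_le (f : TensorKernel ι α β) (s : Finset ι) :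
    ‖f.restrict s‖ ≤ ‖f‖ := by
  rw [← sq_le_sq₀ (norm_nonneg _) (norm_nonneg _), ← f.norm_restrict_sq_add s]
  have := sq_nonneg ‖f.tail s‖
  linarith

theorem TensorKernel.norm_le_restrict_add (f : TensorKernel ι α β) (s : Finset ι) :
    ‖f‖ ≤ ‖f.restrict s‖ + ‖f.tail s‖ := by
  rw [← sq_le_sq₀ (norm_nonneg _) (by positivity), ← f.norm_restrict_sq_add s]
  have := mul_nonneg (norm_nonneg (f.restrict s)) (norm_nonneg (f.tail s))
  nlinarith

/-- A multi-index involves finitely many indices, so each coordinate of the tail is eventually zero;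
dominated convergence applies with the summable bound `‖f z‖ ^ 2`. -/
theorem TensorKernel.tendsto_norm_tail [Finite α] [Finite β] (f : TensorKernel ι α β) :
    Tendsto (fun s => ‖f.tail s‖) atTop (𝓝 0) := by
  classical
  cases nonempty_fintype α
  cases nonempty_fintype β
  have hf := memlp_two_iff.1 (lp.memℓp f)
  have h1 : Tendsto (fun s => ∑' z, ‖f.tail s z‖ ^ 2) atTop (𝓝 (∑' _ : (α → ι) × (β → ι), 0)) := by
    refine tendsto_tsum_of_dominated_convergence hf (fun z => ?_) ?_
    · refine tendsto_const_nhds.congr' ?_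
      filter_upwards [eventually_ge_atTop (Finset.univ.image z.1 ∪ Finset.univ.image z.2)] with s hs
      change 0 = ‖(Set.range (incl s))ᶜ.indicator f z‖ ^ 2
      have : z ∈ Set.range (incl s) := mem_range_incl.2
        ⟨fun t => hs (by simp), fun t => hs (by simp)⟩
      rw [Set.indicator_of_notMem (by simpa using this)]
      simp
    · filter_upwards with s z
      rw [norm_pow, norm_norm]
      gcongr
      exact norm_indicator_le_norm_self _ _
  rw [tsum_zero] at h1
  have h2 := h1.sqrt
  rw [Real.sqrt_zero] at h2
  refine h2.congr fun s => ?_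
  rw [← norm_sq_eq_tsum, Real.sqrt_sq (norm_nonneg _)]

theorem restrict_symmetrize [Fintype α] [DecidableEq α] [Fintype β] [DecidableEq β]
    (f : TensorKernel ι α β) (s : Finset ι) :
    (symmetrize f).restrict s = symmetrize (f.restrict s) := rfl

theorem TensorKernel.IsSymm.restrict {f : TensorKernel ι α β} (hf : f.IsSymm) (s : Finset ι) :
    (f.restrict s).IsSymm := fun σ τ p q => hf σ τ (incl s (p, q)).1 (incl s (p, q)).2

theorem IsAdj.restrict {f : TensorKernel ι α β} {h : TensorKernel ι β α} (hfh : IsAdj f h)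
    (s : Finset ι) : IsAdj (f.restrict s) (h.restrict s) := fun _ _ => hfh _ _

theorem symmetrize_sub [Fintype α] [DecidableEq α] [Fintype β] [DecidableEq β]
    (f g : TensorKernel ι α β) : symmetrize (f - g) = symmetrize f - symmetrize g := by
  ext z
  change symFun (f - g) z = symFun f z - symFun g z
  simp [symFun, mul_sub]

end Restrict

section ContractRestrict

variable {ι : Type*} {a b c d : ℕ}

theorem forall_glue_mem {i : ℕ} (hi : i ≤ a) {p : Fin (a - i) → ι} {w : Fin i → ι} {s : Finset ι} :
    (∀ t, glue hi p w t ∈ s) ↔ (∀ t, p t ∈ s) ∧ ∀ t, w t ∈ s := by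
  have : (∀ t, glue hi p w t ∈ s) ↔ ∀ t, Fin.append p w t ∈ s :=
    (finCongr (Nat.sub_add_cancel hi).symm).forall_congr fun t => Iff.rfl
  rw [this]
  constructor
  · intro h
    exact ⟨fun t => by simpa using h (Fin.castAdd i t), fun t => by simpa using h (Fin.natAdd _ t)⟩
  · rintro ⟨h1, h2⟩ t
    refine Fin.addCases (fun t => ?_) (fun t => ?_) t
    · simpa using h1 t
    · simpa using h2 t

theorem comp_glue {κ : Type*} (g : ι → κ) {i : ℕ} (hi : i ≤ a) (p : Fin (a - i) → ι)
    (w : Fin i → ι) : (fun t => g (glue hi p w t)) = glue hi (fun t => g (p t)) fun t => g (w t) := by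
  funext t
  unfold glue
  generalize Fin.cast (Nat.sub_add_cancel hi).symm t = t
  refine Fin.addCases (fun t => ?_) (fun t => ?_) t <;> simp

/-- Truncating before contracting also truncates the summation indices. The lost terms are those
whose summation index leaves `s`; with free indices in `s`, they are exactly what the tail of `f`
contributes. -/
theorem contract_restrict (i j : ℕ) (hia : i ≤ a) (hjb : j ≤ b) (hjc : j ≤ c) (hid : i ≤ d)
    (f : TensorKernel ι (Fin a) (Fin b)) (g : TensorKernel ι (Fin c) (Fin d)) (s : Finset ι) :
    contract i j hia hjb hjc hid (f.restrict s) (g.restrict s) =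
      (contract i j hia hjb hjc hid f g).restrict s -
        (contract i j hia hjb hjc hid (f.tail s) g).restrict s := by
  rw [eq_sub_iff_add_eq]
  ext z
  let F : (Fin i → ι) × (Fin j → ι) → ℂ := fun w =>
    f (glue hia ((incl s z).1 ∘ Sum.inl) w.1, glue hjb ((incl s z).2 ∘ Sum.inl) w.2)
  let G : (Fin i → ι) × (Fin j → ι) → ℂ := fun w =>
    g (glue hjc ((incl s z).1 ∘ Sum.inr) w.2, glue hid ((incl s z).2 ∘ Sum.inr) w.1)
  have hF : Memℓp F 2 := memlp_comp (lp.memℓp f) (φ := fun w : (Fin i → ι) × (Fin j → ι) =>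
    (glue hia ((incl s z).1 ∘ Sum.inl) w.1, glue hjb ((incl s z).2 ∘ Sum.inl) w.2)) (by
      intro w w' h
      obtain ⟨h1, h2⟩ := Prod.mk.inj h
      exact Prod.ext (glue_injective hia h1).2 (glue_injective hjb h2).2)
  have hG : Memℓp G 2 := memlp_comp (lp.memℓp g) (φ := fun w : (Fin i → ι) × (Fin j → ι) =>
    (glue hjc ((incl s z).1 ∘ Sum.inr) w.2, glue hid ((incl s z).2 ∘ Sum.inr) w.1)) (by
      intro w w' h
      obtain ⟨h1, h2⟩ := Prod.mk.inj h
      exact Prod.ext (glue_injective hid h2).2 (glue_injective hjc h1).2)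
  have hFG := summable_mul_of_memlp hF hG
  have e1 : contract i j hia hjb hjc hid (f.restrict s) (g.restrict s) z =
      ∑' w : (Fin i → s) × (Fin j → s), F (incl s w) * G (incl s w) := by
    change contractFun i j hia hjb hjc hid (f.restrict s) (g.restrict s) z = _
    refine tsum_congr fun w => ?_
    change f (incl s _) * g (incl s _) = _
    simp only [incl, comp_glue, F, G]
    rfl
  have e2 : (contract i j hia hjb hjc hid (f.tail s) g).restrict s z =
      ∑' w, (Set.range (incl s))ᶜ.indicator (fun w => F w * G w) w := by
    change contractFun i j hia hjb hjc hid (f.tail s) g (incl s z) = _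
    refine tsum_congr fun w => ?_
    change (Set.range (incl s))ᶜ.indicator f _ * _ = _
    have hz := mem_range_incl.1 (Set.mem_range_self (f := incl s) z)
    have hw : (glue hia ((incl s z).1 ∘ Sum.inl) w.1, glue hjb ((incl s z).2 ∘ Sum.inl) w.2) ∈
        Set.range (incl s (α := Fin a) (β := Fin b)) ↔ w ∈ Set.range (incl s) := by
      rw [mem_range_incl, mem_range_incl, forall_glue_mem, forall_glue_mem]
      simp [hz.1, hz.2]
    by_cases h : w ∈ Set.range (incl s)
    · rw [Set.indicator_of_notMem (by simpa using hw.2 h), Set.indicator_of_notMem (by simpa using h)]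
      simp
    · rw [Set.indicator_of_mem (by rw [Set.mem_compl_iff, hw]; exact h), Set.indicator_of_mem h]
  have e3 : (contract i j hia hjb hjc hid f g).restrict s z = ∑' w, F w * G w := rfl
  rw [lp.coeFn_add, Pi.add_apply, e1, e2, e3,
    ← hFG.tsum_subtype_add_tsum_subtype_compl (Set.range (incl s)),
    tsum_range (fun w => F w * G w) (incl_injective s), tsum_subtype (Set.range (incl s))ᶜ (fun w => F w * G w)]

theorem norm_symmetrize_contract_restrict_le (i j : ℕ) (hia : i ≤ a) (hjb : j ≤ b) (hjc : j ≤ c)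
    (hid : i ≤ d) (f : TensorKernel ι (Fin a) (Fin b)) (g : TensorKernel ι (Fin c) (Fin d))
    (s : Finset ι) :
    ‖symmetrize (contract i j hia hjb hjc hid (f.restrict s) (g.restrict s))‖ ≤
      ‖symmetrize (contract i j hia hjb hjc hid f g)‖ + ‖f.tail s‖ * ‖g‖ := by
  rw [contract_restrict, symmetrize_sub, ← restrict_symmetrize, ← restrict_symmetrize]
  refine (norm_sub_le _ _).trans (add_le_add (TensorKernel.norm_restrict_le _ _) ?_)
  exact (TensorKernel.norm_restrict_le _ _).trans
    ((norm_symmetrize_le _).trans (norm_contract_le _ _ _ _ _ _ _ _))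

theorem norm_contract_le_restrict_add (i j : ℕ) (hia : i ≤ a) (hjb : j ≤ b) (hjc : j ≤ c)
    (hid : i ≤ d) (f : TensorKernel ι (Fin a) (Fin b)) (g : TensorKernel ι (Fin c) (Fin d))
    (s : Finset ι) :
    ‖contract i j hia hjb hjc hid f g‖ ≤
      ‖contract i j hia hjb hjc hid (f.restrict s) (g.restrict s)‖ + ‖f.tail s‖ * ‖g‖ +
        ‖(contract i j hia hjb hjc hid f g).tail s‖ := by
  refine (TensorKernel.norm_le_restrict_add _ s).trans ?_
  gcongr
  rw [← eq_sub_iff_add_eq.1 (contract_restrict i j hia hjb hjc hid f g s)]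
  refine (norm_add_le _ _).trans ?_
  gcongr
  exact (TensorKernel.norm_restrict_le _ _).trans (norm_contract_le _ _ _ _ _ _ _ _)

end ContractRestrict

end

/-! ### Arbitrary index sets and convergence -/

/-- The contractions of a symmetric kernel are controlled by their symmetrizations. -/
theorem exists_norm_contract_le_symmetrize (m n : ℕ) (hmn : 2 ≤ m + n) : ∃ K : ℝ,
    ∀ (ι : Type*) (f : TensorKernel ι (Fin m) (Fin n))
      (h : TensorKernel ι (Fin n) (Fin m)) (_ : f.IsSymm) (_ : IsAdj f h) (ε : ℝ) (_ : 0 < ε)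
      (_ : ∀ (i j : ℕ) (_ : 0 < i + j) (_ : i + j ≤ m + n - 1)
        (him : i ≤ m) (hin : i ≤ n) (hjm : j ≤ m) (hjn : j ≤ n),
        ‖symmetrize (contract i j him hjn hjm hin f f)‖ ≤ ε)
      (_ : ∀ (i j : ℕ) (_ : 0 < i + j) (_ : i + j ≤ m + n - 1) (him : i ≤ m) (hjn : j ≤ n),
        ‖symmetrize (contract i j him hjn hjn him f h)‖ ≤ ε),
      (∀ (i j : ℕ) (_ : 0 < i + j) (_ : i + j ≤ m + n - 1)
        (him : i ≤ m) (hin : i ≤ n) (hjm : j ≤ m) (hjn : j ≤ n),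
        ‖contract i j him hjn hjm hin f f‖ ≤ K * ε) ∧
      (∀ (i j : ℕ) (_ : 0 < i + j) (_ : i + j ≤ m + n - 1) (him : i ≤ m) (hjn : j ≤ n),
        ‖contract i j him hjn hjn him f h‖ ≤ K * ε) := by
  obtain ⟨K, hK, H⟩ := exists_norm_contract_le m n hmn
  -- The truncated kernels satisfy the hypotheses with `2 * ε`, which gives `√K * 2`; undoing the
  -- truncation costs two further errors of size `ε`.
  refine ⟨√K * 2 + 2, ?_⟩
  intro ι f h hf hfh ε hε hX hY
  have htail : ∀ᶠ s in atTop, ‖f.tail s‖ * (‖f‖ + ‖h‖) < ε := by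
    have := f.tendsto_norm_tail.mul_const (‖f‖ + ‖h‖)
    rw [zero_mul] at this
    exact this.eventually_lt_const hε
  have hs : ∀ s, ‖f.tail s‖ * (‖f‖ + ‖h‖) < ε →
      ‖f.tail s‖ * ‖f‖ ≤ ε ∧ ‖f.tail s‖ * ‖h‖ ≤ ε := by
    intro s hs
    have h1 := mul_nonneg (norm_nonneg (f.tail s)) (norm_nonneg f)
    have h2 := mul_nonneg (norm_nonneg (f.tail s)) (norm_nonneg h)
    constructor <;> linarith
  have hr : ∀ s, ‖f.tail s‖ * (‖f‖ + ‖h‖) < ε → _ := fun s hlt =>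
    H s (f.restrict s) (h.restrict s) (hf.restrict s) (hfh.restrict s) (2 * ε) (by positivity)
      (fun i j h1 h2 him hin hjm hjn =>
        (norm_symmetrize_contract_restrict_le i j him hjn hjm hin f f s).trans
          (by linarith [hX i j h1 h2 him hin hjm hjn, (hs s hlt).1]))
      (fun i j h1 h2 him hjn =>
        (norm_symmetrize_contract_restrict_le i j him hjn hjn him f h s).trans
          (by linarith [hY i j h1 h2 him hjn, (hs s hlt).2]))
  have hsqrt : ∀ x : ℝ, x ^ 2 ≤ K * (2 * ε) ^ 2 → x ≤ √K * 2 * ε := by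
    intro x hx
    refine (Real.le_sqrt_of_sq_le hx).trans_eq ?_
    rw [Real.sqrt_mul hK, Real.sqrt_sq (by positivity)]
    ring
  constructor
  · intro i j h1 h2 him hin hjm hjn
    obtain ⟨s, hs1, hs2⟩ := (htail.and ((TensorKernel.tendsto_norm_tail
      (contract i j him hjn hjm hin f f)).eventually_lt_const hε)).exists
    have := hsqrt _ ((hr s hs1).1 i j h1 h2 him hin hjm hjn)
    have := norm_contract_le_restrict_add i j him hjn hjm hin f f s
    linarith [(hs s hs1).1]
  · intro i j h1 h2 him hjn
    obtain ⟨s, hs1, hs2⟩ := (htail.and ((TensorKernel.tendsto_norm_tail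
      (contract i j him hjn hjn him f h)).eventually_lt_const hε)).exists
    have := hsqrt _ ((hr s hs1).2 i j h1 h2 him hjn)
    have := norm_contract_le_restrict_add i j him hjn hjn him f h s
    linarith [(hs s hs1).2]

theorem tendsto_norm_contract_of_symmetrize {ι : Type*} {m n : ℕ} (hmn : 2 ≤ m + n)
    {f : ℕ → TensorKernel ι (Fin m) (Fin n)} {h : ℕ → TensorKernel ι (Fin n) (Fin m)}
    (hf : ∀ k, (f k).IsSymm) (hfh : ∀ k, IsAdj (f k) (h k))
    (hX : ∀ (i j : ℕ) (_ : 0 < i + j) (_ : i + j ≤ m + n - 1)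
        (him : i ≤ m) (hin : i ≤ n) (hjm : j ≤ m) (hjn : j ≤ n),
        Tendsto (fun k => ‖symmetrize (contract i j him hjn hjm hin (f k) (f k))‖) atTop (𝓝 0))
    (hY : ∀ (i j : ℕ) (_ : 0 < i + j) (_ : i + j ≤ m + n - 1) (him : i ≤ m) (hjn : j ≤ n),
        Tendsto (fun k => ‖symmetrize (contract i j him hjn hjn him (f k) (h k))‖)
          atTop (𝓝 0)) :
    (∀ (i j : ℕ) (_ : 0 < i + j) (_ : i + j ≤ m + n - 1)
        (him : i ≤ m) (hin : i ≤ n) (hjm : j ≤ m) (hjn : j ≤ n),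
        Tendsto (fun k => ‖contract i j him hjn hjm hin (f k) (f k)‖) atTop (𝓝 0)) ∧
      (∀ (i j : ℕ) (_ : 0 < i + j) (_ : i + j ≤ m + n - 1) (him : i ≤ m) (hjn : j ≤ n),
        Tendsto (fun k => ‖contract i j him hjn hjn him (f k) (h k)‖) atTop (𝓝 0)) := by
  obtain ⟨K, H⟩ := exists_norm_contract_le_symmetrize m n hmn
  -- The estimate for one contraction needs smallness of all the symmetrizations at once; finitely
  -- many pairs `(i, j)` are admissible.
  have hevX : ∀ ε > 0, ∀ᶠ k in atTop, ∀ i ∈ Finset.range (m + n), ∀ j ∈ Finset.range (m + n),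
      ∀ (_ : 0 < i + j) (_ : i + j ≤ m + n - 1)
        (him : i ≤ m) (hin : i ≤ n) (hjm : j ≤ m) (hjn : j ≤ n),
        ‖symmetrize (contract i j him hjn hjm hin (f k) (f k))‖ ≤ ε := by
    intro ε hε
    refine (Filter.eventually_all_finset _).2 fun i _ => (Filter.eventually_all_finset _).2
      fun j _ => ?_
    by_cases hc : 0 < i + j ∧ i + j ≤ m + n - 1 ∧ i ≤ m ∧ i ≤ n ∧ j ≤ m ∧ j ≤ n
    · filter_upwards [(hX i j hc.1 hc.2.1 hc.2.2.1 hc.2.2.2.1 hc.2.2.2.2.1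
        hc.2.2.2.2.2).eventually_le_const hε] with k hk
      exact fun _ _ _ _ _ _ => hk
    · exact Eventually.of_forall fun k h1 h2 h3 h4 h5 h6 => absurd ⟨h1, h2, h3, h4, h5, h6⟩ hc
  have hevY : ∀ ε > 0, ∀ᶠ k in atTop, ∀ i ∈ Finset.range (m + n), ∀ j ∈ Finset.range (m + n),
      ∀ (_ : 0 < i + j) (_ : i + j ≤ m + n - 1) (him : i ≤ m) (hjn : j ≤ n),
        ‖symmetrize (contract i j him hjn hjn him (f k) (h k))‖ ≤ ε := by
    intro ε hε
    refine (Filter.eventually_all_finset _).2 fun i _ => (Filter.eventually_all_finset _).2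
      fun j _ => ?_
    by_cases hc : 0 < i + j ∧ i + j ≤ m + n - 1 ∧ i ≤ m ∧ j ≤ n
    · filter_upwards [(hY i j hc.1 hc.2.1 hc.2.2.1 hc.2.2.2).eventually_le_const hε] with k hk
      exact fun _ _ _ _ => hk
    · exact Eventually.of_forall fun k h1 h2 h3 h4 => absurd ⟨h1, h2, h3, h4⟩ hc
  have hev : ∀ ε > 0, ∀ᶠ k in atTop,
      (∀ (i j : ℕ) (_ : 0 < i + j) (_ : i + j ≤ m + n - 1)
        (him : i ≤ m) (hin : i ≤ n) (hjm : j ≤ m) (hjn : j ≤ n),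
        ‖contract i j him hjn hjm hin (f k) (f k)‖ ≤ K * ε) ∧
      (∀ (i j : ℕ) (_ : 0 < i + j) (_ : i + j ≤ m + n - 1) (him : i ≤ m) (hjn : j ≤ n),
        ‖contract i j him hjn hjn him (f k) (h k)‖ ≤ K * ε) := by
    intro ε hε
    filter_upwards [hevX ε hε, hevY ε hε] with k hkX hkY
    exact H ι (f k) (h k) (hf k) (hfh k) ε hε
      (fun i j h1 h2 => hkX i (Finset.mem_range.2 (by omega)) j (Finset.mem_range.2 (by omega)) h1 h2)
      (fun i j h1 h2 => hkY i (Finset.mem_range.2 (by omega)) j (Finset.mem_range.2 (by omega)) h1 h2)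
  have hlim : ∀ u : ℕ → ℝ, (∀ k, 0 ≤ u k) → (∀ ε > 0, ∀ᶠ k in atTop, u k ≤ K * ε) →
      Tendsto u atTop (𝓝 0) := by
    intro u hu0 hu
    refine tendsto_order.2 ⟨fun a ha => Eventually.of_forall fun k => ha.trans_le (hu0 k),
      fun a ha => ?_⟩
    -- The sign of `K` is not part of the estimate, so it is replaced by a positive majorant.
    have hK : 0 < |K| + 1 := by positivity
    filter_upwards [hu (a / (2 * (|K| + 1))) (by positivity)] with k hk
    refine hk.trans_lt ?_
    calc K * (a / (2 * (|K| + 1))) ≤ (|K| + 1) * (a / (2 * (|K| + 1))) := by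
          gcongr; linarith [le_abs_self K]
      _ = a / 2 := by field_simp
      _ < a := by linarith
  constructor
  · intro i j h1 h2 him hin hjm hjn
    exact hlim _ (fun _ => norm_nonneg _) fun ε hε =>
      (hev ε hε).mono fun k hk => hk.1 i j h1 h2 him hin hjm hjn
  · intro i j h1 h2 him hjn
    exact hlim _ (fun _ => norm_nonneg _) fun ε hε =>
      (hev ε hε).mono fun k hk => hk.2 i j h1 h2 him hjn

/-! ### Gaussian integration by parts -/

theorem AllLp.add {Ω : Type*} [MeasurableSpace Ω] {X Y : Ω → ℂ} {P : Measure Ω}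
    (hX : AllLp X P) (hY : AllLp Y P) : AllLp (fun ω => X ω + Y ω) P :=
  fun p hp => (hX p hp).add (hY p hp)

theorem AllLp.integrable {Ω : Type*} [MeasurableSpace Ω] {X : Ω → ℂ} {P : Measure Ω}
    (hX : AllLp X P) : Integrable X P :=
  memLp_one_iff_integrable.1 (hX 1 (by simp))

theorem allLp_ofReal_gaussianReal (v : NNReal) :
    AllLp (fun x : ℝ => (x : ℂ)) (gaussianReal 0 v) :=
  fun p hp => (memLp_id_gaussianReal' (μ := 0) (v := v) p hp).ofReal

theorem integrable_gaussianReal_iff {v : NNReal} (hv : v ≠ 0) {f : ℝ → ℂ} :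
    Integrable f (gaussianReal 0 v) ↔ Integrable fun x => gaussianPDFReal 0 v x • f x := by
  rw [gaussianReal_of_var_ne_zero _ hv,
    integrable_withDensity_iff_integrable_smul' (measurable_gaussianPDF _ _)
      (ae_of_all _ fun x => by simp [gaussianPDF])]
  simp [gaussianPDF, ENNReal.toReal_ofReal (gaussianPDFReal_nonneg _ _ _)]

theorem hasDerivAt_gaussianPDFReal {v : NNReal} (hv : v ≠ 0) (x : ℝ) :
    HasDerivAt (gaussianPDFReal 0 v) (-(x / v) * gaussianPDFReal 0 v x) x := by
  have hv' : (v : ℝ) ≠ 0 := by exact_mod_cast hv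
  unfold gaussianPDFReal
  have h1 : HasDerivAt (fun y : ℝ => -(y - 0) ^ 2 / (2 * v)) (-(x / v)) x := by
    have := ((((hasDerivAt_id x).sub_const 0).pow 2).neg).div_const (2 * (v : ℝ))
    convert! this using 1
    simp
    field_simp
  convert! (h1.exp).const_mul ((√(2 * Real.pi * v))⁻¹) using 1
  ring

/-- Gaussian integration by parts on the real line. -/
theorem integral_mul_gaussianReal {v : NNReal} (hv : v ≠ 0) {f f' : ℝ → ℂ}
    (hf : ∀ x, HasDerivAt f (f' x) x) (hfL : AllLp f (gaussianReal 0 v))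
    (hfL' : AllLp f' (gaussianReal 0 v)) :
    ∫ x, (x : ℂ) * f x ∂(gaussianReal 0 v) = v * ∫ x, f' x ∂(gaussianReal 0 v) := by
  have hv' : (v : ℂ) ≠ 0 := by exact_mod_cast hv
  have hI1 := (integrable_gaussianReal_iff hv).1
    ((allLp_ofReal_gaussianReal v).mul hfL).integrable
  have hI2 := (integrable_gaussianReal_iff hv).1 hfL'.integrable
  have hI3 := (integrable_gaussianReal_iff hv).1 hfL.integrable
  have hd : ∀ x, HasDerivAt (fun x => (gaussianPDFReal 0 v x : ℂ))
      ((-(x / v) * gaussianPDFReal 0 v x : ℝ) : ℂ) x :=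
    fun x => (hasDerivAt_gaussianPDFReal hv x).ofReal_comp
  have key := integral_mul_deriv_eq_deriv_mul_of_integrable
    (u := fun x => (gaussianPDFReal 0 v x : ℂ)) (v := f)
    (u' := fun x => ((-(x / v) * gaussianPDFReal 0 v x : ℝ) : ℂ)) (v' := f')
    (fun x _ => hd x) (fun x _ => hf x)
    (by simpa [Pi.mul_def] using hI2)
    (by
      convert! hI1.const_mul (-(v : ℂ)⁻¹) using 2
      simp
      ring)
    (by simpa [Pi.mul_def] using hI3)
  rw [integral_gaussianReal_eq_integral_smul hv, integral_gaussianReal_eq_integral_smul hv]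
  simp only [Complex.real_smul]
  rw [key, ← integral_neg, ← integral_const_mul]
  congr 1
  ext x
  push_cast
  field_simp

/-- Gaussian integration by parts on the plane, for monomials. -/
theorem integral_monomial_gaussianReal_prod (v : NNReal) (hv : v ≠ 0) (a b : ℕ) :
    ∫ x : ℝ × ℝ, (x.1 + x.2 * Complex.I : ℂ) *
        ((x.1 + x.2 * Complex.I) ^ a * (x.1 - x.2 * Complex.I) ^ b)
        ∂((gaussianReal 0 v).prod (gaussianReal 0 v)) =
      2 * v * (b * ∫ x : ℝ × ℝ, (x.1 + x.2 * Complex.I : ℂ) ^ a *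
        (x.1 - x.2 * Complex.I) ^ (b - 1) ∂((gaussianReal 0 v).prod (gaussianReal 0 v))) := by
  set γ := gaussianReal 0 v
  have hx : AllLp (fun x : ℝ × ℝ => (x.1 : ℂ)) (γ.prod γ) := fun p hp =>
    (allLp_ofReal_gaussianReal v p hp).comp_fst γ
  have hy : AllLp (fun x : ℝ × ℝ => (x.2 : ℂ)) (γ.prod γ) := fun p hp =>
    (allLp_ofReal_gaussianReal v p hp).comp_snd γ
  have hx1 := allLp_ofReal_gaussianReal v
  have hc : ∀ (c : ℂ), AllLp (fun _ : ℝ => c) γ := fun c => AllLp.const c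
  have hc2 : ∀ (c : ℂ), AllLp (fun _ : ℝ × ℝ => c) (γ.prod γ) := fun c => AllLp.const c
  have hz : AllLp (fun x : ℝ × ℝ => (x.1 + x.2 * Complex.I : ℂ)) (γ.prod γ) :=
    hx.add (hy.mul (hc2 _))
  have hw : AllLp (fun x : ℝ × ℝ => (x.1 - x.2 * Complex.I : ℂ)) (γ.prod γ) := by
    convert hx.add (hy.mul (hc2 (-Complex.I))) using 2
    ring
  have hm : ∀ a b : ℕ, AllLp (fun x : ℝ × ℝ => (x.1 + x.2 * Complex.I : ℂ) ^ a *
      (x.1 - x.2 * Complex.I) ^ b) (γ.prod γ) := fun a b => (hz.pow a).mul (hw.pow b)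
  have hX : ∀ (y : ℝ) (a b : ℕ), AllLp (fun x : ℝ => (x + y * Complex.I : ℂ) ^ a *
      (x - y * Complex.I) ^ b) γ := fun y a b =>
    ((hx1.add (hc _)).pow a).mul (((hx1.add (hc (-(y * Complex.I)))).pow b))
  have hY : ∀ (x : ℝ) (a b : ℕ), AllLp (fun y : ℝ => (x + y * Complex.I : ℂ) ^ a *
      (x - y * Complex.I) ^ b) γ := fun x a b => by
    convert ((((hc x).add (hx1.mul (hc Complex.I))).pow a).mul
      ((((hc x).add (hx1.mul (hc (-Complex.I)))).pow b))) using 2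
    ring
  set M : ℕ → ℕ → ℝ → ℝ → ℂ := fun a b x y => (x + y * Complex.I : ℂ) ^ a *
      (x - y * Complex.I) ^ b with hM
  have e1 : ∫ x : ℝ × ℝ, (x.1 : ℂ) * M a b x.1 x.2 ∂(γ.prod γ) =
      v * ∫ x : ℝ × ℝ, (a * M (a - 1) b x.1 x.2 + b * M a (b - 1) x.1 x.2) ∂(γ.prod γ) := by
    have hi : AllLp (fun x : ℝ × ℝ => a * M (a - 1) b x.1 x.2 + b * M a (b - 1) x.1 x.2)
      (γ.prod γ) := ((hc2 a).mul (hm (a - 1) b)).add ((hc2 b).mul (hm a (b - 1)))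
    rw [integral_prod_symm _ (hx.mul (hm a b)).integrable, integral_prod_symm _ hi.integrable,
      ← integral_const_mul]
    congr 1
    ext y
    refine integral_mul_gaussianReal hv (fun x => ?_) (hX y a b)
      (((hc a).mul (hX y (a - 1) b)).add ((hc b).mul (hX y a (b - 1))))
    have h0 : HasDerivAt (fun x : ℝ => (x : ℂ)) 1 x := Complex.ofRealCLM.hasDerivAt
    convert! ((h0.add_const (y * Complex.I)).pow a).mul ((h0.sub_const (y * Complex.I)).pow b)
      using 1
    simp [hM]
    ring
  have e2 : ∫ x : ℝ × ℝ, (x.2 : ℂ) * M a b x.1 x.2 ∂(γ.prod γ) =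
      v * ∫ x : ℝ × ℝ, (Complex.I * a * M (a - 1) b x.1 x.2 +
        -Complex.I * b * M a (b - 1) x.1 x.2) ∂(γ.prod γ) := by
    have hi : AllLp (fun x : ℝ × ℝ => Complex.I * a * M (a - 1) b x.1 x.2 +
      -Complex.I * b * M a (b - 1) x.1 x.2)
      (γ.prod γ) := ((hc2 _).mul (hm (a - 1) b)).add ((hc2 _).mul (hm a (b - 1)))
    rw [integral_prod _ (hy.mul (hm a b)).integrable, integral_prod _ hi.integrable,
      ← integral_const_mul]
    congr 1
    ext x
    refine integral_mul_gaussianReal hv (fun y => ?_) (hY x a b)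
      (((hc _).mul (hY x (a - 1) b)).add ((hc _).mul (hY x a (b - 1))))
    have h0 : HasDerivAt (fun y : ℝ => (y * Complex.I : ℂ)) Complex.I y := by
      simpa using (Complex.ofRealCLM.hasDerivAt (x := y)).mul_const Complex.I
    convert! ((h0.const_add (x : ℂ)).pow a).mul ((h0.const_sub (x : ℂ)).pow b)
      using 1
    simp [hM]
    ring
  have e3 : ∀ x : ℝ × ℝ, (x.1 + x.2 * Complex.I : ℂ) *
        ((x.1 + x.2 * Complex.I) ^ a * (x.1 - x.2 * Complex.I) ^ b) =
      x.1 * M a b x.1 x.2 + Complex.I * (x.2 * M a b x.1 x.2) := fun x => by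
    simp only [hM]; ring
  simp_rw [e3]
  rw [integral_add (hx.mul (hm a b)).integrable ((hy.mul (hm a b)).integrable.const_mul _),
    integral_const_mul, e1, e2, mul_left_comm Complex.I, ← mul_add, ← integral_const_mul,
    ← integral_add (((hc2 a).mul (hm (a - 1) b)).add ((hc2 b).mul (hm a (b - 1)))).integrable
    ((((hc2 _).mul (hm (a - 1) b)).add ((hc2 _).mul (hm a (b - 1)))).integrable.const_mul _),
    ← integral_const_mul, ← integral_const_mul, ← integral_const_mul]
  congr 1
  ext x
  -- The operator `∂ₓ + i ∂ᵧ` is twice the derivative in the conjugate variable: by `I * I = -1` the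
  -- `a`-terms cancel and the `b`-terms double.
  linear_combination (v * (a * ((x.1 + x.2 * Complex.I : ℂ) ^ (a - 1) *
      (x.1 - x.2 * Complex.I) ^ b) - b * ((x.1 + x.2 * Complex.I : ℂ) ^ a *
      (x.1 - x.2 * Complex.I) ^ (b - 1)))) * Complex.I_mul_I

section

variable {H : Type*} [NormedAddCommGroup H] [InnerProductSpace ℂ H] {ι : Type*}
  {Ω : Type*} [MeasurableSpace Ω] {Z : H → Ω → ℂ} {P : Measure Ω}

/-- The product of two real parts is half the real part of `U V + U conj V`; the first term has mean
zero by the vanishing pseudo-covariance. Choosing `x, y` among `1` and `-I` gives every covariance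
of real and imaginary parts. -/
theorem IsComplexIsonormal.covariance_re (hZ : IsComplexIsonormal Z P) (g h : H) (x y : ℂ) :
    cov[fun ω => (x * Z g ω).re, fun ω => (y * Z h ω).re; P] =
      (x * conj y * inner ℂ h g).re / 2 := by
  have := hZ.isProbabilityMeasure
  have hL : ∀ (c : ℂ) (g : H), AllLp (fun ω => c * Z g ω) P :=
    fun c g => (AllLp.const c).mul (hZ.allLp g)
  have hE : ∀ (c : ℂ) (g : H), ∫ ω, (c * Z g ω).re ∂P = 0 := fun c g => by
    have := integral_re (hL c g).integrable
    simp only [RCLike.re_to_complex] at this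
    rw [this, integral_const_mul, hZ.mean, mul_zero, Complex.zero_re]
  have hR : ∀ (c : ℂ) (g : H), MemLp (fun ω => (c * Z g ω).re) 2 P :=
    fun c g => (hL c g 2 (by simp)).re
  rw [covariance_eq_sub (hR x g) (hR y h)]
  change ∫ ω, (x * Z g ω).re * (y * Z h ω).re ∂P - (∫ ω, (x * Z g ω).re ∂P) *
    (∫ ω, (y * Z h ω).re ∂P) = _
  rw [hE, zero_mul, sub_zero]
  have e : ∀ ω, (x * Z g ω).re * (y * Z h ω).re =
      ((x * y / 2) * (Z g ω * Z h ω) + (x * conj y / 2) * (Z g ω * conj (Z h ω))).re := by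
    intro ω
    simp [Complex.add_re, Complex.mul_re, Complex.mul_im]
    ring
  simp_rw [e]
  have h1 : Integrable (fun ω => (x * y / 2) * (Z g ω * Z h ω)) P :=
    ((AllLp.const _).mul ((hZ.allLp g).mul (hZ.allLp h))).integrable
  have h2 : Integrable (fun ω => (x * conj y / 2) * (Z g ω * conj (Z h ω))) P :=
    ((AllLp.const _).mul ((hZ.allLp g).mul (hZ.allLp h).conj)).integrable
  have := integral_re (h1.add h2)
  simp only [RCLike.re_to_complex, Pi.add_apply] at this
  rw [this, integral_add h1 h2, integral_const_mul, integral_const_mul, hZ.pseudoCovariance,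
    hZ.covariance, mul_zero, zero_add, div_mul_eq_mul_div]
  exact Complex.div_ofNat_re _ 2

/-- The real and imaginary parts are jointly Gaussian and uncorrelated, hence independent, each of
variance `1 / 2`. -/
theorem IsComplexIsonormal.map_re_im (hZ : IsComplexIsonormal Z P) {g : H} (hg : ‖g‖ = 1) :
    P.map (fun ω => ((Z g ω).re, (Z g ω).im)) =
      (gaussianReal 0 (1 / 2)).prod (gaussianReal 0 (1 / 2)) := by
  have := hZ.isProbabilityMeasure
  have hG := hZ.gaussian.hasGaussianLaw_eval g
  have hi : inner ℂ g g = 1 := by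
    rw [inner_self_eq_norm_sq_to_K, hg]; simp
  have hpair : HasGaussianLaw (fun ω => ((Z g ω).re, (Z g ω).im)) P :=
    hG.map_fun (Complex.reCLM.prod Complex.imCLM)
  have him : ∀ z : ℂ, z.im = (-Complex.I * z).re := fun z => by simp
  have hre : ∀ z : ℂ, z.re = (1 * z).re := fun z => by simp
  have hcov : cov[fun ω => (Z g ω).re, fun ω => (Z g ω).im; P] = 0 := by
    simp_rw [him, hre (Z g _)]
    rw [hZ.covariance_re, hi]
    simp
  have hind := hpair.indepFun_of_covariance_eq_zero hcov
  rw [indepFun_iff_map_prod_eq_prod_map_map hpair.fst.aemeasurable hpair.snd.aemeasurable] at hind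
  rw [hind]
  have hre' : P.map (fun ω => (Z g ω).re) = gaussianReal 0 (1 / 2) := by
    rw [hpair.fst.map_eq_gaussianReal]
    have h1 := integral_re (hZ.allLp g).integrable
    simp only [RCLike.re_to_complex] at h1
    rw [h1, hZ.mean, ← covariance_self hpair.fst.aemeasurable]
    simp_rw [hre (Z g _)]
    rw [hZ.covariance_re, hi]
    simp [Real.toNNReal_inv]
  have him' : P.map (fun ω => (Z g ω).im) = gaussianReal 0 (1 / 2) := by
    rw [hpair.snd.map_eq_gaussianReal]
    have h1 := integral_im (hZ.allLp g).integrable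
    simp only [RCLike.im_to_complex] at h1
    rw [h1, hZ.mean, ← covariance_self hpair.snd.aemeasurable]
    simp_rw [him (Z g _)]
    rw [hZ.covariance_re, hi]
    simp [Real.toNNReal_inv]
  rw [hre', him']

/-- Gaussian integration by parts for the monomials in `Z g` and its conjugate. -/
theorem IsComplexIsonormal.integral_mul_monomial (hZ : IsComplexIsonormal Z P) {g : H}
    (hg : ‖g‖ = 1) (a b : ℕ) :
    ∫ ω, Z g ω * (Z g ω ^ a * conj (Z g ω) ^ b) ∂P =
      b * ∫ ω, Z g ω ^ a * conj (Z g ω) ^ (b - 1) ∂P := by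
  have hG := hZ.gaussian.hasGaussianLaw_eval g
  have hpair : HasGaussianLaw (fun ω => ((Z g ω).re, (Z g ω).im)) P :=
    hG.map_fun (Complex.reCLM.prod Complex.imCLM)
  have key := integral_monomial_gaussianReal_prod (1 / 2) (by simp) a b
  rw [← hZ.map_re_im hg, integral_map hpair.aemeasurable (by fun_prop),
    integral_map hpair.aemeasurable (by fun_prop)] at key
  have hc : ∀ z : ℂ, conj z = z.re - z.im * Complex.I := fun z => by
    apply Complex.ext <;> simp
  simp only [Complex.re_add_im, ← hc] at key
  rw [key]
  push_cast
  ring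

/-! ### Polynomials in a complex variable and its conjugate -/

/-- The value at `z` of a polynomial in `z` and `conj z`. -/
abbrev evalConj (z : ℂ) (p : MvPolynomial (Fin 2) ℂ) : ℂ :=
  MvPolynomial.eval ![z, conj z] p

theorem AllLp.evalConj {X : Ω → ℂ} [IsFiniteMeasure P] (hX : AllLp X P)
    (p : MvPolynomial (Fin 2) ℂ) : AllLp (fun ω => evalConj (X ω) p) P := by
  induction p using MvPolynomial.induction_on with
  | C c => simpa using AllLp.const c
  | add p q hp hq => simpa using hp.add hq
  | mul_X p i hp =>
    fin_cases i
    · simpa using hp.mul hX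
    · simpa using hp.mul hX.conj

theorem IsComplexIsonormal.integral_mul_evalConj (hZ : IsComplexIsonormal Z P) {g : H}
    (hg : ‖g‖ = 1) (p : MvPolynomial (Fin 2) ℂ) :
    ∫ ω, Z g ω * evalConj (Z g ω) p ∂P = ∫ ω, evalConj (Z g ω) (MvPolynomial.pderiv 1 p) ∂P := by
  have := hZ.isProbabilityMeasure
  induction p using MvPolynomial.induction_on' with
  | monomial u c =>
    have h1 := hZ.integral_mul_monomial hg (u 0) (u 1)
    simp only [MvPolynomial.pderiv_monomial, MvPolynomial.eval_monomial, Finsupp.prod_fintype,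
      Fin.prod_univ_two, pow_zero, implies_true]
    simp only [Matrix.cons_val_zero, Matrix.cons_val_one, Finsupp.tsub_apply,
      Finsupp.single_apply]
    simp only [Fin.isValue, one_ne_zero, if_false, if_true, tsub_zero]
    simp_rw [mul_left_comm _ c]
    rw [integral_const_mul, integral_const_mul, h1, mul_assoc]
  | add p q hp hq =>
    simp only [map_add, mul_add]
    rw [integral_add, integral_add, hp, hq]
    · exact ((hZ.allLp g).evalConj _).integrable
    · exact ((hZ.allLp g).evalConj _).integrable
    · exact ((hZ.allLp g).mul ((hZ.allLp g).evalConj _)).integrable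
    · exact ((hZ.allLp g).mul ((hZ.allLp g).evalConj _)).integrable

end

/-! ### Complex Hermite polynomials: recursion and orthogonality -/

section

theorem conj_hermiteJ (a b : ℕ) (z : ℂ) (ρ : ℝ) : conj (hermiteJ a b z ρ) = hermiteJ b a z ρ := by
  simp only [hermiteJ, map_sum, map_mul, map_pow, map_neg, map_one, map_natCast,
    Complex.conj_conj, Complex.conj_ofReal, min_comm b a]
  refine Finset.sum_congr rfl fun r _ => ?_
  ring

theorem hermiteJ_zero_zero (z : ℂ) (ρ : ℝ) : hermiteJ 0 0 z ρ = 1 := by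
  simp [hermiteJ]

theorem hermiteJ_one_eq_sum (a b : ℕ) (z : ℂ) :
    hermiteJ a b z 1 = ∑ r ∈ Finset.range (b + 1), (-1) ^ r * (r.factorial : ℂ) *
      (a.choose r : ℂ) * (b.choose r : ℂ) * z ^ (a - r) * (conj z) ^ (b - r) := by
  simp only [hermiteJ, Complex.ofReal_one, one_pow, mul_one]
  refine Finset.sum_subset (fun r hr => ?_) fun r hr hr' => ?_
  · simp only [Finset.mem_range] at hr ⊢
    omega
  · have : a < r := by
      simp only [Finset.mem_range] at hr hr'
      omega
    simp [Nat.choose_eq_zero_of_lt this]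

/-- Coefficientwise this is Pascal's rule for `a + 1` together with `(r + 1) * C(b + 1, r + 1) = (b
+ 1) * C(b, r)`. It exhibits `z - ∂/∂(conj z)` as the operator raising the first index. -/
theorem hermiteJ_succ_left (a b : ℕ) (z : ℂ) :
    hermiteJ (a + 1) b z 1 = z * hermiteJ a b z 1 - b * hermiteJ a (b - 1) z 1 := by
  have hz : ∀ r, (a.choose r : ℂ) * z ^ (a + 1 - r) = (a.choose r : ℂ) * (z * z ^ (a - r)) := by
    intro r
    rcases le_or_gt r a with h | h
    · rw [Nat.succ_sub h, pow_succ']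
    · simp [Nat.choose_eq_zero_of_lt h]
  cases b with
  | zero => simp [hermiteJ_one_eq_sum, pow_succ']
  | succ b =>
    have hch : ∀ r, ((r + 1 : ℕ) : ℂ) * ((b + 1).choose (r + 1) : ℂ) =
        ((b + 1 : ℕ) : ℂ) * (b.choose r : ℂ) := fun r => by
      have := Nat.add_one_mul_choose_eq b r
      rw [mul_comm]
      exact_mod_cast this.symm
    rw [hermiteJ_one_eq_sum, hermiteJ_one_eq_sum a (b + 1), hermiteJ_one_eq_sum a (b + 1 - 1),
      Nat.add_sub_cancel, Finset.sum_range_succ', Finset.sum_range_succ' _ (b + 1), mul_add,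
      Finset.mul_sum, Finset.mul_sum, add_sub_right_comm, ← Finset.sum_sub_distrib]
    congr 1
    · refine Finset.sum_congr rfl fun r _ => ?_
      have h1 := hz (r + 1)
      have h2 := hch r
      rw [Nat.add_sub_add_right] at h1 ⊢
      rw [Nat.choose_succ_succ, Nat.factorial_succ]
      push_cast at h1 h2 ⊢
      linear_combination (-1) ^ (r + 1) * (r + 1) * (r.factorial : ℂ) *
        ((b + 1).choose (r + 1) : ℂ) * conj z ^ (b - r) * h1 - (-1) ^ r * (r.factorial : ℂ) *
        (a.choose r) * z ^ (a - r) * conj z ^ (b - r) * h2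
    · simp [pow_succ']
      ring

/-- The complex Hermite polynomial of parameter one, as a formal polynomial. -/
def hermitePoly : ℕ → ℕ → MvPolynomial (Fin 2) ℂ
  | 0, b => MvPolynomial.X 1 ^ b
  | a + 1, b => MvPolynomial.X 0 * hermitePoly a b - MvPolynomial.pderiv 1 (hermitePoly a b)

theorem pderiv_hermitePoly (a b : ℕ) :
    MvPolynomial.pderiv 1 (hermitePoly a b) = (b : MvPolynomial (Fin 2) ℂ) * hermitePoly a (b - 1) := by
  induction a generalizing b with
  | zero => simp [hermitePoly, Derivation.leibniz_pow, nsmul_eq_mul]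
  | succ a ih =>
    simp only [hermitePoly]
    rw [map_sub, Derivation.leibniz, ih, ih (b - 1), Derivation.leibniz, ih (b - 1),
      MvPolynomial.pderiv_X_of_ne (by decide)]
    simp only [smul_eq_mul, Derivation.map_natCast]
    ring

theorem evalConj_hermitePoly (a b : ℕ) (z : ℂ) :
    evalConj z (hermitePoly a b) = hermiteJ a b z 1 := by
  induction a generalizing b with
  | zero => simp [hermitePoly, hermiteJ]
  | succ a ih =>
    rw [hermiteJ_succ_left, ← ih, ← ih, hermitePoly, pderiv_hermitePoly]
    simp

variable {H : Type*} [NormedAddCommGroup H] [InnerProductSpace ℂ H]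
  {Ω : Type*} [MeasurableSpace Ω] {Z : H → Ω → ℂ} {P : Measure Ω}

/-- Integration by parts moves the raising operator from the first factor to `∂/∂(conj z)` on the
second, which lowers its second index. For `d = 0` the factor `d` makes the truncated `d - 1`
irrelevant. -/
theorem IsComplexIsonormal.integral_hermiteJ_succ_mul (hZ : IsComplexIsonormal Z P) {g : H}
    (hg : ‖g‖ = 1) (a b c d : ℕ) :
    ∫ ω, hermiteJ (a + 1) b (Z g ω) 1 * hermiteJ c d (Z g ω) 1 ∂P =
      d * ∫ ω, hermiteJ a b (Z g ω) 1 * hermiteJ c (d - 1) (Z g ω) 1 ∂P := by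
  have := hZ.isProbabilityMeasure
  have hA := hZ.allLp g
  simp_rw [← evalConj_hermitePoly]
  have e : ∀ ω, evalConj (Z g ω) (hermitePoly (a + 1) b) * evalConj (Z g ω) (hermitePoly c d) =
      Z g ω * evalConj (Z g ω) (hermitePoly a b * hermitePoly c d) -
      evalConj (Z g ω) (MvPolynomial.pderiv 1 (hermitePoly a b) * hermitePoly c d) := by
    intro ω
    simp only [hermitePoly, map_sub, map_mul]
    simp
    ring
  simp_rw [e]
  rw [integral_sub (hA.mul (hA.evalConj _)).integrable (hA.evalConj _).integrable,
    hZ.integral_mul_evalConj hg, ← integral_sub (hA.evalConj _).integrable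
    (hA.evalConj _).integrable, ← integral_const_mul]
  congr 1
  ext ω
  rw [Derivation.leibniz, pderiv_hermitePoly c d, ← map_sub]
  simp only [smul_eq_mul, map_sub, map_add, map_mul, map_natCast]
  ring

/-- The pairing of complex Hermite polynomials in a standard complex Gaussian variable. -/
theorem IsComplexIsonormal.integral_hermiteJ_mul (hZ : IsComplexIsonormal Z P) {g : H}
    (hg : ‖g‖ = 1) (a b c d : ℕ) :
    ∫ ω, hermiteJ a b (Z g ω) 1 * hermiteJ c d (Z g ω) 1 ∂P =
      if a = d ∧ b = c then (a.factorial : ℂ) * b.factorial else 0 := by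
  have := hZ.isProbabilityMeasure
  have hM : ∀ n : ℕ, ∫ ω, conj (Z g ω) ^ n ∂P = if n = 0 then 1 else 0 := by
    intro n
    rcases n with - | n
    · simp
    · have h1 := hZ.integral_mul_monomial hg n 0
      simp only [pow_zero, mul_one, CharP.cast_eq_zero, zero_mul, ← pow_succ'] at h1
      simp_rw [← map_pow]
      rw [integral_conj, h1]
      simp
  have h0 : ∀ b c d : ℕ, ∫ ω, hermiteJ c d (Z g ω) 1 * hermiteJ 0 b (Z g ω) 1 ∂P =
      if c = b ∧ d = 0 then (c.factorial : ℂ) else 0 := by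
    intro b c
    induction c generalizing b with
    | zero =>
      intro d
      have e : ∀ ω, hermiteJ 0 d (Z g ω) 1 * hermiteJ 0 b (Z g ω) 1 = conj (Z g ω) ^ (d + b) := by
        intro ω
        simp [hermiteJ, pow_add]
      simp_rw [e]
      rw [hM]
      have : d + b = 0 ↔ 0 = b ∧ d = 0 := by omega
      exact if_congr this (by simp) rfl
    | succ c ih =>
      intro d
      rw [hZ.integral_hermiteJ_succ_mul hg, ih]
      rcases b with - | b
      · simp
      · simp only [Nat.add_sub_cancel, Nat.add_right_cancel_iff, mul_ite, mul_zero]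
        refine ite_congr rfl (fun h => ?_) fun _ => rfl
        rw [h.1, Nat.factorial_succ]
        push_cast
        ring
  induction a generalizing b c d with
  | zero =>
    simp_rw [mul_comm (hermiteJ 0 b _ _)]
    rw [h0]
    have : (c = b ∧ d = 0) ↔ (0 = d ∧ b = c) := by omega
    simp only [this, Nat.factorial_zero, Nat.cast_one, one_mul]
    refine ite_congr rfl (fun h => by rw [h.2]) fun _ => rfl
  | succ a ih =>
    rw [hZ.integral_hermiteJ_succ_mul hg, ih]
    rcases d with - | d
    · simp
    · simp only [Nat.add_sub_cancel, Nat.add_right_cancel_iff, mul_ite, mul_zero]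
      refine ite_congr rfl (fun h => ?_) fun _ => rfl
      rw [h.1, Nat.factorial_succ]
      push_cast
      ring

end

/-! ### Independence and orthogonality of the Hermite products -/

section

variable {H : Type*} [NormedAddCommGroup H] [InnerProductSpace ℂ H] {ι : Type*}
  {Ω : Type*} [MeasurableSpace Ω] {Z : H → Ω → ℂ} {P : Measure Ω}

/-- In a jointly Gaussian family, independence only requires the real covariances to vanish, and
they do because the basis is orthogonal. The `Unit` index presents each variable as a one-element
block. -/
theorem IsComplexIsonormal.iIndepFun (hZ : IsComplexIsonormal Z P) (e : HilbertBasis ι ℂ H) :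
    iIndepFun (fun k => Z (e k)) P := by
  have h := IsGaussianProcess.iIndepFun_of_covariance_inner (T := ι) (S := fun _ => Unit)
    (X := fun k _ => Z (e k)) (P := P) (hZ.gaussian.comp_right fun p : (_ : ι) × Unit => e p.1)
    (fun k _ => hZ.gaussian.aemeasurable (e k)) (fun k l hkl _ _ x y => by
      have hr : ∀ z w : ℂ, inner ℝ z w = (conj z * w).re := fun z w => by
        rw [Complex.inner, mul_comm]
      simp_rw [hr]
      rw [hZ.covariance_re, e.orthonormal.inner_eq_zero hkl.symm]
      simp)
  exact h.comp (fun _ g => g ()) fun _ => measurable_pi_apply _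

open Classical in
/-- The number of occurrences of `k` in the tuple `p`. -/
def count {m : ℕ} (p : Fin m → ι) (k : ι) : ℕ :=
  (Finset.univ.filter fun s => p s = k).card

theorem count_le {m : ℕ} (p : Fin m → ι) (k : ι) : count p k ≤ m := by
  classical
  exact (Finset.card_filter_le _ _).trans (by simp)

theorem count_pos_iff {m : ℕ} {p : Fin m → ι} {k : ι} : 0 < count p k ↔ ∃ s, p s = k := by
  simp [count, Finset.card_pos, Finset.Nonempty]

theorem count_ne_zero_iff {m : ℕ} {p : Fin m → ι} {k : ι} : count p k ≠ 0 ↔ ∃ s, p s = k := by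
  rw [← count_pos_iff, Nat.pos_iff_ne_zero]

/-- Tuples with the same numbers of occurrences differ by a permutation. -/
theorem exists_perm_of_count_eq {m : ℕ} {p p' : Fin m → ι} (h : count p = count p') :
    ∃ σ : Equiv.Perm (Fin m), p' ∘ σ = p := by
  classical
  have hc : ∀ k, Fintype.card {s // p s = k} = Fintype.card {s // p' s = k} := fun k => by
    have := congrFun h k
    simp only [count] at this
    rw [Fintype.card_subtype, Fintype.card_subtype]
    exact this
  refine ⟨Equiv.ofFiberEquiv fun k => Fintype.equivOfCardEq (hc k), ?_⟩
  ext s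
  exact Equiv.ofFiberEquiv_map _ s

/-- The indices occurring in a pair of tuples. -/
def indices {m n : ℕ} (z : (Fin m → ι) × (Fin n → ι)) : Finset ι :=
  open Classical in Finset.univ.image z.1 ∪ Finset.univ.image z.2

theorem count_eq_zero_of_notMem {m n : ℕ} {z : (Fin m → ι) × (Fin n → ι)} {k : ι}
    (hk : k ∉ indices z) : count z.1 k = 0 ∧ count z.2 k = 0 := by
  classical
  simp only [indices, Finset.mem_union, Finset.mem_image, Finset.mem_univ, true_and, not_or] at hk
  refine ⟨?_, ?_⟩ <;> by_contra h <;> rw [← ne_eq, count_ne_zero_iff] at h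
  · exact hk.1 h
  · exact hk.2 h

/-- Two pairs of tuples with the same numbers of occurrences. -/
def SameCounts {m n : ℕ} (z w : (Fin m → ι) × (Fin n → ι)) : Prop :=
  count z.1 = count w.1 ∧ count z.2 = count w.2

theorem SameCounts.symm {m n : ℕ} {z w : (Fin m → ι) × (Fin n → ι)} (h : SameCounts z w) :
    SameCounts w z := ⟨h.1.symm, h.2.symm⟩

/-- The squared norm of the integral of a basis vector. -/
def countFactorial {m n : ℕ} (z : (Fin m → ι) × (Fin n → ι)) : ℕ :=
  ∏ k ∈ indices z, (count z.1 k).factorial * (count z.2 k).factorial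

theorem countFactorial_pos {m n : ℕ} (z : (Fin m → ι) × (Fin n → ι)) : 0 < countFactorial z :=
  Finset.prod_pos fun _ _ => Nat.mul_pos (Nat.factorial_pos _) (Nat.factorial_pos _)

theorem card_indices_le {m n : ℕ} (z : (Fin m → ι) × (Fin n → ι)) :
    (indices z).card ≤ m + n := by
  classical
  refine (Finset.card_union_le _ _).trans (add_le_add ?_ ?_) <;>
  exact Finset.card_image_le.trans (by simp)

theorem countFactorial_le {m n : ℕ} (z : (Fin m → ι) × (Fin n → ι)) :
    countFactorial z ≤ (m.factorial * n.factorial) ^ (m + n) := by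
  refine (Finset.prod_le_pow_card _ _ (m.factorial * n.factorial) fun k _ =>
    Nat.mul_le_mul (Nat.factorial_le (count_le _ _)) (Nat.factorial_le (count_le _ _))).trans ?_
  exact Nat.pow_le_pow_right (Nat.mul_pos (Nat.factorial_pos _) (Nat.factorial_pos _))
    (card_indices_le z)

/-- A finite set containing all pairs of tuples with the same counts as `z`. -/
def classBound {m n : ℕ} (z : (Fin m → ι) × (Fin n → ι)) :
    Finset ((Fin m → ι) × (Fin n → ι)) :=
  Fintype.piFinset (fun _ => indices z) ×ˢ Fintype.piFinset (fun _ => indices z)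

theorem card_classBound_le {m n : ℕ} (z : (Fin m → ι) × (Fin n → ι)) :
    (classBound z).card ≤ (m + n) ^ m * (m + n) ^ n := by
  simp only [classBound, Finset.card_product, Fintype.card_piFinset, Finset.prod_const,
    Finset.card_univ, Fintype.card_fin]
  exact Nat.mul_le_mul (Nat.pow_le_pow_left (card_indices_le z) _)
    (Nat.pow_le_pow_left (card_indices_le z) _)

theorem SameCounts.mem_classBound {m n : ℕ} {z w : (Fin m → ι) × (Fin n → ι)}
    (h : SameCounts z w) : w ∈ classBound z := by
  simp only [classBound, Finset.mem_product, Fintype.mem_piFinset]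
  constructor <;> intro s <;> by_contra hk <;> have h0 := count_eq_zero_of_notMem hk
  · rw [h.1] at h0
    exact count_ne_zero_iff.2 ⟨s, rfl⟩ h0.1
  · rw [h.2] at h0
    exact count_ne_zero_iff.2 ⟨s, rfl⟩ h0.2

theorem hermiteProd_eq_prod {Ω : Type*} (e : HilbertBasis ι ℂ H) (Z : H → Ω → ℂ) {m n : ℕ}
    (z : (Fin m → ι) × (Fin n → ι)) {S : Finset ι} (hS : indices z ⊆ S) (ω : Ω) :
    hermiteProd e Z z.1 z.2 ω =
      ∏ k ∈ S, hermiteJ (count z.1 k) (count z.2 k) (Z (e k) ω) 1 := by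
  refine Finset.prod_subset hS fun k _ hk => ?_
  change hermiteJ (count z.1 k) (count z.2 k) _ 1 = 1
  rw [(count_eq_zero_of_notMem hk).1, (count_eq_zero_of_notMem hk).2, hermiteJ_zero_zero]

theorem measurable_hermiteJ (a b : ℕ) : Measurable fun z : ℂ => hermiteJ a b z 1 := by
  unfold hermiteJ
  fun_prop

open Classical in
-- By independence the integral factorizes over the indices, and a factor whose counts disagree
-- vanishes. Conjugation swaps the two Hermite indices, which is why a pairing without conjugates
-- suffices.
theorem integral_conj_hermiteProd_mul (hZ : IsComplexIsonormal Z P) (e : HilbertBasis ι ℂ H)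
    {m n : ℕ} (z w : (Fin m → ι) × (Fin n → ι)) :
    ∫ ω, conj (hermiteProd e Z z.1 z.2 ω) * hermiteProd e Z w.1 w.2 ω ∂P =
      if SameCounts z w then (countFactorial z : ℂ) else 0 := by
  obtain ⟨S, hSz, hSw, hS⟩ : ∃ S : Finset ι, indices z ⊆ S ∧ indices w ⊆ S ∧
      ∀ k ∉ S, k ∉ indices z ∧ k ∉ indices w :=
    ⟨indices z ∪ indices w, Finset.subset_union_left, Finset.subset_union_right,
      fun k hk => by simpa using hk⟩
  have he : ∀ ω, conj (hermiteProd e Z z.1 z.2 ω) * hermiteProd e Z w.1 w.2 ω =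
      ∏ k : S, (fun x => hermiteJ (count z.2 k) (count z.1 k) x 1 *
        hermiteJ (count w.1 k) (count w.2 k) x 1) (Z (e k) ω) := fun ω => by
    rw [hermiteProd_eq_prod e Z z hSz,
      hermiteProd_eq_prod e Z w hSw, map_prod, ← Finset.prod_mul_distrib,
      ← Finset.prod_coe_sort]
    simp only [conj_hermiteJ]
  rw [integral_congr_ae (ae_of_all _ he)]
  have hind := (hZ.iIndepFun e).precomp (g := fun k : S => (k : ι)) Subtype.val_injective
  refine (hind.integral_fun_prod_comp (fun k => hZ.gaussian.aemeasurable _) fun k =>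
    ((measurable_hermiteJ _ _).mul (measurable_hermiteJ _ _)).aestronglyMeasurable).trans
    ((Finset.prod_congr rfl fun k _ => hZ.integral_hermiteJ_mul (e.orthonormal.1 _) _ _ _ _).trans
    ?_)
  rw [Finset.prod_coe_sort S fun k => if count z.2 k = count w.2 k ∧ count z.1 k = count w.1 k
    then ((count z.2 k).factorial : ℂ) * (count z.1 k).factorial else 0]
  split_ifs with h
  · have hzw : ∀ k, count z.2 k = count w.2 k ∧ count z.1 k = count w.1 k := fun k =>
      ⟨congrFun h.2 k, congrFun h.1 k⟩
    simp only [hzw, countFactorial]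
    push_cast
    refine (Finset.prod_subset hSz fun k _ hk => ?_).symm.trans ?_
    · have := count_eq_zero_of_notMem hk
      simp [← (hzw k).1, ← (hzw k).2, this.1, this.2]
    · exact Finset.prod_congr rfl fun k _ => by simp [mul_comm]
  · have : ∃ k, ¬ (count z.2 k = count w.2 k ∧ count z.1 k = count w.1 k) := by
      by_contra! hc
      exact h ⟨funext fun k => (hc k).2, funext fun k => (hc k).1⟩
    obtain ⟨k, hk⟩ := this
    refine Finset.prod_eq_zero (i := k) ?_ (if_neg hk)
    by_contra hkS
    have h1 := count_eq_zero_of_notMem (hS k hkS).1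
    have h2 := count_eq_zero_of_notMem (hS k hkS).2
    exact hk ⟨h1.2.trans h2.2.symm, h1.1.trans h2.1.symm⟩

end

/-! ### Injectivity of the integral and the kernel of the conjugate -/

section

variable {H : Type*} [NormedAddCommGroup H] [InnerProductSpace ℂ H] {ι : Type*}
  {Ω : Type*} [MeasurableSpace Ω] {Z : H → Ω → ℂ} {P : Measure Ω} {m n : ℕ}

/-- The integral of a basis vector, as an element of `L²`. -/
def basisIntegral (hZ : IsComplexIsonormal Z P) (e : HilbertBasis ι ℂ H)
    (z : (Fin m → ι) × (Fin n → ι)) : Lp ℂ 2 P :=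
  (memLp_hermiteProd hZ e z.1 z.2).toLp

open Classical in
theorem inner_basisIntegral (hZ : IsComplexIsonormal Z P) (e : HilbertBasis ι ℂ H)
    (z w : (Fin m → ι) × (Fin n → ι)) :
    inner ℂ (basisIntegral hZ e z) (basisIntegral hZ e w) =
      if SameCounts z w then (countFactorial z : ℂ) else 0 := by
  rw [MeasureTheory.L2.inner_def, ← integral_conj_hermiteProd_mul hZ e z w]
  refine integral_congr_ae ?_
  filter_upwards [(memLp_hermiteProd hZ e z.1 z.2).coeFn_toLp,
    (memLp_hermiteProd hZ e w.1 w.2).coeFn_toLp] with ω h1 h2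
  simp only [basisIntegral, h1, h2, RCLike.inner_apply]
  ring

/-- The Gram matrix of the basis integrals is block diagonal; block sizes and entries are bounded in
terms of `m` and `n`, so its quadratic form is bounded on `ℓ²`. -/
theorem norm_sum_smul_basisIntegral_sq_le (hZ : IsComplexIsonormal Z P)
    (e : HilbertBasis ι ℂ H) (f : (Fin m → ι) × (Fin n → ι) → ℂ)
    (s : Finset ((Fin m → ι) × (Fin n → ι))) :
    ‖∑ z ∈ s, f z • basisIntegral hZ e z‖ ^ 2 ≤
      ((m.factorial * n.factorial) ^ (m + n) * ((m + n) ^ m * (m + n) ^ n) : ℕ) *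
        ∑ z ∈ s, ‖f z‖ ^ 2 := by
  classical
  set A : ℕ := (m.factorial * n.factorial) ^ (m + n)
  set B : ℕ := (m + n) ^ m * (m + n) ^ n
  have hcard : ∀ z : (Fin m → ι) × (Fin n → ι),
      ((s.filter fun w => SameCounts z w).card : ℝ) ≤ B := fun z => by
    refine Nat.cast_le.2 ((Finset.card_le_card fun w hw => ?_).trans (card_classBound_le z))
    exact (Finset.mem_filter.1 hw).2.mem_classBound
  have h1 : ‖∑ z ∈ s, f z • basisIntegral hZ e z‖ ^ 2 ≤
      ∑ z ∈ s, ∑ w ∈ s, if SameCounts z w then (A : ℝ) * ((‖f z‖ ^ 2 + ‖f w‖ ^ 2) / 2) else 0 := by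
    have h0 : ((‖∑ z ∈ s, f z • basisIntegral hZ e z‖ ^ 2 : ℝ) : ℂ) =
        ∑ z ∈ s, ∑ w ∈ s, conj (f z) * (f w * if SameCounts z w then (countFactorial z : ℂ) else 0) := by
      push_cast
      rw [← RCLike.ofReal_eq_complex_ofReal, ← inner_self_eq_norm_sq_to_K (𝕜 := ℂ), sum_inner]
      refine Finset.sum_congr rfl fun z _ => ?_
      rw [inner_sum]
      refine Finset.sum_congr rfl fun w _ => ?_
      rw [inner_smul_left, inner_smul_right, inner_basisIntegral]
    have h2 := congrArg norm h0
    rw [Complex.norm_real, norm_pow, norm_norm] at h2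
    rw [h2]
    refine (norm_sum_le _ _).trans (Finset.sum_le_sum fun z _ => (norm_sum_le _ _).trans
      (Finset.sum_le_sum fun w _ => ?_))
    split_ifs
    · rw [norm_mul, norm_mul, RCLike.norm_conj, Complex.norm_natCast]
      have hA : (countFactorial z : ℝ) ≤ A := Nat.cast_le.2 (countFactorial_le z)
      have hm : ‖f z‖ * ‖f w‖ ≤ (‖f z‖ ^ 2 + ‖f w‖ ^ 2) / 2 := by
        nlinarith [sq_nonneg (‖f z‖ - ‖f w‖)]
      calc ‖f z‖ * (‖f w‖ * countFactorial z) = countFactorial z * (‖f z‖ * ‖f w‖) := by ring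
        _ ≤ _ := by gcongr
    · simp
  refine h1.trans ?_
  have h3 : ∀ z w, (if SameCounts z w then (A : ℝ) * ((‖f z‖ ^ 2 + ‖f w‖ ^ 2) / 2) else 0) =
      (if SameCounts z w then (A : ℝ) * (‖f z‖ ^ 2 / 2) else 0) +
      (if SameCounts w z then (A : ℝ) * (‖f w‖ ^ 2 / 2) else 0) := fun z w => by
    by_cases h : SameCounts z w
    · rw [if_pos h, if_pos h, if_pos h.symm]; ring
    · rw [if_neg h, if_neg h, if_neg fun h' => h h'.symm, add_zero]
  have h4 : ∑ z ∈ s, ∑ w ∈ s, (if SameCounts z w then (A : ℝ) * (‖f z‖ ^ 2 / 2) else 0) ≤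
      ∑ z ∈ s, B * (A * (‖f z‖ ^ 2 / 2)) := by
    refine Finset.sum_le_sum fun z _ => ?_
    rw [← Finset.sum_filter, Finset.sum_const, nsmul_eq_mul]
    exact mul_le_mul_of_nonneg_right (hcard z) (by positivity)
  simp only [h3, Finset.sum_add_distrib]
  rw [Finset.sum_comm (f := fun z w => if SameCounts w z then (A : ℝ) * (‖f w‖ ^ 2 / 2) else 0)]
  refine (add_le_add h4 h4).trans (le_of_eq ?_)
  rw [← Finset.sum_add_distrib, Finset.mul_sum]
  refine Finset.sum_congr rfl fun z _ => ?_
  push_cast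
  ring

/-- Without this, the `tsum` defining the integral could be the default value zero. -/
theorem summable_smul_basisIntegral (hZ : IsComplexIsonormal Z P) (e : HilbertBasis ι ℂ H)
    (f : TensorKernel ι (Fin m) (Fin n)) :
    Summable fun z => f z • basisIntegral hZ e z := by
  set C : ℝ := (((m.factorial * n.factorial) ^ (m + n) * ((m + n) ^ m * (m + n) ^ n) : ℕ) : ℝ)
    with hC
  have hC0 : 0 ≤ C := Nat.cast_nonneg _
  have hf : Summable fun z => ‖f z‖ ^ 2 := memlp_two_iff.1 (lp.memℓp f)
  rw [summable_iff_vanishing_norm] at hf ⊢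
  intro ε hε
  obtain ⟨s, hs⟩ := hf (ε ^ 2 / (C + 1)) (by positivity)
  refine ⟨s, fun t ht => ?_⟩
  have h1 := norm_sum_smul_basisIntegral_sq_le hZ e f t
  have h2 := (le_abs_self _).trans_lt (hs t ht)
  rw [lt_div_iff₀ (by positivity)] at h2
  have h3 : 0 ≤ ∑ z ∈ t, ‖f z‖ ^ 2 := Finset.sum_nonneg fun _ _ => by positivity
  refine lt_of_pow_lt_pow_left₀ 2 hε.le (h1.trans_lt ?_)
  rw [← hC]
  nlinarith

theorem TensorKernel.IsSymm.eq_of_sameCounts {f : TensorKernel ι (Fin m) (Fin n)}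
    (hf : f.IsSymm) {z w : (Fin m → ι) × (Fin n → ι)} (h : SameCounts z w) : f z = f w := by
  obtain ⟨σ, hσ⟩ := exists_perm_of_count_eq h.1
  obtain ⟨τ, hτ⟩ := exists_perm_of_count_eq h.2
  have := hf σ τ w.1 w.2
  rwa [hσ, hτ] at this

/-- The integral determines the coordinates of a symmetric kernel. -/
theorem exists_inner_wienerIto (hZ : IsComplexIsonormal Z P) (e : HilbertBasis ι ℂ H)
    (z : (Fin m → ι) × (Fin n → ι)) : ∃ c : ℂ, c ≠ 0 ∧
      ∀ f : TensorKernel ι (Fin m) (Fin n), f.IsSymm →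
        inner ℂ (basisIntegral hZ e z) (wienerIto hZ e m n f) = f z * c := by
  classical
  -- The number of multi-indices with the counts of `z`, times the squared norm of their common
  -- integral; a symmetric kernel is constant on this class.
  refine ⟨((∑ w ∈ classBound z, if SameCounts z w then countFactorial z else 0 : ℕ) : ℂ), ?_,
    fun f hf => ?_⟩
  · refine Nat.cast_ne_zero.2 (ne_of_gt ?_)
    have hz : SameCounts z z := ⟨rfl, rfl⟩
    refine Finset.sum_pos' (fun _ _ => Nat.zero_le _) ⟨z, hz.mem_classBound, ?_⟩
    rw [if_pos hz]
    exact countFactorial_pos z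
  · have hs := (summable_smul_basisIntegral hZ e f).hasSum.mapL
      (innerSL ℂ (basisIntegral hZ e z))
    simp only [innerSL_apply_apply, inner_smul_right, inner_basisIntegral] at hs
    have h1 : ∀ w, (f w * if SameCounts z w then (countFactorial z : ℂ) else 0) =
        f z * if SameCounts z w then (countFactorial z : ℂ) else 0 := fun w => by
      by_cases h : SameCounts z w
      · rw [hf.eq_of_sameCounts h]
      · simp [h]
    simp only [h1] at hs
    have hfin := hasSum_sum_of_ne_finset_zero
      (f := fun w => f z * if SameCounts z w then (countFactorial z : ℂ) else 0)
      (s := classBound z) (L := SummationFilter.unconditional _) fun w hw => by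
        rw [if_neg fun h => hw h.mem_classBound, mul_zero]
    refine (hs.unique hfin).trans ?_
    push_cast
    rw [Finset.mul_sum]

theorem wienerIto_injective (hZ : IsComplexIsonormal Z P) (e : HilbertBasis ι ℂ H)
    {f g : TensorKernel ι (Fin m) (Fin n)} (hf : f.IsSymm) (hg : g.IsSymm)
    (h : wienerIto hZ e m n f = wienerIto hZ e m n g) : f = g := by
  refine lp.ext (funext fun z => ?_)
  obtain ⟨c, hc, hz⟩ := exists_inner_wienerIto hZ e z
  refine mul_right_cancel₀ hc ?_
  rw [← hz f hf, ← hz g hg, h]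

/-- The kernel `(q, p) ↦ conj (f (p, q))`. -/
def adjointKernel (f : TensorKernel ι (Fin m) (Fin n)) : TensorKernel ι (Fin n) (Fin m) :=
  ⟨fun z => conj (f z.swap), by
    change Memℓp (fun z : (Fin n → ι) × (Fin m → ι) => conj (f z.swap)) 2
    have h := memlp_comp (lp.memℓp f) (φ := fun z : (Fin n → ι) × (Fin m → ι) => z.swap)
      Prod.swap_injective
    rw [memlp_two_iff] at h ⊢
    simpa using h⟩

theorem adjointKernel_apply (f : TensorKernel ι (Fin m) (Fin n))
    (z : (Fin n → ι) × (Fin m → ι)) : adjointKernel f z = conj (f z.swap) := rfl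

theorem star_basisIntegral (hZ : IsComplexIsonormal Z P) (e : HilbertBasis ι ℂ H)
    (z : (Fin m → ι) × (Fin n → ι)) :
    star (basisIntegral hZ e z) = basisIntegral hZ e z.swap := by
  classical
  apply Lp.ext
  filter_upwards [Lp.coeFn_star (basisIntegral hZ e z),
    (memLp_hermiteProd hZ e z.1 z.2).coeFn_toLp,
    (memLp_hermiteProd hZ e z.swap.1 z.swap.2).coeFn_toLp] with ω h1 h2 h3
  rw [h1, Pi.star_apply, basisIntegral, basisIntegral, h2, h3,
    hermiteProd_eq_prod e Z z subset_rfl, hermiteProd_eq_prod e Z z.swap (S := indices z)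
      (by simp [indices, Finset.union_comm])]
  change conj _ = _
  rw [map_prod]
  simp only [conj_hermiteJ, Prod.fst_swap, Prod.snd_swap]

theorem star_eq_compLpL (F : Lp ℂ 2 P) :
    star F = (Complex.conjCLE : ℂ →L[ℝ] ℂ).compLpL 2 P F := by
  apply Lp.ext
  filter_upwards [Lp.coeFn_star F,
    ContinuousLinearMap.coeFn_compLpL (p := 2) (Complex.conjCLE : ℂ →L[ℝ] ℂ) F] with ω h1 h2
  rw [h1, h2]
  rfl

theorem star_smul_Lp (c : ℂ) (F : Lp ℂ 2 P) : star (c • F) = conj c • star F := by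
  apply Lp.ext
  filter_upwards [Lp.coeFn_star (c • F), Lp.coeFn_smul c F, Lp.coeFn_smul (conj c) (star F),
    Lp.coeFn_star F] with ω h1 h2 h3 h4
  rw [h1, h3, Pi.star_apply, h2, Pi.smul_apply, Pi.smul_apply, h4, Pi.star_apply, star_smul]
  rfl

/-- Conjugation is continuous and real linear on `L²`, so it passes through the series; on basis
integrals it swaps `p` and `q`. -/
theorem star_wienerIto (hZ : IsComplexIsonormal Z P) (e : HilbertBasis ι ℂ H)
    (f : TensorKernel ι (Fin m) (Fin n)) :
    star (wienerIto hZ e m n f) = wienerIto hZ e n m (adjointKernel f) := by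
  change star (∑' z, f z • basisIntegral hZ e z) =
    ∑' z, adjointKernel f z • basisIntegral hZ e z
  rw [star_eq_compLpL, ((summable_smul_basisIntegral hZ e f).hasSum.mapL
    ((Complex.conjCLE : ℂ →L[ℝ] ℂ).compLpL 2 P)).tsum_eq.symm,
    ← (Equiv.prodComm (Fin n → ι) (Fin m → ι)).tsum_eq]
  refine tsum_congr fun z => ?_
  rw [adjointKernel_apply, ← star_eq_compLpL, star_smul_Lp, star_basisIntegral]
  rfl

/-- The kernel of the conjugate of a multiple integral is the adjoint kernel. -/
theorem isAdj_of_star_wienerIto_eq (hZ : IsComplexIsonormal Z P) (e : HilbertBasis ι ℂ H)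
    {f : TensorKernel ι (Fin m) (Fin n)} {h : TensorKernel ι (Fin n) (Fin m)}
    (hf : f.IsSymm) (hh : h.IsSymm)
    (heq : star (wienerIto hZ e m n f) = wienerIto hZ e n m h) : IsAdj f h := by
  rw [star_wienerIto] at heq
  rw [← wienerIto_injective hZ e (fun σ τ p q => congrArg conj (hf τ σ q p)) hh heq]
  exact fun p q => rfl

end

end ComplexWiener

end

open ComplexWiener
theorem theorem1p1 {H : Type*} [NormedAddCommGroup H] [InnerProductSpace ℂ H] [CompleteSpace H]
    [TopologicalSpace.SeparableSpace H] {ι : Type*} (e : HilbertBasis ι ℂ H)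
    {Ω : Type*} [MeasurableSpace Ω] (P : Measure Ω) (Z : H → Ω → ℂ)
    (hZ : IsComplexIsonormal Z P) (m n : ℕ) (hmn : 2 ≤ m + n)
    (F : ℕ → Lp ℂ 2 P)
    (f : ℕ → TensorKernel ι (Fin m) (Fin n)) (hf : ∀ k, (f k).IsSymm)
    (hF : ∀ k, F k = wienerIto hZ e m n (f k))
    (h : ℕ → TensorKernel ι (Fin n) (Fin m)) (hh : ∀ k, (h k).IsSymm)
    (hFbar : ∀ k, star (F k) = wienerIto hZ e n m (h k)) :
    ((∀ (i j : ℕ) (_ : 0 < i + j) (_ : i + j ≤ m + n - 1)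
        (him : i ≤ m) (hin : i ≤ n) (hjm : j ≤ m) (hjn : j ≤ n),
        Tendsto (fun k => ‖contract i j him hjn hjm hin (f k) (f k)‖) atTop (𝓝 0)) ∧
      (∀ (i j : ℕ) (_ : 0 < i + j) (_ : i + j ≤ m + n - 1) (him : i ≤ m) (hjn : j ≤ n),
        Tendsto (fun k => ‖contract i j him hjn hjn him (f k) (h k)‖) atTop (𝓝 0)))
    ↔
    ((∀ (i j : ℕ) (_ : 0 < i + j) (_ : i + j ≤ m + n - 1)
        (him : i ≤ m) (hin : i ≤ n) (hjm : j ≤ m) (hjn : j ≤ n),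
        Tendsto (fun k => ‖symmetrize (contract i j him hjn hjm hin (f k) (f k))‖) atTop (𝓝 0)) ∧
      (∀ (i j : ℕ) (_ : 0 < i + j) (_ : i + j ≤ m + n - 1) (him : i ≤ m) (hjn : j ≤ n),
        Tendsto (fun k => ‖symmetrize (contract i j him hjn hjn him (f k) (h k))‖)
          atTop (𝓝 0))) := by
  -- This is all that is needed from the probabilistic side; the rest concerns the kernels alone.
  have hadj : ∀ k, IsAdj (f k) (h k) := fun k =>
    isAdj_of_star_wienerIto_eq hZ e (hf k) (hh k) (by rw [← hF k, hFbar k])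
  refine ⟨fun H => ⟨fun i j h0 h1 him hin hjm hjn => ?_, fun i j h0 h1 him hjn => ?_⟩, fun H =>
    tendsto_norm_contract_of_symmetrize hmn hf hadj H.1 H.2⟩
  · exact squeeze_zero (fun k => norm_nonneg _) (fun k => norm_symmetrize_le _)
      (H.1 i j h0 h1 him hin hjm hjn)
  · exact squeeze_zero (fun k => norm_nonneg _) (fun k => norm_symmetrize_le _)
      (H.2 i j h0 h1 him hjn)
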